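/- **Theorem 1 (Run-Time Complexity for Arbitrary DMDP).** Let $\mathcal M=(\mathcal S,\mathcal A,\mathcal P,\mathbf r,\gamma)$ be a discounted Markov decision problem with finite non-empty state and action sets, transition probabilities $p_{ij}(a)$, rewards $r_{ij}(a)\in[0,1]$ and $\gamma\in(0,1)$. For a stationary randomized policy $\pi=(\pi_i)_{i\in\mathcal S}$ let $v^\pi(i)=\mathbf E^\pi\big[\sum_{t\ge0}\gamma^t r_{i_ti_{t+1}}(a_t)\mid i_0=i\big]$, let $v^*(i)=\max_\pi v^\pi(i)$, and put $\mathbf q=\frac1{|\mathcal S|}\mathbf e$, $\theta=1-\gamma$. *Algorithm 1* (input $\mathcal M$, $T\ge1$). Put $\mathbf v=0$, $\xi=\frac1{|\mathcal S|}\mathbf e$, $\pi_i=\frac1{|\mathcal A|}\mathbf e$ for all $i$, $M=\frac1{1-\gamma}$, $\beta=(1-\gamma)\sqrt{\frac{\log(|\mathcal S||\mathcal A|+1)}{2|\mathcal S||\mathcal A|T}}$, $\alpha=\frac{|\mathcal S|}{2(1-\gamma)^2}\beta$. For $t=1,\dots,T$: let $\pi^t$ be the current $\pi$; sample $i$ with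 probability $w_i=(1-\theta)\xi_i+\theta q_i$, then $a$ with probability $\pi_{i,a}$, then $j$ with probability $p_{ij}(a)$; put $\Delta=\beta\,\frac{\gamma v_j-v_i+r_{ij}(a)-M}{w_i\pi_{i,a}}$; then update, in this order, $v_i\leftarrow\max\{\min\{v_i-\alpha(\frac{(1-\gamma)q_i}{w_i}-1),\frac1{1-\gamma}\},0\}$, $v_j\leftarrow\max\{\min\{v_j-\alpha\gamma,\frac1{1-\gamma}\},0\}$, $\xi_i\leftarrow\xi_i+\xi_i\pi_{i,a}(e^\Delta-1)$, $\xi\leftarrow\xi/\|\xi\|_1$, $\pi_{i,a}\leftarrow\pi_{i,a}e^\Delta$, $\pi_i\leftarrow\pi_i/\|\pi_i\|_1$. Output $\hat\pi=\frac1T\sum_{t=1}^T\pi^t$. *Algorithm 2* (input $\mathcal M,\epsilon,\delta,T,K$ with $K\ge1$). Run Algorithm 1 independently $K$ times with $T$ iterations, giving $\pi^{(1)},\dots,\pi^{(K)}$; apply, independently for each $k$, a randomized policy evaluation subroutine that for every policy $\pi$ returns an estimate in $[\mathbf q^\top v^\pi-\frac\epsilon2,\ \mathbf q^\top v^\pi]$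 with probability at least $1-\frac{\delta}{2K}$; output the policy $\pi^{(k)}$ with the largest estimate. Write $X(\epsilon)=\frac{|\mathcal S|^3|\mathcal A|\log(|\mathcal S||\mathcal A|)}{(1-\gamma)^6\epsilon^2}$. There is an absolute constant $C>0$ such that for all such $\mathcal M$ and all $\epsilon,\delta\in(0,1)$: (i) If $T\ge C\,X(\epsilon)$, $T\ge1$, then Algorithm 1 outputs a policy $\hat\pi$ such that, with probability at least $2/3$, $v^{\hat\pi}(i)\ge v^*(i)-\epsilon$ for all $i\in\mathcal S$. (ii) If $T\ge C\,X(\epsilon/2)$ and $K\ge C\log\frac1\delta$ with $T,K\ge1$, then Algorithm 2 (with any evaluation subroutine as above) outputs a policy $\hat\pi$ such that $\mathbf q^\top v^{\hat\pi}\ge\mathbf q^\top v^*-\epsilon$ with probability at least $1-\delta$. Moreover, for $T$ and $K$ of these orders, i.e. also $T\le B(1+X(\epsilon/2))$ and $K\le B\log\frac2\delta$ for a constant $B$, Algorithm 2 with a suitable evaluation subroutine is implemented, exactly in law, by a single program for a real random access machine with uniform random numbers in $[0,1]$ (unit cost for each access to an input entry or to memory, arithmetic operation, exponential, logarithm, square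 root, comparison and random draw), whose run time is always at most $$D\,\Big(1+\log\tfrac{|\mathcal S||\mathcal A|}{\epsilon(1-\gamma)}\Big)^{k}\Big(|\mathcal S|^2|\mathcal A|+\frac{|\mathcal S|^3|\mathcal A|}{(1-\gamma)^6\epsilon^2}\log\frac2\delta+\frac{1}{\epsilon^2(1-\gamma)^2}\Big(\log\frac2\delta\Big)^2\Big),$$ where $k$ is an absolute constant and $D$ depends only on $B$. -/

import Mathlib

open MeasureTheory ProbabilityTheory
open scoped ENNReal

noncomputable section

/-! ## Discounted Markov decision problems -/

/-- A discounted Markov decision problem with `n` states and `m` actions: transition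
probabilities `p i a j`, rewards `r i a j ∈ [0, 1]`, discount factor `γ ∈ (0, 1)`. -/
structure DMDP (n m : ℕ) where
  p : Fin n → Fin m → stdSimplex ℝ (Fin n)
  r : Fin n → Fin m → Fin n → ℝ
  r_mem : ∀ i a j, r i a j ∈ Set.Icc (0 : ℝ) 1
  γ : ℝ
  γ_mem : γ ∈ Set.Ioo (0 : ℝ) 1

/-- Stationary randomized policies: a probability vector over actions for every state. -/
abbrev Policy (n m : ℕ) : Type := Fin n → stdSimplex ℝ (Fin m)

/-- The probability mass function of a probability vector. -/
def vecPMF {k : ℕ} (x : stdSimplex ℝ (Fin k)) : PMF (Fin k) :=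
  PMF.ofFintype (fun a => ENNReal.ofReal (x a)) (by
    have h : ∑ a, x a = 1 := x.2.2
    have h0 : ∀ a ∈ Finset.univ, 0 ≤ x a := fun a _ => x.2.1 a
    rw [← ENNReal.ofReal_sum_of_nonneg h0, h, ENNReal.ofReal_one])

/-- The uniform probability vector. -/
def unifVec (k : ℕ) [NeZero k] : stdSimplex ℝ (Fin k) :=
  ⟨fun _ => 1 / (k : ℝ), fun _ => by positivity, by
    have : (k : ℝ) ≠ 0 := Nat.cast_ne_zero.mpr (NeZero.ne k)
    simp [this]⟩

namespace DMDP

variable {n m : ℕ} (M : DMDP n m)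

/-- One transition of the state-action process under `π`: from `(i, a)`, draw the next state `j`
from `p i a`, then the next action from `π j`. -/
def stepPMF (π : Policy n m) (x : Fin n × Fin m) : PMF (Fin n × Fin m) :=
  (vecPMF (M.p x.1 x.2)).bind fun j => (vecPMF (π j)).map fun a => (j, a)

/-- The transition kernel of the state-action process under `π`. -/
def stepKernel (π : Policy n m) : Kernel (Fin n × Fin m) (Fin n × Fin m) :=
  Kernel.ofFunOfCountable fun x => (M.stepPMF π x).toMeasure

instance (π : Policy n m) : IsMarkovKernel (M.stepKernel π) :=
  ⟨fun x => by
    change IsProbabilityMeasure (M.stepPMF π x).toMeasure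
    infer_instance⟩

/-- The transition kernel at time `t`, as a kernel from the history up to time `t` (it only uses
the last state-action pair). -/
def histKernel (π : Policy n m) (t : ℕ) :
    Kernel (∀ _ : Finset.Iic t, Fin n × Fin m) (Fin n × Fin m) :=
  (M.stepKernel π).comap (fun h => h ⟨t, Finset.mem_Iic.mpr le_rfl⟩) (measurable_pi_apply _)

instance (π : Policy n m) (t : ℕ) : IsMarkovKernel (M.histKernel π t) := by
  unfold histKernel
  infer_instance

/-- The law of the infinite state-action trajectory generated by `π` from the initial state `i`. -/
def pathMeasure (π : Policy n m) (i : Fin n) : Measure (ℕ → Fin n × Fin m) :=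
  Kernel.trajMeasure (X := fun _ => Fin n × Fin m)
    (((vecPMF (π i)).map fun a => (i, a)).toMeasure) (M.histKernel π)

/-- The value of `π` at `i`: the expected infinite-horizon sum of discounted rewards. -/
def value (π : Policy n m) (i : Fin n) : ℝ :=
  ∫ ω, ∑' t : ℕ, M.γ ^ t * M.r (ω t).1 (ω t).2 (ω (t + 1)).1 ∂(M.pathMeasure π i)

/-- The optimal value at `i`. -/
def optValue (i : Fin n) : ℝ := ⨆ π : Policy n m, M.value π i

/-! ## The randomized primal-dual method -/

/-- Clipping to the interval `[0, 1 / (1 - γ)]`. -/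
def clip (x : ℝ) : ℝ := max (min x (1 / (1 - M.γ))) 0

/-- The parameter `θ = 1 - γ`. -/
def θ : ℝ := 1 - M.γ

/-- The weight vector `q`, uniform over the states. -/
def q (_ : DMDP n m) [NeZero n] : stdSimplex ℝ (Fin n) := unifVec n

/-- The dual step size, for `T` iterations. -/
def β (T : ℕ) : ℝ :=
  (1 - M.γ) * Real.sqrt (Real.log ((n : ℝ) * m + 1) / (2 * ((n : ℝ) * m * T)))

/-- The primal step size, for `T` iterations. -/
def α (T : ℕ) : ℝ := (n : ℝ) / (2 * (1 - M.γ) ^ 2) * M.β T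

end DMDP

/-- Normalization `w / ‖w‖₁` of a nonnegative nonzero weight vector. -/
def normalizeVec {k : ℕ} (w : Fin k → ℝ) (h0 : ∀ a, 0 ≤ w a) (hpos : 0 < ∑ a, w a) :
    stdSimplex ℝ (Fin k) :=
  ⟨fun a => w a / ∑ b, w b, fun a => div_nonneg (h0 a) hpos.le, by
    rw [← Finset.sum_div, div_self hpos.ne']⟩

theorem update_mul_nonneg {k : ℕ} (x : stdSimplex ℝ (Fin k)) (i : Fin k) {c : ℝ} (hc : 0 < c)
    (a : Fin k) : 0 ≤ Function.update (fun b => x b) i (x i * c) a := by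
  have hx : ∀ b, 0 ≤ x b := x.2.1
  by_cases h : a = i
  · subst h
    simpa only [Function.update_self] using mul_nonneg (hx a) hc.le
  · simpa only [Function.update_of_ne h] using hx a

theorem sum_update_mul_pos {k : ℕ} (x : stdSimplex ℝ (Fin k)) (i : Fin k) {c : ℝ} (hc : 0 < c) :
    0 < ∑ a, Function.update (fun b => x b) i (x i * c) a := by
  have hnn := update_mul_nonneg x i hc
  refine lt_of_le_of_ne (Finset.sum_nonneg fun a _ => hnn a) fun h => ?_
  have hz := (Finset.sum_eq_zero_iff_of_nonneg fun a _ => hnn a).mp h.symm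
  have hx : ∀ a, x a = 0 := by
    intro a
    have ha := hz a (Finset.mem_univ a)
    by_cases h : a = i
    · subst h
      simpa [hc.ne'] using ha
    · simpa [h] using ha
  have h1 : ∑ a, x a = 1 := x.2.2
  simp [hx] at h1

/-- The update `x i ← x i * c`, `x ← x / ‖x‖₁` of a probability vector, for a factor `c > 0`. -/
def scaleAt {k : ℕ} (x : stdSimplex ℝ (Fin k)) (i : Fin k) (c : ℝ) (hc : 0 < c) :
    stdSimplex ℝ (Fin k) :=
  normalizeVec (Function.update (fun b => x b) i (x i * c))
    (update_mul_nonneg x i hc) (sum_update_mul_pos x i hc)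

theorem dual_factor_pos {k : ℕ} (x : stdSimplex ℝ (Fin k)) (a : Fin k) (Δ : ℝ) :
    0 < 1 + x a * (Real.exp Δ - 1) := by
  have h0 : 0 ≤ x a := x.2.1 a
  have h1 : x a ≤ 1 := by
    have hs : ∑ b, x b = 1 := x.2.2
    rw [← hs]
    exact Finset.single_le_sum (f := fun b => x b) (fun b _ => x.2.1 b) (Finset.mem_univ a)
  have he := Real.exp_pos Δ
  rcases h1.lt_or_eq with h | h
  · nlinarith [mul_nonneg h0 he.le]
  · rw [h]
    linarith

/-- The iterates: value vector `v`, distribution `ξ` over states, policy `π`. -/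
structure Iterate (n m : ℕ) where
  v : Fin n → ℝ
  ξ : stdSimplex ℝ (Fin n)
  π : Policy n m

namespace DMDP

variable {n m : ℕ} (M : DMDP n m)

/-- Initial iterate. -/
def initIterate (_ : DMDP n m) [NeZero n] [NeZero m] : Iterate n m :=
  ⟨fun _ => 0, unifVec n, fun _ => unifVec m⟩

/-- The sampling distribution `(1 - θ) ξ + θ q` over states. -/
def mixVec [NeZero n] (ξ : stdSimplex ℝ (Fin n)) : stdSimplex ℝ (Fin n) :=
  ⟨fun i => (1 - M.θ) * ξ i + M.θ * M.q i, by
    have hθ0 : 0 ≤ M.θ := sub_nonneg.mpr M.γ_mem.2.le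
    have hθ1 : 0 ≤ 1 - M.θ := by
      have := M.γ_mem.1
      simp only [θ]
      linarith
    exact convex_stdSimplex ℝ (Fin n) ξ.2 M.q.2 hθ1 hθ0 (by ring)⟩

/-- The exponent `Δ` of the multiplicative update for the sample `(i, a, j)`. -/
def dualStep [NeZero n] (T : ℕ) (x : Iterate n m) (i : Fin n) (a : Fin m) (j : Fin n) : ℝ :=
  M.β T * ((M.γ * x.v j - x.v i + M.r i a j - 1 / (1 - M.γ)) / (M.mixVec x.ξ i * x.π i a))

/-- The update of the value vector for the sample `(i, j)`: first coordinate `i`,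
then coordinate `j`. -/
def primalUpdate [NeZero n] (T : ℕ) (x : Iterate n m) (i j : Fin n) : Fin n → ℝ :=
  let v₁ := Function.update x.v i
    (M.clip (x.v i - M.α T * ((1 - M.γ) * M.q i / M.mixVec x.ξ i - 1)))
  Function.update v₁ j (M.clip (v₁ j - M.α T * M.γ))

/-- All updates of one iteration for the sample `(i, a, j)`. The update of `ξ` is
`ξ i ← ξ i + ξ i * π i a * (exp Δ - 1)`, `ξ ← ξ / ‖ξ‖₁`. -/
def update [NeZero n] (T : ℕ) (x : Iterate n m) (i : Fin n) (a : Fin m) (j : Fin n) :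
    Iterate n m :=
  let Δ := M.dualStep T x i a j
  { v := M.primalUpdate T x i j
    ξ := scaleAt x.ξ i (1 + x.π i a * (Real.exp Δ - 1)) (dual_factor_pos (x.π i) a Δ)
    π := Function.update x.π i (scaleAt (x.π i) a (Real.exp Δ) (Real.exp_pos Δ)) }

/-- One randomized iteration (of a run of `T` iterations). -/
def iteration [NeZero n] (T : ℕ) (x : Iterate n m) : PMF (Iterate n m) :=
  (vecPMF (M.mixVec x.ξ)).bind fun i =>
    (vecPMF (x.π i)).bind fun a =>
      (vecPMF (M.p i a)).map fun j => M.update T x i a j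

/-- The joint law of the iterate after `t` iterations and of the policies `π¹, …, πᵗ`, where `πˢ`
is the policy at the start of iteration `s`. -/
def runPMF [NeZero n] [NeZero m] (T : ℕ) :
    (t : ℕ) → PMF (Iterate n m × (Fin t → Policy n m))
  | 0 => PMF.pure (M.initIterate, Fin.elim0)
  | t + 1 => (runPMF T t).bind fun x =>
      (M.iteration T x.1).map fun y => (y, Fin.snoc x.2 x.1.π)

end DMDP

/-- The average of `T` policies. -/
def avgPolicy {n m T : ℕ} [NeZero T] (h : Fin T → Policy n m) : Policy n m := fun i =>
  ⟨fun a => 1 / (T : ℝ) * ∑ t, h t i a, fun a =>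
    mul_nonneg (by positivity) (Finset.sum_nonneg fun t _ => (h t i).2.1 a), by
    have hT : (T : ℝ) ≠ 0 := Nat.cast_ne_zero.mpr (NeZero.ne T)
    have hs : ∀ t, ∑ a, h t i a = 1 := fun t => (h t i).2.2
    rw [← Finset.mul_sum, Finset.sum_comm]
    simp [hs, hT]⟩

/-- Law of the output policy of the randomized primal-dual method with `T` iterations. -/
def DMDP.primalDual {n m : ℕ} (M : DMDP n m) [NeZero n] [NeZero m] (T : ℕ) [NeZero T] :
    PMF (Policy n m) :=
  (M.runPMF T T).map fun x => avgPolicy x.2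

/-! ## The meta algorithm -/

/-- Independent draws from the laws `μ 0, …, μ (K - 1)`. -/
def indepPMF {E : Type} : (K : ℕ) → (Fin K → PMF E) → PMF (Fin K → E)
  | 0, _ => PMF.pure Fin.elim0
  | K + 1, μ => (μ 0).bind fun x =>
      (indepPMF K fun k => μ k.succ).map fun y => (Fin.cons x y : Fin (K + 1) → E)

/-- The first index at which `y` is maximal. -/
def argmaxIdx {K : ℕ} [NeZero K] (y : Fin K → ℝ) : Fin K :=
  (Finset.univ.filter fun k => ∀ l, y l ≤ y k).min' (by
    obtain ⟨k, -, hk⟩ := Finset.exists_max_image Finset.univ y ⟨0, Finset.mem_univ 0⟩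
    exact ⟨k, by simpa using hk⟩)

namespace DMDP

variable {n m : ℕ} (M : DMDP n m)

/-- `qᵀ v^π`. -/
def weightedValue [NeZero n] (π : Policy n m) : ℝ := ∑ i, M.q i * M.value π i

/-- `qᵀ v^*`. -/
def weightedOptValue [NeZero n] : ℝ := ∑ i, M.q i * M.optValue i

/-- A randomized policy evaluation subroutine (mapping a policy to the law of an estimate of
`qᵀ v^π`) has precision `η` and failure probability `ρ` if for every policy the estimate lies in
`[qᵀ v^π - η, qᵀ v^π]` with probability at least `1 - ρ`. -/
def IsEvaluator [NeZero n] (ev : Policy n m → PMF ℝ) (η ρ : ℝ) : Prop :=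
  ∀ π, ENNReal.ofReal (1 - ρ) ≤
    (ev π).toOuterMeasure (Set.Icc (M.weightedValue π - η) (M.weightedValue π))

/-- Law of the output policy of the meta algorithm: `K` independent runs of the primal-dual method
with `T` iterations each, an evaluation of each of the resulting policies by the subroutine `ev`,
and selection of the policy with the largest estimate. -/
def metaAlg [NeZero n] [NeZero m] (T K : ℕ) [NeZero T] [NeZero K] (ev : Policy n m → PMF ℝ) :
    PMF (Policy n m) :=
  (indepPMF K fun _ => M.primalDual T).bind fun π =>
    (indepPMF K fun k => ev (π k)).map fun y => π (argmaxIdx y)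

end DMDP

/-! ## Programs for a randomized real RAM, and their run time

A machine has natural-number registers, used for indexing and counting, and real arrays with
indirect addressing, and can draw uniform random numbers from `[0, 1]`. All constants in a program
are natural numbers. Every literal, every access to a register or to an array entry, every
arithmetic operation, every test, every draw and every loop iteration costs one unit. Loops are
bounded by a number computed before the loop is entered, so every program halts. -/

/-- Natural-number expressions (subtraction is truncated, division rounds down). -/
inductive NExpr where
  | lit (k : ℕ)
  | reg (x : ℕ)
  | add (e f : NExpr)
  | sub (e f : NExpr)
  | mul (e f : NExpr)
  | div (e f : NExpr)

/-- Real expressions; `get b e` is the entry at index `e` of the array `b`. -/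
inductive RExpr where
  | cast (e : NExpr)
  | get (b : ℕ) (e : NExpr)
  | add (e f : RExpr)
  | sub (e f : RExpr)
  | mul (e f : RExpr)
  | div (e f : RExpr)
  | exp (e : RExpr)
  | log (e : RExpr)
  | sqrt (e : RExpr)

/-- Programs. -/
inductive Prog where
  | skip
  /-- assignment to the natural-number register `x` -/
  | setN (x : ℕ) (e : NExpr)
  /-- assignment to the entry at index `e` of the array `b` -/
  | setR (b : ℕ) (e : NExpr) (f : RExpr)
  /-- store a fresh uniform random number at index `e` of the array `b` -/
  | draw (b : ℕ) (e : NExpr)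
  | seq (c d : Prog)
  /-- if `e < f` then `c` else `d` -/
  | ifN (e f : NExpr) (c d : Prog)
  /-- if `e < f` then `c` else `d` -/
  | ifR (e f : RExpr) (c d : Prog)
  /-- evaluate `e` and repeat `c` that many times -/
  | loop (e : NExpr) (c : Prog)

/-- Machine states: registers, arrays, the stream of random numbers not yet used, and the number
of operations performed. -/
structure MState where
  nreg : ℕ → ℕ
  arr : ℕ → ℕ → ℝ
  tape : ℕ → unitInterval
  time : ℕ

namespace NExpr

def eval (s : MState) : NExpr → ℕ
  | lit k => k
  | reg x => s.nreg x
  | add e f => e.eval s + f.eval s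
  | sub e f => e.eval s - f.eval s
  | mul e f => e.eval s * f.eval s
  | div e f => e.eval s / f.eval s

def cost : NExpr → ℕ
  | lit _ => 1
  | reg _ => 1
  | add e f => e.cost + f.cost + 1
  | sub e f => e.cost + f.cost + 1
  | mul e f => e.cost + f.cost + 1
  | div e f => e.cost + f.cost + 1

end NExpr

namespace RExpr

def eval (s : MState) : RExpr → ℝ
  | cast e => (e.eval s : ℝ)
  | get b e => s.arr b (e.eval s)
  | add e f => e.eval s + f.eval s
  | sub e f => e.eval s - f.eval s
  | mul e f => e.eval s * f.eval s
  | div e f => e.eval s / f.eval s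
  | exp e => Real.exp (e.eval s)
  | log e => Real.log (e.eval s)
  | sqrt e => Real.sqrt (e.eval s)

def cost : RExpr → ℕ
  | cast e => e.cost + 1
  | get _ e => e.cost + 1
  | add e f => e.cost + f.cost + 1
  | sub e f => e.cost + f.cost + 1
  | mul e f => e.cost + f.cost + 1
  | div e f => e.cost + f.cost + 1
  | exp e => e.cost + 1
  | log e => e.cost + 1
  | sqrt e => e.cost + 1

end RExpr

namespace MState

/-- Count `k` operations. -/
def tick (s : MState) (k : ℕ) : MState := { s with time := s.time + k }

def writeN (s : MState) (x k : ℕ) : MState := { s with nreg := Function.update s.nreg x k }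

def writeR (s : MState) (b k : ℕ) (y : ℝ) : MState :=
  { s with arr := Function.update s.arr b (Function.update (s.arr b) k y) }

end MState

/-- Execution of a program. -/
def Prog.exec : Prog → MState → MState
  | skip, s => s.tick 1
  | setN x e, s => (s.writeN x (e.eval s)).tick (e.cost + 1)
  | setR b e f, s => (s.writeR b (e.eval s) (f.eval s)).tick (e.cost + f.cost + 1)
  | draw b e, s =>
      ({ s.writeR b (e.eval s) (s.tape 0) with tape := fun k => s.tape (k + 1) }).tick (e.cost + 1)
  | seq c d, s => d.exec (c.exec s)
  | ifN e f c d, s =>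
      if e.eval s < f.eval s then c.exec (s.tick (e.cost + f.cost + 1))
      else d.exec (s.tick (e.cost + f.cost + 1))
  | ifR e f c d, s =>
      open Classical in
      if e.eval s < f.eval s then c.exec (s.tick (e.cost + f.cost + 1))
      else d.exec (s.tick (e.cost + f.cost + 1))
  | loop e c, s => (fun s' => c.exec (s'.tick 1))^[e.eval s] (s.tick (e.cost + 1))

/-- The law of an infinite sequence of independent uniform random numbers from `[0, 1]`. -/
def tapeMeasure : Measure (ℕ → unitInterval) :=
  Measure.infinitePi fun _ => (volume : Measure unitInterval)

/-- The array with entry `f i a j` at index `j + n * (a + m * i)`, and zeros afterwards. -/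
def flatten {n m : ℕ} (f : Fin n → Fin m → Fin n → ℝ) (k : ℕ) : ℝ :=
  if h : k < n * m * n then
    let x := finProdFinEquiv.symm (⟨k, h⟩ : Fin (n * m * n))
    let y := finProdFinEquiv.symm x.1
    f y.1 y.2 x.2
  else 0

/-- Initial machine state for the meta algorithm: registers `0, 1, 2, 3` hold `n, m, T, K`; array
`0` holds the transition probabilities, array `1` the rewards, array `2` the numbers `γ, ε, δ`;
everything else is zero. -/
def DMDP.inputState {n m : ℕ} (M : DMDP n m) (ε δ : ℝ) (T K : ℕ) (ω : ℕ → unitInterval) :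
    MState where
  nreg x := match x with
    | 0 => n
    | 1 => m
    | 2 => T
    | 3 => K
    | _ => 0
  arr b := match b with
    | 0 => flatten fun i a j => M.p i a j
    | 1 => flatten M.r
    | 2 => fun k => match k with
      | 0 => M.γ
      | 1 => ε
      | 2 => δ
      | _ => 0
    | _ => fun _ => 0
  tape := ω
  time := 0

/-- The output of a computation: array `3`, whose entry at index `a + m * i` is the probability of
action `a` in state `i`. -/
def MState.output (n m : ℕ) (s : MState) : Fin n → Fin m → ℝ :=
  fun i a => s.arr 3 ((a : ℕ) + m * (i : ℕ))

/-- The program `c`, started with the given input, outputs a random policy with law `μ`. -/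
def Prog.OutputsPolicy (c : Prog) {n m : ℕ} (input : (ℕ → unitInterval) → MState)
    (μ : PMF (Policy n m)) : Prop :=
  HasLaw (fun ω => (c.exec (input ω)).output n m)
    ((μ.map fun π => fun i a => π i a).toMeasure) tapeMeasure

end

noncomputable section

/-! ## Values of policies -/

/-! Quality of Algorithm 1. Let `gap i a` be the shortfall of the pair `(i, a)` in the Bellman
optimality equation. A policy loses at most `∑ π gap / (1 - γ)` at every state
(`optValue_sub_value_le`). This bound is linear in the policy, so it suffices to bound the expected
`policyGap` of the averaged policy and to apply Markov's inequality.

The algorithm is stochastic mirror descent for the saddle point form of the linear program of the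
decision problem: projected gradient steps for `v`, multiplicative weights for the dual point `w i *
π i a` with `w = γ ξ + (1 - γ) q`. The dual comparator is the discounted occupancy measure `ν i * σ
i a` of an optimal policy `σ` started from `q`; it has the same shape, `ν = γ μ + (1 - γ) q`. The
`potential` adds the squared distance of `v` to the optimal values, over `2α`, and the cross entropy
of the comparator relative to `ξ` and `π`, over `β`. In one iteration its mean drops by `∑ w π gap`,
up to `α + 2 n m β / (1 - γ)²` (`sampleMean_potential_le`). Importance weighting does no harm
because the probability of the sample cancels its own inverse, and all terms in `v - v*` cancel by
complementary slackness and the balance equation of `ν`. Since `w ≥ (1 - γ) q`, the drop dominates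
the `policyGap` of the current policy. Summing over `T` iterations from an initial potential of at
most `(1 + log(n m)) / β` gives the mean bound `expect_policyGap_le`.

Quality of Algorithm 2. With probability at least `1 - δ/2` some run is `ε/2`-optimal, as `(1/3)^K ≤
δ/2`, and with probability at least `1 - δ/2` all evaluations are valid. On both events the selected
policy is `ε`-optimal (`metaAlg_near_optimal`).

Run time. All distributions are kept as unnormalized weights in sum trees, so that sampling and
updating cost `O(log(n + m))`. No normalization is ever carried out: multiplying one weight in row
`i` multiplies the row sum by exactly the factor by which `ξ i` is updated, so `ξ` is proportional
to the row sums. The average policy is accumulated lazily, with one entry of two arrays changed per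
iteration (`Represents`). Policies are evaluated by `T / (n² m) + 1` sweeps of value iteration,
whose total cost `O(T + n² m)` fits the budget.

The law of the output is obtained from `Generates`: for a fixed input, a program is a finite tree of
coin tosses, so laws compose like probability mass functions. Time is bounded statically by
`maxTime`, since loop bounds involve only registers that the loops do not change. -/

theorem vecPMF_toReal {k : ℕ} (x : stdSimplex ℝ (Fin k)) (a : Fin k) :
    (vecPMF x a).toReal = x a := by
  simp [vecPMF, PMF.ofFintype_apply]

theorem simplex_nonneg {k : ℕ} (x : stdSimplex ℝ (Fin k)) (a : Fin k) : 0 ≤ x a := x.2.1 a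

theorem simplex_sum {k : ℕ} (x : stdSimplex ℝ (Fin k)) : ∑ a, x a = 1 := x.2.2

theorem simplex_le_one {k : ℕ} (x : stdSimplex ℝ (Fin k)) (a : Fin k) : x a ≤ 1 := by
  rw [← simplex_sum x]
  exact Finset.single_le_sum (f := fun b => x b) (fun b _ => simplex_nonneg x b)
    (Finset.mem_univ a)

namespace DMDP

variable {n m : ℕ} (M : DMDP n m)

/-- The expected immediate reward of a state-action pair. -/
def meanReward (i : Fin n) (a : Fin m) : ℝ := ∑ j, M.p i a j * M.r i a j

/-- The expected value of `v` at the next state. -/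
def meanNext (v : Fin n → ℝ) (i : Fin n) (a : Fin m) : ℝ := ∑ j, M.p i a j * v j

theorem meanReward_nonneg (i : Fin n) (a : Fin m) : 0 ≤ M.meanReward i a :=
  Finset.sum_nonneg fun j _ => mul_nonneg (simplex_nonneg _ j) (M.r_mem i a j).1

theorem meanReward_le_one (i : Fin n) (a : Fin m) : M.meanReward i a ≤ 1 := by
  rw [← simplex_sum (M.p i a)]
  exact Finset.sum_le_sum fun j _ =>
    mul_le_of_le_one_right (simplex_nonneg _ j) (M.r_mem i a j).2

theorem integral_step (π : Policy n m) (x : Fin n × Fin m) (f : Fin n × Fin m → ℝ) :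
    ∫ y, f y ∂(M.stepKernel π x) = ∑ j, M.p x.1 x.2 j * ∑ a, π j a * f (j, a) := by
  have h : ∀ j a, ((M.stepPMF π x) (j, a)).toReal = M.p x.1 x.2 j * π j a := by
    intro j a
    have : (M.stepPMF π x) (j, a) = vecPMF (M.p x.1 x.2) j * vecPMF (π j) a := by
      rw [stepPMF, PMF.bind_apply, tsum_fintype, Finset.sum_eq_single j]
      · rw [PMF.map_apply, tsum_fintype, Finset.sum_eq_single a]
        · simp
        · intro b _ hb
          simp [hb.symm]
        · simp
      · intro b _ hb
        rw [PMF.map_apply]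
        simp [hb.symm]
      · simp
    rw [this, ENNReal.toReal_mul, vecPMF_toReal, vecPMF_toReal]
  change ∫ y, f y ∂((M.stepPMF π x).toMeasure) = _
  rw [PMF.integral_eq_sum, Fintype.sum_prod_type]
  simp_rw [h, Finset.mul_sum, smul_eq_mul, mul_assoc]

theorem isProbabilityMeasure_pathMeasure (π : Policy n m) (i : Fin n) :
    IsProbabilityMeasure (M.pathMeasure π i) := by
  unfold pathMeasure
  infer_instance

theorem integrable_path (π : Policy n m) (i : Fin n) {E : Type*} [Fintype E] [MeasurableSpace E]
    [DiscreteMeasurableSpace E] (g : E → ℝ)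
    (h : (ℕ → Fin n × Fin m) → E) (hh : Measurable h) :
    Integrable (fun ω => g (h ω)) (M.pathMeasure π i) := by
  have := M.isProbabilityMeasure_pathMeasure π i
  have hg : Measurable g := measurable_of_finite g
  refine Integrable.of_bound (hg.comp hh).aestronglyMeasurable (∑ e, |g e|) ?_
  refine Filter.Eventually.of_forall fun ω => ?_
  exact Finset.single_le_sum (f := fun e => |g e|) (fun e _ => abs_nonneg _) (Finset.mem_univ _)

/-- The Markov property: the joint law of the history up to `t` and of the next pair is the
composition product of the law of the history with `histKernel`. Together with `integral_path_zero`
this is all that is used about the distribution of trajectories. -/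
theorem integral_path_pair (π : Policy n m) (i : Fin n) (t : ℕ)
    (g : Fin n × Fin m → Fin n × Fin m → ℝ) :
    ∫ ω, g (ω t) (ω (t + 1)) ∂(M.pathMeasure π i) =
      ∫ ω, (∑ j, M.p (ω t).1 (ω t).2 j * ∑ a, π j a * g (ω t) (j, a)) ∂(M.pathMeasure π i) := by
  have := M.isProbabilityMeasure_pathMeasure π i
  have key := Kernel.map_frestrictLe_trajMeasure_compProd_eq_map_trajMeasure
    (X := fun _ => Fin n × Fin m) (κ := M.histKernel π)
    (μ₀ := (((vecPMF (π i)).map fun a => (i, a)).toMeasure)) (a := t)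
  change (M.pathMeasure π i).map _ ⊗ₘ _ = (M.pathMeasure π i).map _ at key
  let G : (∀ _ : Finset.Iic t, Fin n × Fin m) × (Fin n × Fin m) → ℝ :=
    fun z => g (z.1 ⟨t, Finset.mem_Iic.mpr le_rfl⟩) z.2
  have hGm : Measurable G := by
    have h1 : Measurable fun z : (∀ _ : Finset.Iic t, Fin n × Fin m) × (Fin n × Fin m) =>
        (z.1 ⟨t, Finset.mem_Iic.mpr le_rfl⟩, z.2) := by fun_prop
    exact (measurable_of_finite fun z : (Fin n × Fin m) × (Fin n × Fin m) => g z.1 z.2).comp h1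
  have hr : Measurable (Preorder.frestrictLe (π := fun _ => Fin n × Fin m) t) :=
    Preorder.measurable_frestrictLe t
  have hL : ∫ z, G z ∂((M.pathMeasure π i).map
      (fun x => (Preorder.frestrictLe (π := fun _ => Fin n × Fin m) t x, x (t + 1)))) =
      ∫ ω, g (ω t) (ω (t + 1)) ∂(M.pathMeasure π i) := by
    rw [integral_map]
    · rfl
    · exact (hr.prodMk (measurable_pi_apply _)).aemeasurable
    · exact hGm.aestronglyMeasurable
  have : IsProbabilityMeasure ((M.pathMeasure π i).map
    (Preorder.frestrictLe (π := fun _ => Fin n × Fin m) t)) :=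
    Measure.isProbabilityMeasure_map hr.aemeasurable
  rw [← hL, ← key, Measure.integral_compProd, integral_map]
  · refine integral_congr_ae (Filter.Eventually.of_forall fun ω => ?_)
    exact M.integral_step π (ω t) (fun y => g (ω t) y)
  · exact hr.aemeasurable
  · exact (measurable_of_finite _).aestronglyMeasurable
  · refine Integrable.of_bound hGm.aestronglyMeasurable (∑ e, ∑ e', |g e e'|) ?_
    refine Filter.Eventually.of_forall fun z => ?_
    refine le_trans (Finset.single_le_sum (f := fun e => |g _ e|) (fun e _ => abs_nonneg _)
      (Finset.mem_univ z.2)) ?_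
    exact Finset.single_le_sum (f := fun e => ∑ e', |g e e'|)
      (fun e _ => Finset.sum_nonneg fun _ _ => abs_nonneg _) (Finset.mem_univ _)

theorem integral_path_zero (π : Policy n m) (i : Fin n) (f : Fin n × Fin m → ℝ) :
    ∫ ω, f (ω 0) ∂(M.pathMeasure π i) = ∑ a, π i a * f (i, a) := by
  have hr : Measurable (Preorder.frestrictLe (π := fun _ => Fin n × Fin m) 0) :=
    Preorder.measurable_frestrictLe 0
  have h0 : (M.pathMeasure π i).map (Preorder.frestrictLe (π := fun _ => Fin n × Fin m) 0) =
      (((vecPMF (π i)).map fun a => (i, a)).toMeasure).map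
        (MeasurableEquiv.piUnique (fun _ : Finset.Iic 0 => Fin n × Fin m)).symm := by
    rw [pathMeasure, Kernel.trajMeasure, Measure.map_comp _ _ (by fun_prop),
      Kernel.traj_map_frestrictLe, Kernel.partialTraj_self]
    exact Measure.id_comp
  let G : (∀ _ : Finset.Iic 0, Fin n × Fin m) → ℝ :=
    fun z => f (z ⟨0, Finset.mem_Iic.mpr le_rfl⟩)
  have hL : ∫ z, G z ∂((M.pathMeasure π i).map
      (Preorder.frestrictLe (π := fun _ => Fin n × Fin m) 0)) =
      ∫ ω, f (ω 0) ∂(M.pathMeasure π i) := by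
    rw [integral_map]
    · rfl
    · exact hr.aemeasurable
    · exact (measurable_of_finite G).aestronglyMeasurable
  rw [← hL, h0, integral_map]
  · change ∫ z, f z ∂((vecPMF (π i)).map fun a => (i, a)).toMeasure = _
    rw [PMF.integral_eq_sum, Fintype.sum_prod_type, Finset.sum_eq_single i]
    · refine Finset.sum_congr rfl fun a _ => ?_
      rw [PMF.map_apply, tsum_fintype, Finset.sum_eq_single a]
      · simp [vecPMF_toReal]
      · intro b _ hb
        simp [hb.symm]
      · simp
    · intro b _ hb
      refine Finset.sum_eq_zero fun a _ => ?_
      rw [PMF.map_apply]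
      simp [hb]
    · simp
  · exact (MeasurableEquiv.measurable _).aemeasurable
  · exact (measurable_of_finite G).aestronglyMeasurable

/-- The expected reward collected at time `t`. -/
def rewardAt (π : Policy n m) : ℕ → Fin n → ℝ
  | 0, i => ∑ a, π i a * M.meanReward i a
  | t + 1, i => ∑ a, π i a * M.meanNext (rewardAt π t) i a

theorem integral_reward (π : Policy n m) (i : Fin n) (t : ℕ) :
    ∫ ω, M.r (ω t).1 (ω t).2 (ω (t + 1)).1 ∂(M.pathMeasure π i) = M.rewardAt π t i := by
  have hmean : ∫ ω, M.r (ω t).1 (ω t).2 (ω (t + 1)).1 ∂(M.pathMeasure π i) =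
      ∫ ω, M.meanReward (ω t).1 (ω t).2 ∂(M.pathMeasure π i) := by
    rw [M.integral_path_pair π i t fun x y => M.r x.1 x.2 y.1]
    refine integral_congr_ae (Filter.Eventually.of_forall fun ω => ?_)
    simp_rw [meanReward, ← Finset.sum_mul, simplex_sum, one_mul]
  rw [hmean]
  -- The induction replaces `f` by its one-step conditional mean and shifts `g` by one, so both have
  -- to vary.
  have gen : ∀ (t : ℕ) (f : Fin n × Fin m → ℝ) (g : ℕ → Fin n → ℝ),
      (∀ j, g 0 j = ∑ a, π j a * f (j, a)) →
      (∀ s j, g (s + 1) j = ∑ a, π j a * M.meanNext (g s) j a) →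
      ∫ ω, f (ω t) ∂(M.pathMeasure π i) = g t i := by
    intro t
    induction t with
    | zero =>
      intro f g h0 _
      rw [integral_path_zero, h0]
    | succ t ih =>
      intro f g h0 hs
      rw [M.integral_path_pair π i t fun _ y => f y]
      rw [ih (fun x => ∑ j, M.p x.1 x.2 j * ∑ a, π j a * f (j, a)) (fun s => g (s + 1)) ?_
        (fun s j => hs (s + 1) j)]
      intro j
      rw [hs 0 j]
      simp_rw [meanNext, h0]
  exact gen t (fun x => M.meanReward x.1 x.2) (M.rewardAt π) (fun j => rfl) (fun s j => rfl)

theorem rewardAt_mem (π : Policy n m) (t : ℕ) (i : Fin n) :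
    M.rewardAt π t i ∈ Set.Icc (0 : ℝ) 1 := by
  have avg : ∀ {k : ℕ} (x : stdSimplex ℝ (Fin k)) (f : Fin k → ℝ),
      (∀ j, f j ∈ Set.Icc (0 : ℝ) 1) → ∑ j, x j * f j ∈ Set.Icc (0 : ℝ) 1 := by
    intro k x f hf
    refine ⟨Finset.sum_nonneg fun j _ => mul_nonneg (simplex_nonneg _ j) (hf j).1, ?_⟩
    rw [← simplex_sum x]
    exact Finset.sum_le_sum fun j _ => mul_le_of_le_one_right (simplex_nonneg _ j) (hf j).2
  induction t generalizing i with
  | zero => exact avg _ _ fun a => ⟨M.meanReward_nonneg i a, M.meanReward_le_one i a⟩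
  | succ t ih => exact avg _ _ fun a => avg _ _ ih

theorem γ_nonneg : 0 ≤ M.γ := M.γ_mem.1.le

theorem one_sub_γ_pos : 0 < 1 - M.γ := sub_pos.mpr M.γ_mem.2

theorem summable_discounted {f : ℕ → ℝ} (hf : ∀ t, f t ∈ Set.Icc (0 : ℝ) 1) :
    Summable fun t => M.γ ^ t * f t :=
  Summable.of_nonneg_of_le (fun t => mul_nonneg (pow_nonneg M.γ_nonneg t) (hf t).1)
    (fun t => mul_le_of_le_one_right (pow_nonneg M.γ_nonneg t) (hf t).2)
    (summable_geometric_of_lt_one M.γ_nonneg M.γ_mem.2)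

theorem value_eq_tsum (π : Policy n m) (i : Fin n) :
    M.value π i = ∑' t, M.γ ^ t * M.rewardAt π t i := by
  have hp := M.isProbabilityMeasure_pathMeasure π i
  have hint : ∀ t, Integrable (fun ω : ℕ → Fin n × Fin m =>
      M.γ ^ t * M.r (ω t).1 (ω t).2 (ω (t + 1)).1) (M.pathMeasure π i) := fun t =>
    (M.integrable_path π i (fun z : (Fin n × Fin m) × (Fin n × Fin m) => M.r z.1.1 z.1.2 z.2.1)
      (fun ω => (ω t, ω (t + 1))) (by fun_prop)).const_mul _
  rw [value, ← integral_tsum_of_summable_integral_norm hint]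
  · refine tsum_congr fun t => ?_
    rw [integral_const_mul, integral_reward]
  · refine (M.summable_discounted (M.rewardAt_mem π · i)).congr fun t => ?_
    rw [← integral_reward, ← integral_const_mul]
    refine integral_congr_ae (Filter.Eventually.of_forall fun ω => ?_)
    exact (Real.norm_of_nonneg (mul_nonneg (pow_nonneg M.γ_nonneg t) (M.r_mem _ _ _).1)).symm

/-- Splitting off the term `t = 0` leaves `γ` times the series started at the next state. Apart from
the bounds in `value_mem`, later arguments use nothing else about `value`. -/
theorem value_bellman (π : Policy n m) (i : Fin n) :
    M.value π i = ∑ a, π i a * (M.meanReward i a + M.γ * M.meanNext (M.value π) i a) := by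
  have hs := fun j => M.summable_discounted (M.rewardAt_mem π · j)
  have h1 : ∀ t, M.γ ^ (t + 1) * M.rewardAt π (t + 1) i =
      ∑ a, ∑ j, (π i a * M.p i a j * M.γ) * (M.γ ^ t * M.rewardAt π t j) := by
    intro t
    rw [rewardAt]
    simp_rw [meanNext, Finset.mul_sum]
    refine Finset.sum_congr rfl fun a _ => Finset.sum_congr rfl fun j _ => ?_
    ring
  rw [value_eq_tsum, (hs i).tsum_eq_zero_add]
  simp_rw [h1]
  rw [Summable.tsum_finsetSum fun a _ => summable_sum fun j _ => (hs j).mul_left _]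
  simp_rw [mul_add, Finset.sum_add_distrib]
  congr 1
  · simp [rewardAt]
  · refine Finset.sum_congr rfl fun a _ => ?_
    rw [Summable.tsum_finsetSum fun j _ => (hs j).mul_left _]
    simp_rw [tsum_mul_left, ← value_eq_tsum, meanNext, Finset.mul_sum]
    refine Finset.sum_congr rfl fun j _ => ?_
    ring

theorem value_mem (π : Policy n m) (i : Fin n) :
    M.value π i ∈ Set.Icc (0 : ℝ) (1 / (1 - M.γ)) := by
  rw [value_eq_tsum, one_div, ← tsum_geometric_of_lt_one M.γ_nonneg M.γ_mem.2]
  have h := M.rewardAt_mem π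
  refine ⟨tsum_nonneg fun t => mul_nonneg (pow_nonneg M.γ_nonneg t) (h t i).1,
    (M.summable_discounted (h · i)).tsum_le_tsum
      (fun t => mul_le_of_le_one_right (pow_nonneg M.γ_nonneg t) (h t i).2)
      (summable_geometric_of_lt_one M.γ_nonneg M.γ_mem.2)⟩

end DMDP

/-! ## Optimal values and occupancy measures -/

namespace DMDP

variable {n m : ℕ} (M : DMDP n m)

theorem meanNext_mono {u v : Fin n → ℝ} (h : ∀ j, u j ≤ v j) (i : Fin n) (a : Fin m) :
    M.meanNext u i a ≤ M.meanNext v i a :=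
  Finset.sum_le_sum fun j _ => mul_le_mul_of_nonneg_left (h j) (simplex_nonneg _ j)

theorem meanNext_const (c : ℝ) (i : Fin n) (a : Fin m) : M.meanNext (fun _ => c) i a = c := by
  rw [meanNext, ← Finset.sum_mul, simplex_sum, one_mul]

theorem meanNext_add (u v : Fin n → ℝ) (i : Fin n) (a : Fin m) :
    M.meanNext (fun j => u j + v j) i a = M.meanNext u i a + M.meanNext v i a := by
  simp_rw [meanNext, mul_add, Finset.sum_add_distrib]

theorem meanNext_sub (u v : Fin n → ℝ) (i : Fin n) (a : Fin m) :
    M.meanNext (fun j => u j - v j) i a = M.meanNext u i a - M.meanNext v i a := by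
  simp_rw [meanNext, mul_sub, Finset.sum_sub_distrib]

/-- The one-step shortfall of the pair `(i, a)` with respect to the values `v`. -/
def gapOf (v : Fin n → ℝ) (i : Fin n) (a : Fin m) : ℝ :=
  v i - M.meanReward i a - M.γ * M.meanNext v i a

/-- The Bellman optimality operator is a `γ`-contraction in the sup norm; `v` is its fixed point and
`σ` picks a maximizing action in each state. -/
theorem exists_bellman [NeZero m] : ∃ (v : Fin n → ℝ) (σ : Fin n → Fin m),
    (∀ i a, 0 ≤ M.gapOf v i a) ∧ ∀ i, M.gapOf v i (σ i) = 0 := by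
  have hne : (Finset.univ : Finset (Fin m)).Nonempty := ⟨0, Finset.mem_univ 0⟩
  let B : (Fin n → ℝ) → Fin n → ℝ := fun v i =>
    Finset.univ.sup' hne fun a => M.meanReward i a + M.γ * M.meanNext v i a
  have hle : ∀ u v : Fin n → ℝ, ∀ i, B u i ≤ B v i + M.γ * dist u v := by
    intro u v i
    refine Finset.sup'_le _ _ fun a _ => ?_
    have h1 : M.meanNext u i a ≤ M.meanNext v i a + dist u v := by
      rw [← M.meanNext_const (dist u v) i a, ← meanNext_add]
      refine M.meanNext_mono (fun j => ?_) i a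
      have := (abs_le.mp ((Real.dist_eq (u j) (v j)) ▸ dist_le_pi_dist u v j)).2
      linarith
    have h2 := Finset.le_sup' (fun a => M.meanReward i a + M.γ * M.meanNext v i a)
      (Finset.mem_univ a)
    have h3 := mul_le_mul_of_nonneg_left h1 M.γ_nonneg
    change _ ≤ B v i at h2
    linarith
  have hc : ContractingWith ⟨M.γ, M.γ_nonneg⟩ B := by
    refine ⟨by exact_mod_cast M.γ_mem.2, LipschitzWith.of_dist_le_mul fun u v => ?_⟩
    refine (dist_pi_le_iff (mul_nonneg M.γ_nonneg dist_nonneg)).mpr fun i => ?_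
    rw [Real.dist_eq, abs_le]
    have h1 := hle u v i
    have h2 := hle v u i
    rw [dist_comm v u] at h2
    change -(M.γ * dist u v) ≤ _ ∧ _ ≤ M.γ * dist u v
    constructor <;> linarith
  obtain ⟨v, hv⟩ : ∃ v, B v = v := ⟨_, hc.fixedPoint_isFixedPt⟩
  have hσ : ∀ i, ∃ a, M.gapOf v i a = 0 := by
    intro i
    obtain ⟨a, -, ha⟩ := Finset.exists_mem_eq_sup' hne
      fun a => M.meanReward i a + M.γ * M.meanNext v i a
    refine ⟨a, ?_⟩
    have : B v i = _ := ha
    rw [hv] at this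
    rw [gapOf]
    linarith
  choose σ hσ using hσ
  refine ⟨v, σ, fun i a => ?_, hσ⟩
  have h : _ ≤ B v i := Finset.le_sup' (fun a => M.meanReward i a + M.γ * M.meanNext v i a)
    (Finset.mem_univ a)
  rw [hv] at h
  rw [gapOf]
  linarith

theorem sub_value_eq (v : Fin n → ℝ) (π : Policy n m) (i : Fin n) :
    v i - M.value π i = ∑ a, π i a * M.gapOf v i a +
      M.γ * ∑ a, π i a * M.meanNext (fun j => v j - M.value π j) i a := by
  have h : v i = ∑ a, π i a * v i := by rw [← Finset.sum_mul, simplex_sum, one_mul]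
  rw [value_bellman, h, ← Finset.sum_sub_distrib, Finset.mul_sum, ← Finset.sum_add_distrib]
  refine Finset.sum_congr rfl fun a _ => ?_
  rw [meanNext_sub, gapOf]
  ring

/-- At a state maximizing `d = v - v^π`, `sub_value_eq` gives `d ≤ ∑ π gap + γ d`. Replacing the gap
of that state by the sum over all states is lossy, but makes the bound linear in the policy. -/
theorem sub_value_le (v : Fin n → ℝ) (π : Policy n m) (hv : ∀ i a, 0 ≤ M.gapOf v i a)
    (i : Fin n) :
    v i - M.value π i ≤ (∑ k, ∑ a, π k a * M.gapOf v k a) / (1 - M.γ) := by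
  obtain ⟨i₀, -, h₀⟩ := Finset.exists_max_image Finset.univ (fun i => v i - M.value π i)
    ⟨i, Finset.mem_univ i⟩
  refine (h₀ i (Finset.mem_univ i)).trans ?_
  rw [le_div_iff₀ M.one_sub_γ_pos]
  have h1 : ∑ a, π i₀ a * M.meanNext (fun j => v j - M.value π j) i₀ a ≤
      v i₀ - M.value π i₀ := by
    rw [← one_mul (v i₀ - M.value π i₀), ← simplex_sum (π i₀), Finset.sum_mul]
    refine Finset.sum_le_sum fun a _ => mul_le_mul_of_nonneg_left ?_ (simplex_nonneg _ a)
    rw [← M.meanNext_const (v i₀ - M.value π i₀) i₀ a]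
    exact M.meanNext_mono (fun j => h₀ j (Finset.mem_univ j)) i₀ a
  have h2 := M.sub_value_eq v π i₀
  have h3 : ∑ a, π i₀ a * M.gapOf v i₀ a ≤ ∑ k, ∑ a, π k a * M.gapOf v k a :=
    Finset.single_le_sum (f := fun k => ∑ a, π k a * M.gapOf v k a)
      (fun k _ => Finset.sum_nonneg fun a _ => mul_nonneg (simplex_nonneg _ a) (hv k a))
      (Finset.mem_univ i₀)
  have h4 := mul_le_mul_of_nonneg_left h1 M.γ_nonneg
  linarith

/-- At a state minimizing `d = v - v^π`, `sub_value_eq` gives `d ≥ γ d`, hence `d ≥ 0`. -/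
theorem value_le_of_gap_nonneg (v : Fin n → ℝ) (π : Policy n m)
    (hv : ∀ i a, 0 ≤ M.gapOf v i a) (i : Fin n) : M.value π i ≤ v i := by
  obtain ⟨i₀, -, h₀⟩ := Finset.exists_min_image Finset.univ (fun i => v i - M.value π i)
    ⟨i, Finset.mem_univ i⟩
  have h1 : v i₀ - M.value π i₀ ≤
      ∑ a, π i₀ a * M.meanNext (fun j => v j - M.value π j) i₀ a := by
    rw [← one_mul (v i₀ - M.value π i₀), ← simplex_sum (π i₀), Finset.sum_mul]
    refine Finset.sum_le_sum fun a _ => mul_le_mul_of_nonneg_left ?_ (simplex_nonneg _ a)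
    rw [← M.meanNext_const (v i₀ - M.value π i₀) i₀ a]
    exact M.meanNext_mono (fun j => h₀ j (Finset.mem_univ j)) i₀ a
  have h2 := M.sub_value_eq v π i₀
  have h3 : 0 ≤ ∑ a, π i₀ a * M.gapOf v i₀ a :=
    Finset.sum_nonneg fun a _ => mul_nonneg (simplex_nonneg _ a) (hv i₀ a)
  have h4 := mul_le_mul_of_nonneg_left h1 M.γ_nonneg
  have h5 : 0 ≤ v i₀ - M.value π i₀ := by nlinarith [M.one_sub_γ_pos]
  have := h₀ i (Finset.mem_univ i)
  linarith

/-- The shortfall of the pair `(i, a)` with respect to the optimal values. -/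
def gap (i : Fin n) (a : Fin m) : ℝ := M.gapOf M.optValue i a

/-- The greedy policy of the Bellman fixed point has the fixed point as its value, and no policy
exceeds it, so the suprema defining `optValue` are attained simultaneously. The last clause is
complementary slackness. -/
theorem exists_optimal [NeZero m] : ∃ σ : Policy n m, (∀ i, M.value σ i = M.optValue i) ∧
    (∀ i a, 0 ≤ M.gap i a) ∧ ∀ i a, σ i a * M.gap i a = 0 := by
  obtain ⟨v, σ, h0, hσ⟩ := M.exists_bellman
  let s : Policy n m := fun i => ⟨Pi.single (σ i) 1, single_mem_stdSimplex ℝ (σ i)⟩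
  have hs : ∀ i a, s i a = if a = σ i then 1 else 0 := fun i a => Pi.single_apply _ _ _
  have hsg : ∀ i a, s i a * M.gapOf v i a = 0 := by
    intro i a
    rw [hs]
    split_ifs with h
    · rw [h, hσ, mul_zero]
    · rw [zero_mul]
  have hval : ∀ i, M.value s i = v i := by
    intro i
    refine le_antisymm (M.value_le_of_gap_nonneg v s h0 i) ?_
    have := M.sub_value_le v s h0 i
    simp_rw [hsg] at this
    simp at this
    linarith
  have hopt : M.optValue = v := by
    have : Nonempty (Policy n m) := ⟨s⟩
    funext i
    refine le_antisymm (ciSup_le fun π => M.value_le_of_gap_nonneg v π h0 i) ?_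
    rw [← hval]
    exact le_ciSup (f := fun π => M.value π i)
      ⟨v i, by rintro _ ⟨π, rfl⟩; exact M.value_le_of_gap_nonneg v π h0 i⟩ s
  refine ⟨s, fun i => by rw [hval, hopt], ?_, ?_⟩ <;> rw [show M.gap = M.gapOf v by
    funext i a; rw [gap, hopt]]
  exacts [h0, hsg]

theorem gap_nonneg [NeZero m] (i : Fin n) (a : Fin m) : 0 ≤ M.gap i a := by
  obtain ⟨_, _, h, _⟩ := M.exists_optimal
  exact h i a

theorem optValue_mem [NeZero m] (i : Fin n) : M.optValue i ∈ Set.Icc (0 : ℝ) (1 / (1 - M.γ)) := by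
  obtain ⟨σ, h, _⟩ := M.exists_optimal
  rw [← h]
  exact M.value_mem σ i

theorem optValue_sub_value_le [NeZero m] (π : Policy n m) (i : Fin n) :
    M.optValue i - M.value π i ≤ (∑ k, ∑ a, π k a * M.gap k a) / (1 - M.γ) :=
  M.sub_value_le _ π M.gap_nonneg i

/-- The distribution of the state one step after the distribution `d`. -/
def pushState (π : Policy n m) (d : Fin n → ℝ) (j : Fin n) : ℝ :=
  ∑ i, d i * ∑ a, π i a * M.p i a j

theorem pushState_mem (π : Policy n m) {d : Fin n → ℝ} (hd : d ∈ stdSimplex ℝ (Fin n)) :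
    M.pushState π d ∈ stdSimplex ℝ (Fin n) := by
  refine ⟨fun j => Finset.sum_nonneg fun i _ => mul_nonneg (hd.1 i) (Finset.sum_nonneg
    fun a _ => mul_nonneg (simplex_nonneg _ a) (simplex_nonneg _ j)), ?_⟩
  simp_rw [pushState]
  rw [Finset.sum_comm]
  simp_rw [← Finset.mul_sum]
  rw [← hd.2]
  refine Finset.sum_congr rfl fun i _ => ?_
  rw [Finset.sum_comm]
  simp_rw [← Finset.mul_sum, simplex_sum, mul_one, simplex_sum, mul_one]

/-- There is a discounted occupancy measure for every policy and every initial distribution. -/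
theorem exists_occupancy (π : Policy n m) (d : stdSimplex ℝ (Fin n)) :
    ∃ ν ∈ stdSimplex ℝ (Fin n), ∀ j, ν j = (1 - M.γ) * d j + M.γ * M.pushState π ν j := by
  -- `f t` is the distribution of the state at time `t`. Its normalized discounted sum `ν` satisfies
  -- the balance equation, as one sees by splitting off `t = 0`.
  let f : ℕ → Fin n → ℝ := fun t => (M.pushState π)^[t] d
  have hf : ∀ t, f t ∈ stdSimplex ℝ (Fin n) := by
    intro t
    induction t with
    | zero => exact d.2
    | succ t ih =>
      change (M.pushState π)^[t + 1] d ∈ _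
      rw [Function.iterate_succ_apply']
      exact M.pushState_mem π ih
  have hf1 : ∀ j t, f t j ∈ Set.Icc (0 : ℝ) 1 := fun j t =>
    ⟨(hf t).1 j, simplex_le_one ⟨f t, hf t⟩ j⟩
  have hs := fun j => M.summable_discounted (hf1 j)
  let ν : Fin n → ℝ := fun j => (1 - M.γ) * ∑' t, M.γ ^ t * f t j
  have hν : ∀ j, ν j = (1 - M.γ) * d j + M.γ * M.pushState π ν j := by
    intro j
    have h1 : ∀ t, M.γ ^ (t + 1) * f (t + 1) j =
        ∑ i, (M.γ * ∑ a, π i a * M.p i a j) * (M.γ ^ t * f t i) := by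
      intro t
      change M.γ ^ (t + 1) * (M.pushState π)^[t + 1] d j = _
      rw [Function.iterate_succ_apply']
      change M.γ ^ (t + 1) * (∑ i, f t i * ∑ a, π i a * M.p i a j) = _
      rw [Finset.mul_sum]
      refine Finset.sum_congr rfl fun i _ => ?_
      ring
    change (1 - M.γ) * ∑' t, M.γ ^ t * f t j = _
    rw [(hs j).tsum_eq_zero_add]
    simp_rw [h1]
    rw [Summable.tsum_finsetSum fun i _ => (hs i).mul_left _]
    simp_rw [tsum_mul_left, mul_add]
    congr 1
    · simp [f]
    · simp_rw [pushState, ν, Finset.mul_sum]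
      refine Finset.sum_congr rfl fun i _ => ?_
      simp_rw [Finset.sum_mul, Finset.mul_sum]
      refine Finset.sum_congr rfl fun a _ => ?_
      ring
  refine ⟨ν, ⟨fun j => mul_nonneg M.one_sub_γ_pos.le
    (tsum_nonneg fun t => mul_nonneg (pow_nonneg M.γ_nonneg t) (hf1 j t).1), ?_⟩, hν⟩
  simp_rw [ν, ← Finset.mul_sum]
  rw [← Summable.tsum_finsetSum fun j _ => hs j]
  have : ∀ t, ∑ j, M.γ ^ t * f t j = M.γ ^ t := fun t => by
    rw [← Finset.mul_sum, (hf t).2, mul_one]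
  simp_rw [this]
  rw [tsum_geometric_of_lt_one M.γ_nonneg M.γ_mem.2, mul_inv_cancel₀ M.one_sub_γ_pos.ne']

end DMDP

/-! ## Inequalities for one sample -/

theorem scaleAt_apply {k : ℕ} (x : stdSimplex ℝ (Fin k)) (i : Fin k) (c : ℝ) (hc : 0 < c)
    (b : Fin k) :
    scaleAt x i c hc b = (if b = i then x i * c else x b) / (1 + x i * (c - 1)) := by
  have hsum : ∑ b, Function.update (fun b => x b) i (x i * c) b = 1 + x i * (c - 1) := by
    have h := Finset.add_sum_erase _ (fun b => x b) (Finset.mem_univ i)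
    rw [simplex_sum x] at h
    rw [Finset.sum_update_of_mem (Finset.mem_univ i), Finset.sdiff_singleton_eq_erase]
    linarith
  change Function.update (fun b => x b) i (x i * c) b / _ = _
  rw [hsum, Function.update_apply]

theorem scale_sum_pos {k : ℕ} (x : stdSimplex ℝ (Fin k)) (i : Fin k) {c : ℝ} (hc : 0 < c) :
    0 < 1 + x i * (c - 1) := by
  have := dual_factor_pos x i (Real.log c)
  rwa [Real.exp_log hc] at this

theorem scaleAt_pos {k : ℕ} (x : stdSimplex ℝ (Fin k)) (i : Fin k) (c : ℝ) (hc : 0 < c)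
    (hx : ∀ b, 0 < x b) (b : Fin k) : 0 < scaleAt x i c hc b := by
  rw [scaleAt_apply]
  refine div_pos ?_ (scale_sum_pos x i hc)
  split_ifs
  exacts [mul_pos (hx i) hc, hx b]

theorem log_scaleAt {k : ℕ} (x : stdSimplex ℝ (Fin k)) (i : Fin k) (c : ℝ) (hc : 0 < c)
    (hx : ∀ b, 0 < x b) (b : Fin k) :
    Real.log (scaleAt x i c hc b) =
      Real.log (x b) + (if b = i then Real.log c else 0) - Real.log (1 + x i * (c - 1)) := by
  have hs := scale_sum_pos x i hc
  rw [scaleAt_apply]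
  split_ifs with h
  · rw [h, Real.log_div (mul_pos (hx i) hc).ne' hs.ne', Real.log_mul (hx i).ne' hc.ne']
  · rw [Real.log_div (hx b).ne' hs.ne', add_zero]

/-- The cross entropy of a probability vector after a multiplicative update. -/
theorem cross_entropy_scaleAt {k : ℕ} (x : stdSimplex ℝ (Fin k)) (i : Fin k) (c : ℝ) (hc : 0 < c)
    (hx : ∀ b, 0 < x b) (y : Fin k → ℝ) (hy : ∑ b, y b = 1) :
    ∑ b, y b * Real.log (scaleAt x i c hc b) =
      ∑ b, y b * Real.log (x b) + y i * Real.log c - Real.log (1 + x i * (c - 1)) := by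
  simp_rw [log_scaleAt x i c hc hx, mul_sub, mul_add, Finset.sum_sub_distrib,
    Finset.sum_add_distrib, ← Finset.sum_mul, hy, one_mul]
  simp

/-- Multiply `exp (-x) ≥ 1 - x + x²/2` by the positive number `1 + x + x²/2`; the polynomial product
is `1 + x⁴/4 ≥ 1`. The sign condition is the reason for the shift by `1 / (1 - γ)` in `dualStep`. -/
theorem exp_le_quadratic_of_nonpos {x : ℝ} (hx : x ≤ 0) : Real.exp x ≤ 1 + x + x ^ 2 / 2 := by
  have h := Real.quadratic_le_exp_of_nonneg (neg_nonneg.mpr hx)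
  have hpos : 0 < 1 + x + x ^ 2 / 2 := by nlinarith [sq_nonneg (1 + x)]
  have h1 : 1 ≤ (1 + x + x ^ 2 / 2) * Real.exp (-x) := by
    nlinarith [mul_le_mul_of_nonneg_left h hpos.le, sq_nonneg (x ^ 2)]
  calc Real.exp x = 1 * Real.exp x := (one_mul _).symm
    _ ≤ (1 + x + x ^ 2 / 2) * Real.exp (-x) * Real.exp x :=
      mul_le_mul_of_nonneg_right h1 (Real.exp_pos x).le
    _ = 1 + x + x ^ 2 / 2 := by rw [mul_assoc, ← Real.exp_add]; simp

namespace DMDP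

variable {n m : ℕ} (M : DMDP n m)

theorem clip_mem (x : ℝ) : M.clip x ∈ Set.Icc (0 : ℝ) (1 / (1 - M.γ)) :=
  ⟨le_max_right _ _, max_le (min_le_right _ _) (one_div_pos.mpr M.one_sub_γ_pos).le⟩

theorem clip_of_mem {z : ℝ} (hz : z ∈ Set.Icc (0 : ℝ) (1 / (1 - M.γ))) : M.clip z = z := by
  rw [clip, min_eq_left hz.2, max_eq_left hz.1]

theorem clip_mono : Monotone M.clip := fun _ _ h => max_le_max_right _ (min_le_min_right _ h)

theorem clip_sub_sq_le (x : ℝ) {z : ℝ} (hz : z ∈ Set.Icc (0 : ℝ) (1 / (1 - M.γ))) :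
    (M.clip x - z) ^ 2 ≤ (x - z) ^ 2 := by
  refine sq_le_sq.mpr ?_
  rw [clip]
  rcases le_total x z with h | h
  · have h1 : max (min x (1 / (1 - M.γ))) 0 ≤ z := max_le ((min_le_left _ _).trans h) hz.1
    have h2 : x ≤ max (min x (1 / (1 - M.γ))) 0 :=
      le_max_of_le_left (le_min le_rfl (h.trans hz.2))
    rw [abs_of_nonpos (sub_nonpos.mpr h1), abs_of_nonpos (sub_nonpos.mpr h)]
    linarith
  · have h1 : z ≤ max (min x (1 / (1 - M.γ))) 0 := le_max_of_le_left (le_min h hz.2)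
    have h2 : max (min x (1 / (1 - M.γ))) 0 ≤ x := max_le (min_le_left _ _) (hz.1.trans h)
    rw [abs_of_nonneg (sub_nonneg.mpr h1), abs_of_nonneg (sub_nonneg.mpr h)]
    linarith

theorem dist_sq_update_clip (v z : Fin n → ℝ) (i : Fin n) (c : ℝ)
    (hz : z i ∈ Set.Icc (0 : ℝ) (1 / (1 - M.γ))) :
    ∑ k, (Function.update v i (M.clip (v i - c)) k - z k) ^ 2 ≤
      ∑ k, (v k - z k) ^ 2 - 2 * c * (v i - z i) + c ^ 2 := by
  have h := M.clip_sub_sq_le (v i - c) hz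
  rw [← Finset.add_sum_erase _ _ (Finset.mem_univ i),
    ← Finset.add_sum_erase (a := i) _ (fun k => (v k - z k) ^ 2) (Finset.mem_univ i)]
  have h2 : ∑ k ∈ Finset.univ.erase i,
      (Function.update v i (M.clip (v i - c)) k - z k) ^ 2 =
      ∑ k ∈ Finset.univ.erase i, (v k - z k) ^ 2 :=
    Finset.sum_congr rfl fun k hk => by rw [Function.update_of_ne (Finset.ne_of_mem_erase hk)]
  rw [h2, Function.update_self]
  nlinarith

theorem α_nonneg (T : ℕ) : 0 ≤ M.α T := by
  have h := M.one_sub_γ_pos.le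
  rw [α, β]
  positivity

/-- The upper bound makes the exponent of the multiplicative update nonpositive; the lower bound
controls its second moment. -/
theorem temporalDifference_mem (x : Iterate n m) (i : Fin n) (a : Fin m) (j : Fin n)
    (hx : ∀ k, x.v k ∈ Set.Icc (0 : ℝ) (1 / (1 - M.γ))) :
    M.γ * x.v j - x.v i + M.r i a j - 1 / (1 - M.γ) ∈ Set.Icc (-(2 / (1 - M.γ))) 0 := by
  have h1 := mul_le_mul_of_nonneg_left (hx j).2 M.γ_nonneg
  have h0 := mul_nonneg M.γ_nonneg (hx j).1
  have h2 : M.γ * (1 / (1 - M.γ)) + 1 = 1 / (1 - M.γ) := by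
    have := M.one_sub_γ_pos.ne'
    field_simp
    ring
  have h3 : 2 / (1 - M.γ) = 1 / (1 - M.γ) + 1 / (1 - M.γ) := by ring
  have := (hx i).1
  have := (hx i).2
  have := (M.r_mem i a j).1
  have := (M.r_mem i a j).2
  constructor <;> linarith

variable [NeZero n]

theorem q_apply (i : Fin n) : M.q i = 1 / (n : ℝ) := rfl

theorem q_pos (i : Fin n) : 0 < M.q i :=
  one_div_pos.mpr (Nat.cast_pos.mpr (Nat.pos_of_ne_zero (NeZero.ne n)))

theorem mixVec_apply (ξ : stdSimplex ℝ (Fin n)) (i : Fin n) :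
    M.mixVec ξ i = M.γ * ξ i + (1 - M.γ) * M.q i := by
  change (1 - (1 - M.γ)) * ξ i + (1 - M.γ) * M.q i = _
  ring

theorem le_mixVec (ξ : stdSimplex ℝ (Fin n)) (i : Fin n) : (1 - M.γ) * M.q i ≤ M.mixVec ξ i := by
  rw [mixVec_apply]
  linarith [mul_nonneg M.γ_nonneg (simplex_nonneg ξ i)]

theorem mixVec_pos (ξ : stdSimplex ℝ (Fin n)) (i : Fin n) : 0 < M.mixVec ξ i :=
  (mul_pos M.one_sub_γ_pos (M.q_pos i)).trans_le (M.le_mixVec ξ i)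

theorem primalUpdate_mem (T : ℕ) (x : Iterate n m) (i j : Fin n)
    (hx : ∀ k, x.v k ∈ Set.Icc (0 : ℝ) (1 / (1 - M.γ))) (k : Fin n) :
    M.primalUpdate T x i j k ∈ Set.Icc (0 : ℝ) (1 / (1 - M.γ)) := by
  rw [primalUpdate, Function.update_apply]
  split_ifs
  · exact M.clip_mem _
  · rw [Function.update_apply]
    split_ifs
    exacts [M.clip_mem _, hx k]

/-- One projected stochastic gradient step on the values. -/
theorem dist_sq_primalUpdate (T : ℕ) (x : Iterate n m) (i j : Fin n) (z : Fin n → ℝ)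
    (hx : ∀ k, x.v k ∈ Set.Icc (0 : ℝ) (1 / (1 - M.γ)))
    (hz : ∀ k, z k ∈ Set.Icc (0 : ℝ) (1 / (1 - M.γ))) :
    ∑ k, (M.primalUpdate T x i j k - z k) ^ 2 ≤ ∑ k, (x.v k - z k) ^ 2
      - 2 * M.α T * (((1 - M.γ) * M.q i / M.mixVec x.ξ i - 1) * (x.v i - z i)
        + M.γ * (x.v j - z j)) + 2 * M.α T ^ 2 := by
  have hα := M.α_nonneg T
  set g := (1 - M.γ) * M.q i / M.mixVec x.ξ i - 1 with hg
  have hw := M.mixVec_pos x.ξ i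
  have hg1 : g ≤ 0 := by
    rw [hg, sub_nonpos, div_le_one hw]
    exact M.le_mixVec x.ξ i
  have hg0 : -1 ≤ g := by
    have := div_nonneg (mul_pos M.one_sub_γ_pos (M.q_pos i)).le hw.le
    rw [hg]
    linarith
  set v₁ := Function.update x.v i (M.clip (x.v i - M.α T * g)) with hv₁
  have h1 := M.dist_sq_update_clip x.v z i (M.α T * g) (hz i)
  have h2 := M.dist_sq_update_clip v₁ z j (M.α T * M.γ) (hz j)
  -- This matters only for `i = j`, when the second step starts from a coordinate already changed.
  -- The first gradient `g` lies in `[-1, 0]`, so the first step raised that coordinate, which only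
  -- improves the decrease from the second step.
  have h3 : x.v j ≤ v₁ j := by
    rw [hv₁, Function.update_apply]
    split_ifs with h
    · rw [h]
      calc x.v i = M.clip (x.v i) := (M.clip_of_mem (hx i)).symm
        _ ≤ _ := M.clip_mono (by nlinarith)
    · rfl
  have h4 : ∑ k, (M.primalUpdate T x i j k - z k) ^ 2 =
    ∑ k, (Function.update v₁ j (M.clip (v₁ j - M.α T * M.γ)) k - z k) ^ 2 := rfl
  rw [h4]
  have hγ0 := M.γ_nonneg
  have hγ1 := M.γ_mem.2.le
  have h5 : (M.α T * g) ^ 2 ≤ M.α T ^ 2 := by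
    rw [mul_pow]
    exact mul_le_of_le_one_right (sq_nonneg _) (by nlinarith)
  have h6 : (M.α T * M.γ) ^ 2 ≤ M.α T ^ 2 := by
    rw [mul_pow]
    exact mul_le_of_le_one_right (sq_nonneg _) (by nlinarith)
  have h7 : M.α T * M.γ * (x.v j) ≤ M.α T * M.γ * (v₁ j) :=
    mul_le_mul_of_nonneg_left h3 (mul_nonneg hα hγ0)
  nlinarith

/-- The cross entropy of the dual iterate relative to a comparator with state distributions
`μ` (weighting `ξ`) and `ν` (weighting the policies `σ`). -/
def dualEntropy (μ ν : Fin n → ℝ) (σ : Policy n m) (x : Iterate n m) : ℝ :=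
  -(M.γ * ∑ i, μ i * Real.log (x.ξ i)) - ∑ i, ν i * ∑ a, σ i a * Real.log (x.π i a)

/-- One multiplicative weights step on the dual variables. -/
theorem dualEntropy_update (T : ℕ) (x : Iterate n m) (i : Fin n) (a : Fin m) (j : Fin n)
    (μ ν : Fin n → ℝ) (σ : Policy n m) (hμ : ∑ i, μ i = 1)
    (hν : ∀ j, ν j = (1 - M.γ) * M.q j + M.γ * μ j)
    (hξ : ∀ k, 0 < x.ξ k) (hπ : ∀ k b, 0 < x.π k b) (hΔ : M.dualStep T x i a j ≤ 0) :
    M.dualEntropy μ ν σ (M.update T x i a j) ≤ M.dualEntropy μ ν σ x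
      + (M.mixVec x.ξ i * x.π i a - ν i * σ i a) * M.dualStep T x i a j
      + M.mixVec x.ξ i * x.π i a * M.dualStep T x i a j ^ 2 / 2 := by
  set Δ := M.dualStep T x i a j with hΔ'
  set c := 1 + x.π i a * (Real.exp Δ - 1) with hc
  have hcpos : 0 < c := dual_factor_pos (x.π i) a Δ
  have e1 : ∑ k, μ k * Real.log ((M.update T x i a j).ξ k) =
      ∑ k, μ k * Real.log (x.ξ k) + μ i * Real.log c - Real.log (1 + x.ξ i * (c - 1)) :=
    cross_entropy_scaleAt x.ξ i c hcpos hξ μ hμ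
  have e2 : ∑ k, ν k * ∑ b, σ k b * Real.log ((M.update T x i a j).π k b) =
      ∑ k, ν k * ∑ b, σ k b * Real.log (x.π k b) + ν i * (σ i a * Δ - Real.log c) := by
    have : ∀ k, ∑ b, σ k b * Real.log ((M.update T x i a j).π k b) =
        ∑ b, σ k b * Real.log (x.π k b) + if k = i then σ i a * Δ - Real.log c else 0 := by
      intro k
      by_cases h : k = i
      · subst h
        have h1 : (M.update T x k a j).π k = scaleAt (x.π k) a (Real.exp Δ) (Real.exp_pos Δ) :=
          Function.update_self ..
        rw [h1, cross_entropy_scaleAt _ _ _ _ (hπ k) _ (simplex_sum (σ k)), Real.log_exp,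
          if_pos rfl]
        ring
      · have h1 : (M.update T x i a j).π k = x.π k := Function.update_of_ne h ..
        rw [h1, if_neg h, add_zero]
    simp_rw [this, mul_add, Finset.sum_add_distrib]
    simp
  have hs : 0 < 1 + x.ξ i * (c - 1) := scale_sum_pos x.ξ i hcpos
  have l1 := Real.log_le_sub_one_of_pos hs
  have l2 := Real.log_le_sub_one_of_pos hcpos
  have l3 := exp_le_quadratic_of_nonpos hΔ
  have hq := mul_pos M.one_sub_γ_pos (M.q_pos i)
  have hw := M.mixVec_pos x.ξ i
  have hwπ := mul_pos hw (hπ i a)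
  have k1 := mul_le_mul_of_nonneg_left l1 M.γ_nonneg
  have k2 := mul_le_mul_of_nonneg_left l2 hq.le
  have k3 := mul_le_mul_of_nonneg_left l3 hwπ.le
  rw [dualEntropy, dualEntropy, e1, e2]
  have hwe := M.mixVec_apply x.ξ i
  -- After the logarithms are linearized, the normalization of `ξ` (weight `γ`) and that of row `i`
  -- (net weight `ν i - γ μ i = (1 - γ) q i`, see `e3`) recombine to the sampling weight `w i`. This
  -- is why `ξ` is updated by the row factor `c`.
  have hk : M.γ * (1 + x.ξ i * (c - 1) - 1) + (1 - M.γ) * M.q i * (c - 1) =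
      M.mixVec x.ξ i * x.π i a * (Real.exp Δ - 1) := by
    rw [hwe, hc]
    ring
  have hνi := hν i
  have e3 : ν i * Real.log c - M.γ * μ i * Real.log c = (1 - M.γ) * M.q i * Real.log c := by
    rw [hνi]
    ring
  linarith

end DMDP

/-! ## The potential -/

namespace DMDP

variable {n m : ℕ} (M : DMDP n m)

theorem meanNext_temporalDifference (v : Fin n → ℝ) (i : Fin n) (a : Fin m) :
    ∑ j, M.p i a j * (M.γ * v j - v i + M.r i a j - 1 / (1 - M.γ)) =
      -M.gapOf v i a - 1 / (1 - M.γ) := by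
  have h : ∀ j, M.p i a j * (M.γ * v j - v i + M.r i a j - 1 / (1 - M.γ)) =
      M.γ * (M.p i a j * v j) + M.p i a j * M.r i a j - M.p i a j * (v i + 1 / (1 - M.γ)) := by
    intro j
    ring
  simp_rw [h, Finset.sum_sub_distrib, Finset.sum_add_distrib, ← Finset.sum_mul,
    ← Finset.mul_sum, simplex_sum, gapOf, meanNext, meanReward]
  ring

variable [NeZero n]

/-- Summation by parts for an occupancy measure. -/
theorem sum_occupancy (σ : Policy n m) (ν : Fin n → ℝ)
    (hν : ∀ j, ν j = (1 - M.γ) * M.q j + M.γ * M.pushState σ ν j) (d : Fin n → ℝ) :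
    ∑ i, ∑ a, ν i * σ i a * (d i - M.γ * M.meanNext d i a) = (1 - M.γ) * ∑ i, M.q i * d i := by
  have h1 : ∑ i, ∑ a, ν i * σ i a * (d i - M.γ * M.meanNext d i a) =
      ∑ i, ν i * d i - M.γ * ∑ i, ∑ a, ν i * σ i a * M.meanNext d i a := by
    rw [Finset.mul_sum, ← Finset.sum_sub_distrib]
    refine Finset.sum_congr rfl fun i _ => ?_
    have h : d i = ∑ a, σ i a * d i := by rw [← Finset.sum_mul, simplex_sum, one_mul]
    have h' : ν i * d i = ∑ a, ν i * (σ i a * d i) := by rw [← Finset.mul_sum, ← h]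
    rw [h', Finset.mul_sum, ← Finset.sum_sub_distrib]
    refine Finset.sum_congr rfl fun a _ => ?_
    ring
  have h2 : ∑ j, M.pushState σ ν j * d j = ∑ i, ∑ a, ν i * σ i a * M.meanNext d i a := by
    simp_rw [pushState, meanNext, Finset.mul_sum, Finset.sum_mul]
    rw [Finset.sum_comm]
    refine Finset.sum_congr rfl fun i _ => ?_
    rw [Finset.sum_comm]
    refine Finset.sum_congr rfl fun a _ => Finset.sum_congr rfl fun j _ => ?_
    ring
  rw [h1, ← h2, Finset.mul_sum, Finset.mul_sum, ← Finset.sum_sub_distrib]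
  refine Finset.sum_congr rfl fun j _ => ?_
  have := hν j
  linear_combination d j * this

/-- The mean over one sample `(i, a, j)` drawn at the iterate `x`. -/
def sampleMean (x : Iterate n m) (f : Fin n → Fin m → Fin n → ℝ) : ℝ :=
  ∑ i, ∑ a, ∑ j, M.mixVec x.ξ i * x.π i a * M.p i a j * f i a j

theorem β_pos [NeZero m] {T : ℕ} (hT : 0 < T) : 0 < M.β T := by
  have hn : (0 : ℝ) < n := Nat.cast_pos.mpr (Nat.pos_of_ne_zero (NeZero.ne n))
  have hm : (0 : ℝ) < m := Nat.cast_pos.mpr (Nat.pos_of_ne_zero (NeZero.ne m))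
  have hT' : (0 : ℝ) < T := Nat.cast_pos.mpr hT
  have hl : 0 < Real.log ((n : ℝ) * m + 1) := Real.log_pos (by nlinarith [mul_pos hn hm])
  have := M.one_sub_γ_pos
  rw [β]
  positivity

theorem α_pos [NeZero m] {T : ℕ} (hT : 0 < T) : 0 < M.α T := by
  have hn : (0 : ℝ) < n := Nat.cast_pos.mpr (Nat.pos_of_ne_zero (NeZero.ne n))
  have := M.one_sub_γ_pos
  have := M.β_pos hT
  rw [α]
  positivity

/-- The Lyapunov function of the primal-dual method. -/
def potential (T : ℕ) (μ ν : Fin n → ℝ) (σ : Policy n m) (x : Iterate n m) : ℝ :=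
  (∑ k, (x.v k - M.optValue k) ^ 2) / (2 * M.α T) + M.dualEntropy μ ν σ x / M.β T

/-- Iterates with values in range and full support. -/
structure Admissible (x : Iterate n m) : Prop where
  v_mem : ∀ k, x.v k ∈ Set.Icc (0 : ℝ) (1 / (1 - M.γ))
  ξ_pos : ∀ k, 0 < x.ξ k
  π_pos : ∀ k b, 0 < x.π k b

variable {M}

theorem Admissible.update {x : Iterate n m} (hx : M.Admissible x) (T : ℕ) (i : Fin n) (a : Fin m)
    (j : Fin n) : M.Admissible (M.update T x i a j) := by
  refine ⟨M.primalUpdate_mem T x i j hx.v_mem,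
    scaleAt_pos _ _ _ (dual_factor_pos (x.π i) a _) hx.ξ_pos, fun k b => ?_⟩
  by_cases h : k = i
  · subst h
    have h1 : (M.update T x k a j).π k = scaleAt (x.π k) a _ (Real.exp_pos _) :=
      Function.update_self ..
    rw [h1]
    exact scaleAt_pos _ _ _ _ (hx.π_pos k) b
  · have h1 : (M.update T x i a j).π k = x.π k := Function.update_of_ne h ..
    rw [h1]
    exact hx.π_pos k b

variable (M)

/-- The estimate carries the probability of the sample as a factor: it cancels the division by `w i
* π i a` in the exponent. The linear term becomes `(W - ν σ) p num` and the quadratic term `p β num²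
/ 2`, without any lower bound on `W`. -/
theorem potential_update_le [NeZero m] {T : ℕ} (hT : 0 < T) {x : Iterate n m}
    (hx : M.Admissible x)
    (σ : Policy n m) (μ ν : Fin n → ℝ) (hμ : ∑ i, μ i = 1)
    (hν : ∀ j, ν j = (1 - M.γ) * M.q j + M.γ * μ j) (i : Fin n) (a : Fin m) (j : Fin n) :
    M.mixVec x.ξ i * x.π i a * M.p i a j * M.potential T μ ν σ (M.update T x i a j) ≤
      M.mixVec x.ξ i * x.π i a * M.p i a j * (M.potential T μ ν σ x + M.α T
        - (((1 - M.γ) * M.q i / M.mixVec x.ξ i - 1) * (x.v i - M.optValue i)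
          + M.γ * (x.v j - M.optValue j)))
      + (M.mixVec x.ξ i * x.π i a - ν i * σ i a) *
          (M.p i a j * (M.γ * x.v j - x.v i + M.r i a j - 1 / (1 - M.γ)))
      + M.p i a j * (M.β T * (2 / (1 - M.γ) ^ 2)) := by
  have hα := M.α_pos hT
  have hβ := M.β_pos hT
  have hw := M.mixVec_pos x.ξ i
  have hπ := hx.π_pos i a
  have hp := simplex_nonneg (M.p i a) j
  have hwπ := mul_pos hw hπ
  have hnum := M.temporalDifference_mem x i a j hx.v_mem
  set num := M.γ * x.v j - x.v i + M.r i a j - 1 / (1 - M.γ) with hnum'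
  set W := M.mixVec x.ξ i * x.π i a with hW
  have hΔ : M.dualStep T x i a j = M.β T * (num / W) := rfl
  have hΔ0 : M.dualStep T x i a j ≤ 0 := by
    rw [hΔ]
    exact mul_nonpos_of_nonneg_of_nonpos hβ.le (div_nonpos_of_nonpos_of_nonneg hnum.2 hwπ.le)
  have h1 := M.dist_sq_primalUpdate T x i j M.optValue hx.v_mem M.optValue_mem
  have h2 := M.dualEntropy_update T x i a j μ ν σ hμ hν hx.ξ_pos hx.π_pos hΔ0
  rw [hΔ] at h2
  set G := ((1 - M.γ) * M.q i / M.mixVec x.ξ i - 1) * (x.v i - M.optValue i)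
    + M.γ * (x.v j - M.optValue j) with hG
  have h3 : (∑ k, ((M.update T x i a j).v k - M.optValue k) ^ 2) / (2 * M.α T) ≤
      (∑ k, (x.v k - M.optValue k) ^ 2) / (2 * M.α T) - G + M.α T := by
    rw [div_le_iff₀ (by positivity)]
    have e : ((∑ k, (x.v k - M.optValue k) ^ 2) / (2 * M.α T) - G + M.α T) * (2 * M.α T) =
      ∑ k, (x.v k - M.optValue k) ^ 2 - 2 * M.α T * G + 2 * M.α T ^ 2 := by
      field_simp
    rw [e]
    exact h1
  have h4 : M.dualEntropy μ ν σ (M.update T x i a j) / M.β T ≤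
      M.dualEntropy μ ν σ x / M.β T + (W - ν i * σ i a) * (num / W) +
        M.β T * (num ^ 2 / (2 * W)) := by
    rw [div_le_iff₀ hβ]
    have e : (M.dualEntropy μ ν σ x / M.β T + (W - ν i * σ i a) * (num / W) +
        M.β T * (num ^ 2 / (2 * W))) * M.β T = M.dualEntropy μ ν σ x
      + (W - ν i * σ i a) * (M.β T * (num / W)) + W * (M.β T * (num / W)) ^ 2 / 2 := by
      field_simp
    rw [e]
    exact h2
  have hpos : 0 ≤ W * M.p i a j := mul_nonneg hwπ.le hp
  have h5 := mul_le_mul_of_nonneg_left (add_le_add h3 h4) hpos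
  have e2 : W * M.p i a j * ((W - ν i * σ i a) * (num / W)) =
      (W - ν i * σ i a) * (M.p i a j * num) := by
    field_simp
  have e3 : W * M.p i a j * (M.β T * (num ^ 2 / (2 * W))) =
      M.p i a j * (M.β T * (num ^ 2 / 2)) := by
    field_simp
  have h6 : num ^ 2 / 2 ≤ 2 / (1 - M.γ) ^ 2 := by
    have : num ^ 2 ≤ (2 / (1 - M.γ)) ^ 2 := sq_le_sq' hnum.1 (hnum.2.trans
      (div_nonneg zero_le_two M.one_sub_γ_pos.le))
    have e : (2 / (1 - M.γ)) ^ 2 / 2 = 2 / (1 - M.γ) ^ 2 := by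
      rw [div_pow]
      ring
    linarith
  have h7 := mul_le_mul_of_nonneg_left (mul_le_mul_of_nonneg_left h6 hβ.le) hp
  have e4 : M.potential T μ ν σ (M.update T x i a j) =
    (∑ k, ((M.update T x i a j).v k - M.optValue k) ^ 2) / (2 * M.α T) +
      M.dualEntropy μ ν σ (M.update T x i a j) / M.β T := rfl
  have e5 : M.potential T μ ν σ x = (∑ k, (x.v k - M.optValue k) ^ 2) / (2 * M.α T) +
      M.dualEntropy μ ν σ x / M.β T := rfl
  rw [e4, e5]
  linear_combination h5 + e2 + e3 + h7

/-- The potential decreases in expectation by the duality gap, up to a constant. -/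
theorem sampleMean_potential_le [NeZero m] {T : ℕ} (hT : 0 < T) {x : Iterate n m}
    (hx : M.Admissible x)
    (σ : Policy n m) (ν : Fin n → ℝ) (hν1 : ν ∈ stdSimplex ℝ (Fin n))
    (hν : ∀ j, ν j = (1 - M.γ) * M.q j + M.γ * M.pushState σ ν j)
    (hσ : ∀ i a, σ i a * M.gap i a = 0) :
    M.sampleMean x (fun i a j => M.potential T (M.pushState σ ν) ν σ (M.update T x i a j))
      + ∑ i, ∑ a, M.mixVec x.ξ i * x.π i a * M.gap i a ≤
    M.potential T (M.pushState σ ν) ν σ x + M.α T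
      + (n : ℝ) * m * (M.β T * (2 / (1 - M.γ) ^ 2)) := by
  set μ := M.pushState σ ν with hμ
  set d : Fin n → ℝ := fun k => x.v k - M.optValue k with hd
  set c := M.β T * (2 / (1 - M.γ) ^ 2) with hc
  have hw1 : ∑ i, ∑ a, M.mixVec x.ξ i * x.π i a = 1 := by
    simp_rw [← Finset.mul_sum, simplex_sum, mul_one, simplex_sum]
  have hν2 : ∑ i, ∑ a, ν i * σ i a = 1 := by
    simp_rw [← Finset.mul_sum, simplex_sum, mul_one]
    exact hν1.2
  have h1 : M.sampleMean x (fun i a j => M.potential T μ ν σ (M.update T x i a j)) ≤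
      ∑ i, ∑ a, (M.mixVec x.ξ i * x.π i a * (M.potential T μ ν σ x + M.α T
        - (((1 - M.γ) * M.q i / M.mixVec x.ξ i - 1) * d i + M.γ * M.meanNext d i a))
      + (M.mixVec x.ξ i * x.π i a - ν i * σ i a) * (-M.gapOf x.v i a - 1 / (1 - M.γ)) + c) := by
    refine Finset.sum_le_sum fun i _ => Finset.sum_le_sum fun a _ => ?_
    refine (Finset.sum_le_sum fun j _ => M.potential_update_le hT hx σ μ ν
      (M.pushState_mem σ hν1).2 hν i a j).trans_eq ?_
    rw [← meanNext_temporalDifference]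
    simp_rw [Finset.sum_add_distrib, ← Finset.mul_sum, ← Finset.sum_mul, simplex_sum]
    have : ∀ j, M.mixVec x.ξ i * x.π i a * M.p i a j * (M.potential T μ ν σ x + M.α T
        - (((1 - M.γ) * M.q i / M.mixVec x.ξ i - 1) * (x.v i - M.optValue i)
          + M.γ * (x.v j - M.optValue j))) =
      M.mixVec x.ξ i * x.π i a * (M.p i a j * (M.potential T μ ν σ x + M.α T
        - ((1 - M.γ) * M.q i / M.mixVec x.ξ i - 1) * d i) - M.γ * (M.p i a j * d j)) := by
      intro j
      rw [hd]
      ring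
    simp_rw [this, ← Finset.mul_sum, Finset.sum_sub_distrib, ← Finset.sum_mul,
      ← Finset.mul_sum, simplex_sum, meanNext]
    ring
  -- By linearity `gapOf v = gap + d - γ P d`. The terms `w π (d - γ P d)` of the primal and the
  -- dual step cancel, and `σ * gap = 0` removes the gap on the comparator's side. The two remaining
  -- terms in `d` sum to `∓ (1 - γ) ∑ q d`, by `sum_occupancy` for the second one; the shifts `1 /
  -- (1 - γ)` cancel because both measures have mass one.
  have h2 : ∀ i a, M.mixVec x.ξ i * x.π i a * (M.potential T μ ν σ x + M.α T
        - (((1 - M.γ) * M.q i / M.mixVec x.ξ i - 1) * d i + M.γ * M.meanNext d i a))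
      + (M.mixVec x.ξ i * x.π i a - ν i * σ i a) * (-M.gapOf x.v i a - 1 / (1 - M.γ)) + c
      = M.mixVec x.ξ i * x.π i a * (M.potential T μ ν σ x + M.α T - 1 / (1 - M.γ))
        + ν i * σ i a * (1 / (1 - M.γ)) - x.π i a * ((1 - M.γ) * (M.q i * d i))
        - M.mixVec x.ξ i * x.π i a * M.gap i a
        + ν i * σ i a * (d i - M.γ * M.meanNext d i a) + c := by
    intro i a
    have hw := (M.mixVec_pos x.ξ i).ne'
    have e1 : M.mixVec x.ξ i * ((1 - M.γ) * M.q i / M.mixVec x.ξ i) = (1 - M.γ) * M.q i := by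
      field_simp
    have e2 : M.meanNext d i a = M.meanNext x.v i a - M.meanNext M.optValue i a :=
      M.meanNext_sub _ _ i a
    have e3 : d i = x.v i - M.optValue i := rfl
    have e4 := hσ i a
    rw [gap, gapOf] at e4
    rw [gap, gapOf, gapOf, e2, e3]
    linear_combination -(x.π i a * (x.v i - M.optValue i)) * e1 + ν i * e4
  simp_rw [h2, Finset.sum_add_distrib, Finset.sum_sub_distrib, Finset.sum_add_distrib] at h1
  rw [M.sum_occupancy σ ν hν d] at h1
  have s1 : ∀ K : ℝ, ∑ i, ∑ a, M.mixVec x.ξ i * x.π i a * K = K := fun K => by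
    nth_rw 2 [← one_mul K]
    rw [← hw1]
    simp_rw [Finset.sum_mul]
  have s2 : ∀ K : ℝ, ∑ i, ∑ a, ν i * σ i a * K = K := fun K => by
    nth_rw 2 [← one_mul K]
    rw [← hν2]
    simp_rw [Finset.sum_mul]
  have s3 : ∀ K : Fin n → ℝ, ∑ i, ∑ a, x.π i a * K i = ∑ i, K i := fun K => by
    simp_rw [← Finset.sum_mul, simplex_sum, one_mul]
  rw [s1, s2, s3, ← Finset.mul_sum] at h1
  simp only [Finset.sum_const, Finset.card_univ, Fintype.card_fin, nsmul_eq_mul] at h1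
  linarith

end DMDP

/-! ## Expectations, and the quality of the primal-dual method -/

/-- The expectation of a nonnegative function under a probability mass function. -/
def expect {E : Type*} (p : PMF E) (f : E → ℝ≥0∞) : ℝ≥0∞ := ∑' a, p a * f a

section expect

variable {E F : Type*}

theorem expect_pure (a : E) (f : E → ℝ≥0∞) : expect (PMF.pure a) f = f a := by
  rw [expect, tsum_eq_single a]
  · simp
  · intro b hb
    simp [PMF.pure_apply, hb]

theorem expect_bind (p : PMF E) (k : E → PMF F) (f : F → ℝ≥0∞) :
    expect (p.bind k) f = expect p fun a => expect (k a) f := by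
  simp_rw [expect, PMF.bind_apply, ← ENNReal.tsum_mul_right, ← ENNReal.tsum_mul_left]
  rw [ENNReal.tsum_comm]
  simp_rw [mul_assoc]

theorem expect_map (p : PMF E) (g : E → F) (f : F → ℝ≥0∞) :
    expect (p.map g) f = expect p fun a => f (g a) := by
  rw [PMF.map, expect_bind]
  simp_rw [Function.comp_apply, expect_pure]

theorem expect_mono (p : PMF E) {f g : E → ℝ≥0∞} (h : ∀ a, f a ≤ g a) :
    expect p f ≤ expect p g :=
  ENNReal.tsum_le_tsum fun a => mul_le_mul_right (h a) _

theorem expect_add (p : PMF E) (f g : E → ℝ≥0∞) :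
    expect p (fun a => f a + g a) = expect p f + expect p g := by
  simp_rw [expect, mul_add, ENNReal.tsum_add]

theorem expect_const (p : PMF E) (c : ℝ≥0∞) : expect p (fun _ => c) = c := by
  rw [expect, ENNReal.tsum_mul_right, p.tsum_coe, one_mul]

theorem expect_const_mul (p : PMF E) (c : ℝ≥0∞) (f : E → ℝ≥0∞) :
    expect p (fun a => c * f a) = c * expect p f := by
  simp_rw [expect, ← ENNReal.tsum_mul_left, mul_left_comm]

theorem toOuterMeasure_eq_expect (p : PMF E) (s : Set E) :
    p.toOuterMeasure s = expect p (s.indicator 1) := by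
  rw [PMF.toOuterMeasure_apply, expect]
  refine tsum_congr fun a => ?_
  by_cases h : a ∈ s <;> simp [h]

theorem expect_vecPMF {k : ℕ} (x : stdSimplex ℝ (Fin k)) (f : Fin k → ℝ≥0∞) :
    expect (vecPMF x) f = ∑ a, ENNReal.ofReal (x a) * f a := by
  rw [expect, tsum_fintype]
  rfl

theorem toOuterMeasure_add_compl (p : PMF E) (s : Set E) :
    p.toOuterMeasure s + p.toOuterMeasure sᶜ = 1 := by
  rw [toOuterMeasure_eq_expect, toOuterMeasure_eq_expect, ← expect_add, ← expect_const p 1]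
  refine congrArg _ (funext fun a => ?_)
  by_cases h : a ∈ s <;> simp [h]

theorem le_toOuterMeasure_of_compl_le (p : PMF E) {s : Set E} {ρ : ℝ} (hρ : 0 ≤ ρ)
    (h : p.toOuterMeasure sᶜ ≤ ENNReal.ofReal ρ) :
    ENNReal.ofReal (1 - ρ) ≤ p.toOuterMeasure s := by
  rw [ENNReal.ofReal_sub _ hρ, ENNReal.ofReal_one, tsub_le_iff_right,
    ← toOuterMeasure_add_compl p s]
  exact add_le_add_right h _

theorem compl_le_of_le_toOuterMeasure (p : PMF E) {s : Set E} {ρ : ℝ}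
    (h : ENNReal.ofReal (1 - ρ) ≤ p.toOuterMeasure s) :
    p.toOuterMeasure sᶜ ≤ ENNReal.ofReal ρ := by
  have h1 := toOuterMeasure_add_compl p s
  have h2 : p.toOuterMeasure s ≠ ∞ := by
    intro h3
    rw [h3] at h1
    simp at h1
  have h4 : p.toOuterMeasure sᶜ = 1 - p.toOuterMeasure s := by
    rw [← h1, ENNReal.add_sub_cancel_left h2]
  rw [h4, tsub_le_iff_right]
  calc (1 : ℝ≥0∞) = ENNReal.ofReal (ρ + (1 - ρ)) := by simp
    _ ≤ ENNReal.ofReal ρ + ENNReal.ofReal (1 - ρ) := ENNReal.ofReal_add_le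
    _ ≤ _ := add_le_add_right h _

/-- Markov's inequality. -/
theorem mul_toOuterMeasure_le_expect (p : PMF E) (f : E → ℝ≥0∞) (c : ℝ≥0∞) :
    c * p.toOuterMeasure {a | c ≤ f a} ≤ expect p f := by
  rw [toOuterMeasure_eq_expect, ← expect_const_mul]
  refine expect_mono p fun a => ?_
  by_cases h : c ≤ f a <;> simp [h]

end expect

/-- Because `n m + 1 ≥ 3 > e` and `n m + 1 ≤ (n m)²`. This compares the logarithm in `β` with the
one in the hypothesis on `T`; for `n m = 1` the latter is zero and the case is treated apart. -/
theorem log_bounds {n m : ℕ} (h : 2 ≤ n * m) : 1 ≤ Real.log ((n : ℝ) * m + 1) ∧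
    Real.log ((n : ℝ) * m + 1) ≤ 2 * Real.log ((n : ℝ) * m) := by
  have h2 : (2 : ℝ) ≤ (n : ℝ) * m := by exact_mod_cast h
  constructor
  · rw [Real.le_log_iff_exp_le (by linarith)]
    linarith [Real.exp_one_lt_d9]
  · rw [← Real.log_rpow (by linarith)]
    refine Real.log_le_log (by linarith) ?_
    norm_num
    nlinarith

/-! ### Expected drift of the potential, and the shortfall of the averaged policy. -/

namespace DMDP

variable {n m : ℕ} (M : DMDP n m) [NeZero n]

theorem expect_iteration (T : ℕ) (x : Iterate n m) (f : Iterate n m → ℝ) (hf : ∀ i a j,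
    0 ≤ f (M.update T x i a j)) :
    expect (M.iteration T x) (fun y => ENNReal.ofReal (f y)) =
      ENNReal.ofReal (M.sampleMean x fun i a j => f (M.update T x i a j)) := by
  have h3 : ∀ i a, 0 ≤ ∑ j, M.p i a j * f (M.update T x i a j) := fun i a =>
    Finset.sum_nonneg fun j _ => mul_nonneg (simplex_nonneg _ j) (hf i a j)
  have h2 : ∀ i, 0 ≤ ∑ a, x.π i a * ∑ j, M.p i a j * f (M.update T x i a j) := fun i =>
    Finset.sum_nonneg fun a _ => mul_nonneg (simplex_nonneg _ a) (h3 i a)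
  have vec : ∀ {k : ℕ} (y : stdSimplex ℝ (Fin k)) (g : Fin k → ℝ), (∀ a, 0 ≤ g a) →
      expect (vecPMF y) (fun a => ENNReal.ofReal (g a)) = ENNReal.ofReal (∑ a, y a * g a) := by
    intro k y g hg
    rw [expect_vecPMF, ENNReal.ofReal_sum_of_nonneg fun a _ =>
      mul_nonneg (simplex_nonneg _ a) (hg a)]
    exact Finset.sum_congr rfl fun a _ => (ENNReal.ofReal_mul (simplex_nonneg _ a)).symm
  rw [iteration, expect_bind]
  simp_rw [expect_bind, expect_map]
  have e1 : ∀ i a, expect (vecPMF (M.p i a)) (fun j => ENNReal.ofReal (f (M.update T x i a j))) =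
      ENNReal.ofReal (∑ j, M.p i a j * f (M.update T x i a j)) := fun i a => vec _ _ (hf i a)
  simp_rw [e1]
  have e2 : ∀ i, expect (vecPMF (x.π i)) (fun a => ENNReal.ofReal
      (∑ j, M.p i a j * f (M.update T x i a j))) = ENNReal.ofReal
      (∑ a, x.π i a * ∑ j, M.p i a j * f (M.update T x i a j)) := fun i => vec _ _ (h3 i)
  simp_rw [e2]
  rw [vec _ _ h2, sampleMean]
  simp_rw [Finset.mul_sum, mul_assoc]

/-- The weighted shortfall of a policy. -/
def policyGap (π : Policy n m) : ℝ := ∑ i, ∑ a, (1 - M.γ) * M.q i * π i a * M.gap i a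

theorem policyGap_eq (π : Policy n m) :
    M.policyGap π = (1 - M.γ) / n * ∑ i, ∑ a, π i a * M.gap i a := by
  simp_rw [policyGap, Finset.mul_sum, q_apply]
  refine Finset.sum_congr rfl fun i _ => Finset.sum_congr rfl fun a _ => ?_
  ring

/-- The shortfall is linear in the policy, although the value is not; hence a bound for the
accumulated shortfall of the iterates passes to their average. -/
theorem policyGap_avgPolicy {T : ℕ} [NeZero T] (h : Fin T → Policy n m) :
    (T : ℝ) * M.policyGap (avgPolicy h) = ∑ s, M.policyGap (h s) := by
  have hT : (T : ℝ) ≠ 0 := Nat.cast_ne_zero.mpr (NeZero.ne T)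
  have e : ∑ s, M.policyGap (h s) =
      ∑ i, ∑ a, ∑ s, (1 - M.γ) * M.q i * h s i a * M.gap i a := by
    simp_rw [policyGap]
    rw [Finset.sum_comm]
    exact Finset.sum_congr rfl fun i _ => Finset.sum_comm
  rw [e, policyGap, Finset.mul_sum]
  refine Finset.sum_congr rfl fun i _ => ?_
  rw [Finset.mul_sum]
  refine Finset.sum_congr rfl fun a _ => ?_
  change (T : ℝ) * ((1 - M.γ) * M.q i * (1 / (T : ℝ) * ∑ t, h t i a) * M.gap i a) = _
  rw [← Finset.sum_mul, ← Finset.mul_sum]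
  field_simp

variable [NeZero m]

theorem policyGap_nonneg (π : Policy n m) : 0 ≤ M.policyGap π :=
  Finset.sum_nonneg fun i _ => Finset.sum_nonneg fun a _ => mul_nonneg (mul_nonneg
    (mul_pos M.one_sub_γ_pos (M.q_pos i)).le (simplex_nonneg _ a)) (M.gap_nonneg i a)

theorem potential_nonneg (T : ℕ) [NeZero T] (μ ν : Fin n → ℝ) (σ : Policy n m)
    (x : Iterate n m) (hμ : ∀ i, 0 ≤ μ i) (hν : ∀ i, 0 ≤ ν i) : 0 ≤ M.potential T μ ν σ x := by
  have hT := Nat.pos_of_ne_zero (NeZero.ne T)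
  have hα := M.α_pos hT
  have hβ := M.β_pos hT
  have hl : ∀ {k : ℕ} (y : stdSimplex ℝ (Fin k)) (a : Fin k), Real.log (y a) ≤ 0 :=
    fun y a => Real.log_nonpos (simplex_nonneg y a) (simplex_le_one y a)
  have h1 : 0 ≤ M.dualEntropy μ ν σ x := by
    have a1 : M.γ * ∑ i, μ i * Real.log (x.ξ i) ≤ 0 :=
      mul_nonpos_of_nonneg_of_nonpos M.γ_nonneg (Finset.sum_nonpos fun i _ =>
        mul_nonpos_of_nonneg_of_nonpos (hμ i) (hl _ _))
    have a2 : ∑ i, ν i * ∑ a, σ i a * Real.log (x.π i a) ≤ 0 :=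
      Finset.sum_nonpos fun i _ => mul_nonpos_of_nonneg_of_nonpos (hν i) (Finset.sum_nonpos
        fun a _ => mul_nonpos_of_nonneg_of_nonpos (simplex_nonneg _ a) (hl _ _))
    rw [dualEntropy]
    linarith
  have h2 : 0 ≤ ∑ k, (x.v k - M.optValue k) ^ 2 := Finset.sum_nonneg fun k _ => sq_nonneg _
  rw [potential]
  positivity

theorem admissible_init : M.Admissible M.initIterate := by
  refine ⟨fun k => ⟨le_rfl, (one_div_pos.mpr M.one_sub_γ_pos).le⟩, fun k => ?_, fun k b => ?_⟩
  · exact one_div_pos.mpr (Nat.cast_pos.mpr (Nat.pos_of_ne_zero (NeZero.ne n)))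
  · exact one_div_pos.mpr (Nat.cast_pos.mpr (Nat.pos_of_ne_zero (NeZero.ne m)))

/-- The ratio of `α` to `β` is chosen so that `2α = n β / (1 - γ)²`, which turns the initial squared
distance, at most `n / (1 - γ)²`, into `1 / β`. The uniform starting vectors have cross entropy `γ
log n + log m`. -/
theorem potential_init_le (T : ℕ) [NeZero T] (σ : Policy n m) (μ ν : Fin n → ℝ)
    (hμ : ∑ i, μ i = 1) (hν : ∑ i, ν i = 1) :
    M.potential T μ ν σ M.initIterate ≤ (1 + Real.log ((n : ℝ) * m)) / M.β T := by
  have hn : (1 : ℝ) ≤ n := Nat.one_le_cast.mpr (Nat.pos_of_ne_zero (NeZero.ne n))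
  have hm : (1 : ℝ) ≤ m := Nat.one_le_cast.mpr (Nat.pos_of_ne_zero (NeZero.ne m))
  have hT := Nat.pos_of_ne_zero (NeZero.ne T)
  have hα := M.α_pos hT
  have hβ := M.β_pos hT
  have hg := M.one_sub_γ_pos
  have h1 : (∑ k, ((M.initIterate).v k - M.optValue k) ^ 2) / (2 * M.α T) ≤ 1 / M.β T := by
    rw [div_le_iff₀ (by positivity)]
    have e : 1 / M.β T * (2 * M.α T) = ∑ _k : Fin n, (1 / (1 - M.γ)) ^ 2 := by
      rw [α]
      simp only [Finset.sum_const, Finset.card_univ, Fintype.card_fin, nsmul_eq_mul]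
      field_simp
    rw [e]
    refine Finset.sum_le_sum fun k _ => ?_
    have := M.optValue_mem k
    change (0 - M.optValue k) ^ 2 ≤ _
    rw [zero_sub, neg_sq]
    exact pow_le_pow_left₀ this.1 this.2 2
  have h2 : M.dualEntropy μ ν σ M.initIterate ≤ Real.log ((n : ℝ) * m) := by
    have e : M.dualEntropy μ ν σ M.initIterate = -(M.γ * ∑ i, μ i * Real.log (1 / (n : ℝ)))
      - ∑ i, ν i * ∑ a, σ i a * Real.log (1 / (m : ℝ)) := rfl
    rw [e, ← Finset.sum_mul, hμ, Real.log_mul (by positivity) (by positivity)]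
    simp_rw [← Finset.sum_mul, simplex_sum]
    rw [← Finset.sum_mul, hν, one_div, one_div, Real.log_inv, Real.log_inv]
    nlinarith [Real.log_nonneg hn, M.γ_mem.2]
  have e := div_le_div_of_nonneg_right h2 hβ.le
  rw [potential, add_div]
  linarith

/-- The Lyapunov function, with value `∞` outside of the admissible iterates. -/
def lyapunov (T : ℕ) (μ ν : Fin n → ℝ) (σ : Policy n m) (x : Iterate n m) : ℝ≥0∞ :=
  open Classical in
  if M.Admissible x then ENNReal.ofReal (M.potential T μ ν σ x) else ∞

theorem expect_lyapunov_le (T : ℕ) [NeZero T] (σ : Policy n m) (ν : Fin n → ℝ)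
    (hν1 : ν ∈ stdSimplex ℝ (Fin n))
    (hν : ∀ j, ν j = (1 - M.γ) * M.q j + M.γ * M.pushState σ ν j)
    (hσ : ∀ i a, σ i a * M.gap i a = 0) (x : Iterate n m) :
    expect (M.iteration T x) (M.lyapunov T (M.pushState σ ν) ν σ)
      + ENNReal.ofReal (M.policyGap x.π) ≤ M.lyapunov T (M.pushState σ ν) ν σ x
      + ENNReal.ofReal (M.α T + (n : ℝ) * m * (M.β T * (2 / (1 - M.γ) ^ 2))) := by
  have hT := Nat.pos_of_ne_zero (NeZero.ne T)
  by_cases hx : M.Admissible x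
  · have h0 := fun y => M.potential_nonneg T (M.pushState σ ν) ν σ y
      (M.pushState_mem σ hν1).1 hν1.1
    have e1 : expect (M.iteration T x) (M.lyapunov T (M.pushState σ ν) ν σ) =
        expect (M.iteration T x)
          (fun y => ENNReal.ofReal (M.potential T (M.pushState σ ν) ν σ y)) := by
      rw [iteration]
      simp_rw [expect_bind, expect_map]
      refine congrArg _ (funext fun i => congrArg _ (funext fun a => congrArg _
        (funext fun j => ?_)))
      rw [lyapunov, if_pos (hx.update T i a j)]
    have hc : 0 ≤ M.α T + (n : ℝ) * m * (M.β T * (2 / (1 - M.γ) ^ 2)) := by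
      have := (M.α_pos hT).le
      have := (M.β_pos hT).le
      have := M.one_sub_γ_pos.le
      positivity
    rw [e1, expect_iteration _ _ _ _ fun i a j => h0 _, lyapunov, if_pos hx,
      ← ENNReal.ofReal_add (h0 x) hc, ← ENNReal.ofReal_add _ (M.policyGap_nonneg _)]
    · refine ENNReal.ofReal_le_ofReal ?_
      have h1 := M.sampleMean_potential_le hT hx σ ν hν1 hν hσ
      -- The exploration part `(1 - γ) q` of the sampling weights ties the drift to the shortfall of
      -- the policy, whatever `ξ` is.
      have h2 : M.policyGap x.π ≤ ∑ i, ∑ a, M.mixVec x.ξ i * x.π i a * M.gap i a :=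
        Finset.sum_le_sum fun i _ => Finset.sum_le_sum fun a _ => mul_le_mul_of_nonneg_right
          (mul_le_mul_of_nonneg_right (M.le_mixVec x.ξ i) (simplex_nonneg _ a))
          (M.gap_nonneg i a)
      linarith
    · refine Finset.sum_nonneg fun i _ => Finset.sum_nonneg fun a _ => Finset.sum_nonneg
        fun j _ => mul_nonneg (mul_nonneg (mul_nonneg (M.mixVec_pos _ _).le
        (simplex_nonneg _ _)) (simplex_nonneg _ _)) (h0 _)
  -- The value `∞` makes the claim trivial here, so that no statement about the support of the run
  -- has to be carried along.
  · rw [lyapunov, if_neg hx, top_add]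
    exact le_top

/-- A supermartingale argument: the Lyapunov function plus the shortfalls collected so far grows in
mean by at most a constant per iteration. -/
theorem expect_run_le (T : ℕ) [NeZero T] (σ : Policy n m) (ν : Fin n → ℝ)
    (hν1 : ν ∈ stdSimplex ℝ (Fin n))
    (hν : ∀ j, ν j = (1 - M.γ) * M.q j + M.γ * M.pushState σ ν j)
    (hσ : ∀ i a, σ i a * M.gap i a = 0) (t : ℕ) :
    expect (M.runPMF T t) (fun z => M.lyapunov T (M.pushState σ ν) ν σ z.1 +
        ∑ s, ENNReal.ofReal (M.policyGap (z.2 s))) ≤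
      M.lyapunov T (M.pushState σ ν) ν σ M.initIterate
      + t * ENNReal.ofReal (M.α T + (n : ℝ) * m * (M.β T * (2 / (1 - M.γ) ^ 2))) := by
  induction t with
  | zero =>
    rw [runPMF, expect_pure]
    simp
  | succ t ih =>
    set c := ENNReal.ofReal (M.α T + (n : ℝ) * m * (M.β T * (2 / (1 - M.γ) ^ 2)))
    rw [runPMF, expect_bind]
    have h : ∀ z : Iterate n m × (Fin t → Policy n m),
        expect ((M.iteration T z.1).map fun y => (y, (Fin.snoc z.2 z.1.π : Fin (t + 1) → _)))
        (fun z => M.lyapunov T (M.pushState σ ν) ν σ z.1 +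
        ∑ s, ENNReal.ofReal (M.policyGap (z.2 s))) ≤
        (M.lyapunov T (M.pushState σ ν) ν σ z.1 +
        ∑ s, ENNReal.ofReal (M.policyGap (z.2 s))) + c := by
      intro z
      rw [expect_map, expect_add]
      dsimp only
      rw [expect_const, Fin.sum_univ_castSucc]
      simp only [Fin.snoc_castSucc, Fin.snoc_last]
      have := M.expect_lyapunov_le T σ ν hν1 hν hσ z.1
      calc _ = (expect (M.iteration T z.1) (M.lyapunov T (M.pushState σ ν) ν σ) +
          ENNReal.ofReal (M.policyGap z.1.π)) + ∑ s, ENNReal.ofReal (M.policyGap (z.2 s)) := by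
            ring
        _ ≤ (M.lyapunov T (M.pushState σ ν) ν σ z.1 + c) +
            ∑ s, ENNReal.ofReal (M.policyGap (z.2 s)) := add_le_add_left this _
        _ = _ := by ring
    refine (expect_mono _ h).trans ?_
    rw [expect_add, expect_const]
    refine (add_le_add_left ih c).trans_eq ?_
    push_cast
    ring

theorem expect_policyGap_le (h2 : 2 ≤ n * m) (T : ℕ) [NeZero T] :
    expect (M.primalDual T) (fun π => ENNReal.ofReal (M.policyGap π)) ≤
      ENNReal.ofReal (7 * ((n : ℝ) * m) * M.β T / (1 - M.γ) ^ 2) := by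
  obtain ⟨σ, -, -, hσ⟩ := M.exists_optimal
  obtain ⟨ν, hν1, hν⟩ := M.exists_occupancy σ M.q
  have hT0 := Nat.pos_of_ne_zero (NeZero.ne T)
  have hT : (0 : ℝ) < T := Nat.cast_pos.mpr hT0
  have hn : (1 : ℝ) ≤ n := Nat.one_le_cast.mpr (Nat.pos_of_ne_zero (NeZero.ne n))
  have hm : (1 : ℝ) ≤ m := Nat.one_le_cast.mpr (Nat.pos_of_ne_zero (NeZero.ne m))
  have hβ := M.β_pos hT0
  have hα := M.α_pos hT0
  have hg := M.one_sub_γ_pos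
  set c := M.α T + (n : ℝ) * m * (M.β T * (2 / (1 - M.γ) ^ 2)) with hc
  have hc0 : 0 ≤ c := by positivity
  have key := M.expect_run_le T σ ν hν1 hν hσ T
  rw [lyapunov, if_pos M.admissible_init] at key
  have h1 : (T : ℝ≥0∞) * expect (M.primalDual T) (fun π => ENNReal.ofReal (M.policyGap π)) ≤
      ENNReal.ofReal ((1 + Real.log ((n : ℝ) * m)) / M.β T) + T * ENNReal.ofReal c := by
    rw [primalDual, expect_map, ← expect_const_mul]
    refine le_trans (expect_mono _ fun z => ?_) (key.trans (add_le_add_left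
      (ENNReal.ofReal_le_ofReal (M.potential_init_le T σ _ ν (M.pushState_mem σ hν1).2 hν1.2)) _))
    rw [← ENNReal.ofReal_natCast, ← ENNReal.ofReal_mul hT.le, policyGap_avgPolicy,
      ENNReal.ofReal_sum_of_nonneg fun s _ => M.policyGap_nonneg _]
    exact le_add_self
  have hl := log_bounds h2
  have hsq : M.β T ^ 2 * (2 * ((n : ℝ) * m * T)) =
      (1 - M.γ) ^ 2 * Real.log ((n : ℝ) * m + 1) := by
    rw [β, mul_pow, Real.sq_sqrt (div_nonneg (by linarith) (by positivity))]
    field_simp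
  have hlog : Real.log ((n : ℝ) * m) ≤ Real.log ((n : ℝ) * m + 1) :=
    Real.log_le_log (by positivity) (by linarith)
  -- Here `7 = 4 + 3`. By the choice of `β` and `1 + log(n m) ≤ 2 log(n m + 1)`, the initial
  -- potential is at most `4 n m T β / (1 - γ)²`; the constant `c` is at most `(1 + 2) n m β / (1 -
  -- γ)²`, the `1` being a bound for `α`.
  have h3 : (1 + Real.log ((n : ℝ) * m)) / M.β T + T * c ≤
      T * (7 * ((n : ℝ) * m) * M.β T / (1 - M.γ) ^ 2) := by
    have a1 : (1 + Real.log ((n : ℝ) * m)) / M.β T ≤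
        4 * (n * m) * T * M.β T / (1 - M.γ) ^ 2 := by
      rw [div_le_div_iff₀ hβ (by positivity)]
      have : 4 * ((n : ℝ) * m) * T * M.β T * M.β T =
        2 * ((1 - M.γ) ^ 2 * Real.log ((n : ℝ) * m + 1)) := by
        rw [← hsq]
        ring
      rw [this]
      nlinarith [sq_nonneg (1 - M.γ)]
    have a2 : c ≤ 3 * (n * m) * M.β T / (1 - M.γ) ^ 2 := by
      have : M.α T ≤ (n * m) * M.β T / (1 - M.γ) ^ 2 := by
        rw [α, div_mul_eq_mul_div, div_le_div_iff₀ (by positivity) (by positivity)]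
        have : (0 : ℝ) < n * M.β T * (1 - M.γ) ^ 2 := by positivity
        nlinarith
      have e : (n : ℝ) * m * (M.β T * (2 / (1 - M.γ) ^ 2)) =
        2 * ((n * m) * M.β T / (1 - M.γ) ^ 2) := by ring
      have e' : 3 * ((n : ℝ) * m) * M.β T / (1 - M.γ) ^ 2 =
        3 * ((n * m) * M.β T / (1 - M.γ) ^ 2) := by ring
      rw [hc, e, e']
      linarith
    have a3 := mul_le_mul_of_nonneg_left a2 hT.le
    have e : (T : ℝ) * (7 * ((n : ℝ) * m) * M.β T / (1 - M.γ) ^ 2) =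
      4 * (n * m) * T * M.β T / (1 - M.γ) ^ 2 +
        T * (3 * (n * m) * M.β T / (1 - M.γ) ^ 2) := by ring
    linarith
  have h4 := h1.trans_eq (b := ENNReal.ofReal ((1 + Real.log ((n : ℝ) * m)) / M.β T)
    + T * ENNReal.ofReal c) (by
      rw [← ENNReal.ofReal_natCast, ← ENNReal.ofReal_mul hT.le, ← ENNReal.ofReal_add _
        (mul_nonneg hT.le hc0)]
      exact div_nonneg (by
        have := Real.log_nonneg (show (1 : ℝ) ≤ (n : ℝ) * m by nlinarith)
        linarith) hβ.le)
  have h5 := h4.trans (ENNReal.ofReal_le_ofReal h3)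
  rw [ENNReal.ofReal_mul hT.le, ENNReal.ofReal_natCast] at h5
  exact (ENNReal.mul_le_mul_iff_right (Nat.cast_ne_zero.mpr (NeZero.ne T))
    (ENNReal.natCast_ne_top T)).mp h5

/-- The output of the primal-dual method is near-optimal with probability at least `2 / 3`. -/
theorem primalDual_near_optimal {ε : ℝ} (hε : 0 < ε) (T : ℕ) [NeZero T]
    (hT : 441 * ((n : ℝ) ^ 3 * m * Real.log ((n : ℝ) * m) / ((1 - M.γ) ^ 6 * ε ^ 2)) ≤ T) :
    ENNReal.ofReal (2 / 3) ≤
      (M.primalDual T).toOuterMeasure {π | ∀ i, M.value π i ≥ M.optValue i - ε} := by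
  have hn0 := Nat.pos_of_ne_zero (NeZero.ne n)
  have hm0 := Nat.pos_of_ne_zero (NeZero.ne m)
  -- For `n m = 1` the hypothesis on `T` is empty, but there is only one policy.
  rcases Nat.lt_or_ge (n * m) 2 with h2 | h2
  · have hm1 : m = 1 := by nlinarith
    subst hm1
    obtain ⟨σ, hσ, -⟩ := M.exists_optimal
    have hall : {π : Policy n 1 | ∀ i, M.value π i ≥ M.optValue i - ε} = Set.univ := by
      refine Set.eq_univ_of_forall fun π i => ?_
      have : π = σ := by
        funext i
        refine Subtype.ext (funext fun a => ?_)
        have h1 := simplex_sum (π i)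
        have h2 := simplex_sum (σ i)
        rw [Fin.sum_univ_one] at h1 h2
        rw [Subsingleton.elim a 0]
        exact h1.trans h2.symm
      rw [this, hσ]
      linarith
    rw [hall, toOuterMeasure_eq_expect, Set.indicator_univ]
    change _ ≤ expect _ (fun _ => 1)
    rw [expect_const]
    exact ENNReal.ofReal_le_one.mpr (by norm_num)
  · have hn : (0 : ℝ) < n := Nat.cast_pos.mpr hn0
    have hm : (0 : ℝ) < m := Nat.cast_pos.mpr hm0
    have hT0 := Nat.pos_of_ne_zero (NeZero.ne T)
    have hT1 : (0 : ℝ) < T := Nat.cast_pos.mpr hT0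
    have hβ := M.β_pos hT0
    have hg := M.one_sub_γ_pos
    have hl := log_bounds h2
    rw [show (2 : ℝ) / 3 = 1 - 1 / 3 by norm_num]
    refine le_toOuterMeasure_of_compl_le _ (by norm_num) ?_
    -- A policy that loses more than `ε` at some state has `policyGap` at least `c`: one factor `1 -
    -- γ` comes from `optValue_sub_value_le`, the factor `(1 - γ) / n` from `policyGap_eq`. With
    -- mean at most `c / 3`, Markov's inequality gives failure probability `1 / 3`.
    set c : ℝ := (1 - M.γ) ^ 2 * ε / n with hc
    have hc0 : 0 < c := by positivity
    have hsub : {π : Policy n m | ∀ i, M.value π i ≥ M.optValue i - ε}ᶜ ⊆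
        {π | ENNReal.ofReal c ≤ ENNReal.ofReal (M.policyGap π)} := by
      intro π hπ
      simp only [Set.mem_compl_iff, Set.mem_ofPred_eq, not_forall, not_le] at hπ
      obtain ⟨i, hi⟩ := hπ
      refine ENNReal.ofReal_le_ofReal ?_
      have h3 := M.optValue_sub_value_le π i
      rw [le_div_iff₀ hg] at h3
      rw [policyGap_eq, hc, div_mul_eq_mul_div]
      refine div_le_div_of_nonneg_right ?_ hn.le
      nlinarith
    refine ((M.primalDual T).toOuterMeasure.mono hsub).trans ?_
    have h4 := (mul_toOuterMeasure_le_expect (M.primalDual T)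
      (fun π => ENNReal.ofReal (M.policyGap π)) (ENNReal.ofReal c)).trans
      (M.expect_policyGap_le h2 T)
    have h5 : 7 * ((n : ℝ) * m) * M.β T / (1 - M.γ) ^ 2 ≤ c * (1 / 3) := by
      have hsq : M.β T ^ 2 = (1 - M.γ) ^ 2 * Real.log ((n : ℝ) * m + 1) /
          (2 * ((n : ℝ) * m * T)) := by
        rw [β, mul_pow, Real.sq_sqrt (div_nonneg (by linarith) (by positivity))]
        ring
      rw [← mul_div_assoc, div_le_iff₀ (by positivity)] at hT
      -- The claim is squared to bring in `β²`. The constant is `441 = (3 * 7)²`; the factor `2`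
      -- from `log(n m + 1) ≤ 2 log(n m)` is absorbed by the `2` in the denominator of `β²`.
      have h6 : 21 * ((n : ℝ) * n * m) * M.β T ≤ (1 - M.γ) ^ 4 * ε := by
        refine (sq_le_sq₀ (by positivity) (by positivity)).mp ?_
        rw [mul_pow, hsq, ← mul_div_assoc, div_le_iff₀ (by positivity)]
        have h7 : (n : ℝ) ^ 3 * m * Real.log ((n : ℝ) * m + 1) ≤
            2 * ((n : ℝ) ^ 3 * m * Real.log ((n : ℝ) * m)) := by
          have : (0 : ℝ) < (n : ℝ) ^ 3 * m := by positivity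
          nlinarith
        have h8 : 441 * ((n : ℝ) ^ 3 * m * Real.log ((n : ℝ) * m + 1)) ≤
            2 * (T * ((1 - M.γ) ^ 6 * ε ^ 2)) := by linarith
        have h9 : (0 : ℝ) ≤ n * m * (1 - M.γ) ^ 2 := by positivity
        calc (21 * ((n : ℝ) * n * m)) ^ 2 * ((1 - M.γ) ^ 2 * Real.log ((n : ℝ) * m + 1))
            = n * m * (1 - M.γ) ^ 2 * (441 * ((n : ℝ) ^ 3 * m * Real.log ((n : ℝ) * m + 1))) := by
              ring
          _ ≤ n * m * (1 - M.γ) ^ 2 * (2 * (T * ((1 - M.γ) ^ 6 * ε ^ 2))) :=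
              mul_le_mul_of_nonneg_left h8 h9
          _ = _ := by ring
      rw [hc, div_mul_eq_mul_div, div_le_div_iff₀ (by positivity) hn]
      nlinarith
    have h6 := h4.trans (ENNReal.ofReal_le_ofReal h5)
    rw [ENNReal.ofReal_mul hc0.le] at h6
    exact (ENNReal.mul_le_mul_iff_right (ENNReal.ofReal_pos.mpr hc0).ne'
      ENNReal.ofReal_ne_top).mp h6

end DMDP

/-! ## The quality of the meta algorithm -/

theorem expect_indepPMF_prod {E : Type} (K : ℕ) (μ : Fin K → PMF E) (f : Fin K → E → ℝ≥0∞) :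
    expect (indepPMF K μ) (fun y => ∏ k, f k (y k)) = ∏ k, expect (μ k) (f k) := by
  induction K with
  | zero => rw [indepPMF, expect_pure]; simp
  | succ K ih =>
    rw [indepPMF, expect_bind, Fin.prod_univ_succ]
    have : ∀ x, expect ((indepPMF K fun k => μ k.succ).map
        fun y => (Fin.cons x y : Fin (K + 1) → E)) (fun y => ∏ k, f k (y k)) =
        (∏ k : Fin K, expect (μ k.succ) (f k.succ)) * f 0 x := by
      intro x
      rw [expect_map, ← ih, mul_comm, ← expect_const_mul]
      refine congrArg _ (funext fun y => ?_)
      rw [Fin.prod_univ_succ]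
      simp
    simp_rw [this]
    rw [expect_const_mul, mul_comm]

theorem expect_indepPMF_apply {E : Type} (K : ℕ) (μ : Fin K → PMF E) (k : Fin K)
    (f : E → ℝ≥0∞) : expect (indepPMF K μ) (fun y => f (y k)) = expect (μ k) f := by
  have h := expect_indepPMF_prod K μ (fun l x => if l = k then f x else 1)
  have e1 : ∀ y : Fin K → E, ∏ l, (if l = k then f (y l) else 1) = f (y k) := by simp
  have e2 : ∀ l, expect (μ l) (fun x => if l = k then f x else 1) =
      if l = k then expect (μ l) f else 1 := by
    intro l
    by_cases h : l = k
    · simp [h]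
    · simp [h, expect_const]
  simp_rw [e1, e2] at h
  rw [h]
  simp

theorem le_argmaxIdx {K : ℕ} [NeZero K] (y : Fin K → ℝ) (l : Fin K) : y l ≤ y (argmaxIdx y) := by
  have h := Finset.min'_mem (Finset.univ.filter fun k => ∀ l, y l ≤ y k) (by
    obtain ⟨k, -, hk⟩ := Finset.exists_max_image Finset.univ y ⟨0, Finset.mem_univ 0⟩
    exact ⟨k, by simpa using hk⟩)
  exact (Finset.mem_filter.mp h).2 l

/-- For `δ ≥ 2/3` one run suffices. For `δ < 2/3` one has `log(1/δ) ≥ 1/3`, so that `1000 log(1/δ)`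
exceeds `log(1/δ) + log 2`, while `log 3 ≥ 1`. -/
theorem pow_third_le {δ : ℝ} (hδ : δ ∈ Set.Ioo (0 : ℝ) 1) {K : ℕ} (hK0 : 0 < K)
    (hK : 1000 * Real.log (1 / δ) ≤ K) : (1 / 3 : ℝ) ^ K ≤ δ / 2 := by
  rcases le_or_gt (2 / 3) δ with h | h
  · calc (1 / 3 : ℝ) ^ K ≤ (1 / 3) ^ 1 :=
        pow_le_pow_of_le_one (by norm_num) (by norm_num) hK0
      _ ≤ δ / 2 := by linarith
  · have hd : Real.log (1 / δ) = -Real.log δ := by rw [one_div, Real.log_inv]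
    have h1 : Real.log (δ / 2) = Real.log δ - Real.log 2 :=
      Real.log_div hδ.1.ne' two_ne_zero
    have h2 : Real.log δ ≤ Real.log (2 / 3) := Real.log_le_log hδ.1 h.le
    have h3 : Real.log (2 / 3 : ℝ) ≤ 2 / 3 - 1 := Real.log_le_sub_one_of_pos (by norm_num)
    have h4 : Real.log 2 < 0.6931471808 := Real.log_two_lt_d9
    have h5 : (1 : ℝ) ≤ Real.log 3 := by
      rw [Real.le_log_iff_exp_le (by norm_num)]
      linarith [Real.exp_one_lt_d9]
    rw [← Real.log_le_log_iff (by positivity) (by linarith [hδ.1]), Real.log_pow, h1, one_div,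
      Real.log_inv]
    rw [hd] at hK
    have hK' : (0 : ℝ) ≤ K := Nat.cast_nonneg K
    nlinarith

namespace DMDP

variable {n m : ℕ} (M : DMDP n m) [NeZero n] [NeZero m]

/-- Quality of the output of the meta algorithm. -/
theorem metaAlg_near_optimal {ε δ : ℝ} (hε : ε ∈ Set.Ioo (0 : ℝ) 1) (hδ : δ ∈ Set.Ioo (0 : ℝ) 1)
    (T K : ℕ) [NeZero T] [NeZero K] (ev : Policy n m → PMF ℝ)
    (hT : 1000 * ((n : ℝ) ^ 3 * m * Real.log ((n : ℝ) * m) /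
      ((1 - M.γ) ^ 6 * (ε / 2) ^ 2)) ≤ T)
    (hK : 1000 * Real.log (1 / δ) ≤ K) (hev : M.IsEvaluator ev (ε / 2) (δ / (2 * K))) :
    ENNReal.ofReal (1 - δ) ≤
      (M.metaAlg T K ev).toOuterMeasure
        {π | M.weightedValue π ≥ M.weightedOptValue - ε} := by
  classical
  have hK0 := Nat.pos_of_ne_zero (NeZero.ne K)
  have hK1 : (0 : ℝ) < K := Nat.cast_pos.mpr hK0
  have hn : (1 : ℝ) ≤ n := Nat.one_le_cast.mpr (Nat.pos_of_ne_zero (NeZero.ne n))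
  have hm : (1 : ℝ) ≤ m := Nat.one_le_cast.mpr (Nat.pos_of_ne_zero (NeZero.ne m))
  have hg := M.one_sub_γ_pos
  have hε2 : 0 < ε / 2 := half_pos hε.1
  refine le_toOuterMeasure_of_compl_le _ hδ.1.le ?_
  set good : Set (Policy n m) := {π | ∀ i, M.value π i ≥ M.optValue i - ε / 2} with hgood
  have hrun : (M.primalDual T).toOuterMeasure goodᶜ ≤ ENNReal.ofReal (1 / 3) := by
    refine compl_le_of_le_toOuterMeasure _ ?_
    rw [show (1 : ℝ) - 1 / 3 = 2 / 3 by norm_num]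
    refine M.primalDual_near_optimal hε2 T (le_trans ?_ hT)
    have : 0 ≤ (n : ℝ) ^ 3 * m * Real.log ((n : ℝ) * m) / ((1 - M.γ) ^ 6 * (ε / 2) ^ 2) := by
      have := Real.log_nonneg (show (1 : ℝ) ≤ n * m by nlinarith)
      positivity
    linarith
  set I : Policy n m → Set ℝ :=
    fun π => Set.Icc (M.weightedValue π - ε / 2) (M.weightedValue π) with hI
  have hevc : ∀ π, (ev π).toOuterMeasure (I π)ᶜ ≤ ENNReal.ofReal (δ / (2 * K)) := fun π =>
    compl_le_of_le_toOuterMeasure _ (hev π)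
  rw [toOuterMeasure_eq_expect, metaAlg, expect_bind]
  simp_rw [expect_map]
  -- If all estimates are valid and some run `k` is good, the value of the selected policy is at
  -- least its estimate, hence at least the estimate of `π k`, which is within `ε/2` of a value
  -- within `ε/2` of the optimum. So failure forces all runs to be bad or some estimate to be
  -- invalid.
  have hpt : ∀ (π : Fin K → Policy n m) (y : Fin K → ℝ),
      ({π | M.weightedValue π ≥ M.weightedOptValue - ε}ᶜ : Set (Policy n m)).indicator
        (1 : Policy n m → ℝ≥0∞) (π (argmaxIdx y)) ≤
      ∏ k, goodᶜ.indicator 1 (π k) + ∑ k, (I (π k))ᶜ.indicator 1 (y k) := by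
    intro π y
    by_cases h1 : ∃ k, y k ∉ I (π k)
    · obtain ⟨k, hk⟩ := h1
      refine (Set.indicator_le_self' (fun _ _ => zero_le) _).trans (le_trans ?_ le_add_self)
      refine le_trans ?_ (Finset.single_le_sum (f := fun k =>
        ((I (π k))ᶜ.indicator 1 (y k) : ℝ≥0∞)) (fun _ _ => zero_le) (Finset.mem_univ k))
      simp [hk]
    · push Not at h1
      by_cases h2 : ∃ k, π k ∈ good
      · obtain ⟨k, hk⟩ := h2
        rw [Set.indicator_of_notMem]
        · exact zero_le
        · simp only [Set.mem_compl_iff, Set.mem_ofPred_eq, not_not, ge_iff_le]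
          have a1 := (h1 (argmaxIdx y)).2
          have a2 := le_argmaxIdx y k
          have a3 := (h1 k).1
          have a4 : M.weightedOptValue - ε / 2 ≤ M.weightedValue (π k) := by
            have : M.weightedOptValue - ε / 2 = ∑ i, M.q i * (M.optValue i - ε / 2) := by
              simp_rw [mul_sub, Finset.sum_sub_distrib, ← Finset.sum_mul, simplex_sum, one_mul]
              rfl
            rw [this]
            exact Finset.sum_le_sum fun i _ =>
              mul_le_mul_of_nonneg_left (hk i) (simplex_nonneg _ i)
          linarith
      · push Not at h2
        refine (Set.indicator_le_self' (fun _ _ => zero_le) _).trans (le_trans ?_ le_self_add)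
        rw [Finset.prod_eq_one fun k _ => ?_]
        · exact le_rfl
        · simp [h2 k]
  have h1 : ∀ π : Fin K → Policy n m, expect (indepPMF K fun k => ev (π k)) (fun y =>
      ({π | M.weightedValue π ≥ M.weightedOptValue - ε}ᶜ : Set (Policy n m)).indicator
        (1 : Policy n m → ℝ≥0∞) (π (argmaxIdx y))) ≤
      ∏ k, goodᶜ.indicator 1 (π k) + ENNReal.ofReal (δ / 2) := by
    intro π
    refine (expect_mono _ (hpt π)).trans ?_
    rw [expect_add, expect_const]
    refine add_le_add_right ?_ _
    have e : expect (indepPMF K fun k => ev (π k)) (fun y =>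
        ∑ k, ((I (π k))ᶜ.indicator 1 (y k) : ℝ≥0∞)) =
        ∑ k, (ev (π k)).toOuterMeasure (I (π k))ᶜ := by
      have : ∀ s : Finset (Fin K), expect (indepPMF K fun k => ev (π k)) (fun y =>
          ∑ k ∈ s, ((I (π k))ᶜ.indicator 1 (y k) : ℝ≥0∞)) =
          ∑ k ∈ s, (ev (π k)).toOuterMeasure (I (π k))ᶜ := by
        intro s
        induction s using Finset.induction_on with
        | empty => simp [expect]
        | insert k s hk ih =>
          simp_rw [Finset.sum_insert hk]
          rw [expect_add, ih, toOuterMeasure_eq_expect,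
            expect_indepPMF_apply K (fun k => ev (π k)) k ((I (π k))ᶜ.indicator 1)]
      exact this Finset.univ
    rw [e]
    refine (Finset.sum_le_sum fun k _ => hevc (π k)).trans_eq ?_
    rw [Finset.sum_const, Finset.card_univ, Fintype.card_fin, nsmul_eq_mul,
      ← ENNReal.ofReal_natCast, ← ENNReal.ofReal_mul hK1.le]
    congr 1
    field_simp
  refine (expect_mono _ h1).trans ?_
  rw [expect_add, expect_const, expect_indepPMF_prod, Finset.prod_const, Finset.card_univ,
    Fintype.card_fin, ← toOuterMeasure_eq_expect]
  calc (M.primalDual T).toOuterMeasure goodᶜ ^ K + ENNReal.ofReal (δ / 2)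
      ≤ ENNReal.ofReal (1 / 3) ^ K + ENNReal.ofReal (δ / 2) :=
        add_le_add_left (pow_le_pow_left' hrun K) _
    _ = ENNReal.ofReal ((1 / 3) ^ K) + ENNReal.ofReal (δ / 2) := by
        rw [ENNReal.ofReal_pow (by norm_num)]
    _ ≤ ENNReal.ofReal (δ / 2) + ENNReal.ofReal (δ / 2) :=
        add_le_add_left (ENNReal.ofReal_le_ofReal (pow_third_le hδ hK0 hK)) _
    _ = ENNReal.ofReal δ := by
        rw [← ENNReal.ofReal_add (by linarith [hδ.1]) (by linarith [hδ.1]), add_halves]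

end DMDP

/-! ## Finitely branching coin tosses -/

/-- The restriction of a real number to `[0, 1]`. -/
def clampUnit (p : ℝ) : ℝ := max 0 (min p 1)

theorem clampUnit_mem (p : ℝ) : clampUnit p ∈ Set.Icc (0 : ℝ) 1 :=
  ⟨le_max_left _ _, max_le zero_le_one (min_le_right _ _)⟩

theorem clampUnit_of_mem {p : ℝ} (h : p ∈ Set.Icc (0 : ℝ) 1) : clampUnit p = p := by
  rw [clampUnit, min_eq_left h.2, max_eq_right h.1]

/-- A coin with bias `p`. -/
def coinPMF (p : ℝ) : PMF Bool :=
  PMF.ofFintype (fun b => ENNReal.ofReal (if b then clampUnit p else 1 - clampUnit p)) (by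
    have h := clampUnit_mem p
    rw [Fintype.sum_bool]
    simp only [if_true, Bool.false_eq_true, if_false]
    rw [← ENNReal.ofReal_add h.1 (sub_nonneg.mpr h.2)]
    simp)

theorem expect_coinPMF (p : ℝ) (f : Bool → ℝ≥0∞) :
    expect (coinPMF p) f =
      ENNReal.ofReal (clampUnit p) * f true + ENNReal.ofReal (1 - clampUnit p) * f false := by
  rw [expect, tsum_fintype, Fintype.sum_bool]
  simp [coinPMF]

/-- Decision trees whose nodes are coin tosses. -/
inductive CoinTree (E : Type) where
  | leaf (x : E)
  | node (p : ℝ) (l r : CoinTree E)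

namespace CoinTree

variable {E F : Type}

/-- The outcome and the rest of the tape, if coins are tossed with the numbers on the tape. -/
def run : CoinTree E → (ℕ → unitInterval) → E × (ℕ → unitInterval)
  | leaf x, ω => (x, ω)
  | node p l r, ω =>
    open Classical in
    if (ω 0 : ℝ) < p then l.run (fun k => ω (k + 1)) else r.run (fun k => ω (k + 1))

/-- The law of the outcome. -/
def law : CoinTree E → PMF E
  | leaf x => PMF.pure x
  | node p l r => (coinPMF p).bind fun b => if b then l.law else r.law

/-- All leaves satisfy `P`. -/
def All (P : E → Prop) : CoinTree E → Prop
  | leaf x => P x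
  | node _ l r => l.All P ∧ r.All P

theorem All.mono {P Q : E → Prop} (h : ∀ x, P x → Q x) : ∀ {t : CoinTree E}, t.All P → t.All Q
  | leaf _, ht => h _ ht
  | node _ _ _, ht => ⟨ht.1.mono h, ht.2.mono h⟩

/-- Sequential composition. -/
def bind : CoinTree E → (E → CoinTree F) → CoinTree F
  | leaf x, k => k x
  | node p l r, k => node p (l.bind k) (r.bind k)

theorem run_bind (t : CoinTree E) (k : E → CoinTree F) (ω : ℕ → unitInterval) :
    (t.bind k).run ω = (k (t.run ω).1).run (t.run ω).2 := by
  induction t generalizing ω with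
  | leaf x => rfl
  | node p l r hl hr =>
    simp only [bind, run]
    split_ifs
    exacts [hl _, hr _]

theorem law_bind (t : CoinTree E) (k : E → CoinTree F) :
    (t.bind k).law = t.law.bind fun x => (k x).law := by
  induction t with
  | leaf x =>
    change (k x).law = (PMF.pure x).bind _
    rw [PMF.pure_bind]
  | node p l r hl hr =>
    simp only [bind, law]
    rw [PMF.bind_bind]
    refine congrArg _ (funext fun b => ?_)
    cases b
    exacts [hr, hl]

theorem All.bind {P : E → Prop} {Q : F → Prop} {t : CoinTree E} {k : E → CoinTree F}
    (ht : t.All P) (hk : ∀ x, P x → (k x).All Q) : (t.bind k).All Q := by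
  induction t with
  | leaf x => exact hk x ht
  | node p l r hl hr => exact ⟨hl ht.1, hr ht.2⟩

theorem bind_law_congr {G : Type} {t : CoinTree E} {P : E → Prop} (ht : t.All P)
    {f g : E → PMF G} (h : ∀ x, P x → f x = g x) : t.law.bind f = t.law.bind g := by
  induction t with
  | leaf x =>
    change (PMF.pure x).bind f = (PMF.pure x).bind g
    rw [PMF.pure_bind, PMF.pure_bind]
    exact h x ht
  | node p l r hl hr =>
    simp only [law, PMF.bind_bind]
    refine congrArg _ (funext fun b => ?_)
    cases b
    exacts [hr ht.2, hl ht.1]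

theorem run_all {P : E → Prop} {t : CoinTree E} (ht : t.All P) (ω : ℕ → unitInterval) :
    P (t.run ω).1 := by
  induction t generalizing ω with
  | leaf x => exact ht
  | node p l r hl hr =>
    simp only [run]
    split_ifs
    exacts [hl ht.1 _, hr ht.2 _]

end CoinTree

/-! ### Coin trees driven by the random tape. -/

instance : IsProbabilityMeasure tapeMeasure := by
  unfold tapeMeasure
  infer_instance

/-- The first number on the tape is uniform and independent of the rest, which is again a tape. -/
theorem tapeMeasure_head_tail {U : Set unitInterval} {V : Set (ℕ → unitInterval)}
    (hU : MeasurableSet U) (hV : MeasurableSet V) :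
    tapeMeasure {ω | ω 0 ∈ U ∧ (fun k => ω (k + 1)) ∈ V} = volume U * tapeMeasure V := by
  let g : unitInterval × (ℕ → unitInterval) → ℕ → unitInterval :=
    fun z k => Nat.casesOn k z.1 z.2
  have hg : Measurable g := by
    refine measurable_pi_lambda _ fun k => ?_
    cases k with
    | zero => exact measurable_fst
    | succ k => exact (measurable_pi_apply k).comp measurable_snd
  -- An infinite product measure is determined by its values on boxes. A box constraining coordinate
  -- `0` factors into its head and a shifted box; any other box is given the trivial constraint
  -- `Set.univ` at `0`.
  have key : ((volume : Measure unitInterval).prod tapeMeasure).map g = tapeMeasure := by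
    refine Measure.eq_infinitePi _ fun s t ht => ?_
    have hpre : ∀ (s : Finset ℕ) (t : ℕ → Set unitInterval), (∀ i, MeasurableSet (t i)) →
        0 ∈ s → (((volume : Measure unitInterval).prod tapeMeasure).map g)
        (Set.pi s t) = ∏ i ∈ s, (volume : Measure unitInterval) (t i) := by
      intro s t ht hs
      rw [Measure.map_apply hg (MeasurableSet.pi s.countable_toSet fun i _ => ht i)]
      let s' : Finset ℕ := (s.erase 0).image Nat.pred
      have hs' : ∀ k, k ∈ s' ↔ k + 1 ∈ s := by
        intro k
        simp only [s', Finset.mem_image, Finset.mem_erase]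
        constructor
        · rintro ⟨j, ⟨hj0, hj⟩, rfl⟩
          rwa [← Nat.succ_eq_add_one, Nat.succ_pred_eq_of_pos (Nat.pos_of_ne_zero hj0)]
        · intro h
          exact ⟨k + 1, ⟨Nat.succ_ne_zero k, h⟩, rfl⟩
      have e : g ⁻¹' (Set.pi s t) = (t 0) ×ˢ (Set.pi s' fun k => t (k + 1)) := by
        ext z
        simp only [Set.mem_preimage, Set.mem_pi, Set.mem_prod, Finset.mem_coe]
        constructor
        · intro h
          exact ⟨h 0 hs, fun k hk => h (k + 1) ((hs' k).mp hk)⟩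
        · rintro ⟨h0, h1⟩ k hk
          cases k with
          | zero => exact h0
          | succ k => exact h1 k ((hs' k).mpr hk)
      rw [e, Measure.prod_prod, tapeMeasure, Measure.infinitePi_pi _ fun i _ => ht (i + 1),
        ← Finset.mul_prod_erase s _ hs]
      congr 1
      refine Finset.prod_bij (fun k _ => k + 1) ?_ ?_ ?_ ?_
      · intro k hk
        exact Finset.mem_erase.mpr ⟨Nat.succ_ne_zero k, (hs' k).mp hk⟩
      · intro a _ b _ h
        exact Nat.succ_injective h
      · intro b hb
        obtain ⟨hb0, hb⟩ := Finset.mem_erase.mp hb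
        obtain ⟨k, rfl⟩ := Nat.exists_eq_succ_of_ne_zero hb0
        exact ⟨k, (hs' k).mpr hb, rfl⟩
      · intro k _
        rfl
    by_cases h0 : 0 ∈ s
    · exact hpre s t ht h0
    · let t' : ℕ → Set unitInterval := fun k => if k = 0 then Set.univ else t k
      have e1 : Set.pi (s : Set ℕ) t = Set.pi ((insert 0 s : Finset ℕ) : Set ℕ) t' := by
        ext z
        simp only [Set.mem_pi, Finset.mem_coe, Finset.mem_insert, t']
        constructor
        · rintro h k (rfl | hk)
          · simp
          · split_ifs
            exacts [trivial, h k hk]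
        · intro h k hk
          have hk0 : k ≠ 0 := fun h => h0 (h ▸ hk)
          have := h k (Or.inr hk)
          rwa [if_neg hk0] at this
      have ht' : ∀ i, MeasurableSet (t' i) := by
        intro i
        simp only [t']
        split_ifs
        exacts [MeasurableSet.univ, ht i]
      rw [e1, hpre _ t' ht' (Finset.mem_insert_self 0 s), Finset.prod_insert h0]
      have e2 : t' 0 = Set.univ := if_pos rfl
      rw [e2, measure_univ, one_mul]
      refine Finset.prod_congr rfl fun k hk => ?_
      have hk0 : k ≠ 0 := fun h => h0 (h ▸ hk)
      simp only [t', if_neg hk0]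
  have hset : MeasurableSet {ω : ℕ → unitInterval | ω 0 ∈ U ∧ (fun k => ω (k + 1)) ∈ V} := by
    have h1 : Measurable fun ω : ℕ → unitInterval => fun k => ω (k + 1) :=
      measurable_pi_lambda _ fun k => measurable_pi_apply (k + 1)
    exact ((measurable_pi_apply 0) hU).inter (h1 hV)
  rw [← key, Measure.map_apply hg hset, key]
  exact Measure.prod_prod U V

theorem volume_unitInterval_lt (p : ℝ) :
    (volume : Measure unitInterval) {u | (u : ℝ) < p} = ENNReal.ofReal (clampUnit p) := by
  rcases lt_or_ge p 0 with h0 | h0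
  · have e : {u : unitInterval | (u : ℝ) < p} = ∅ :=
      Set.eq_empty_of_forall_notMem fun u hu => absurd (u.2.1.trans_lt hu) h0.not_gt
    rw [e, clampUnit, min_eq_left (h0.le.trans zero_le_one), max_eq_left h0.le]
    simp
  · rcases lt_or_ge 1 p with h1 | h1
    · have e : {u : unitInterval | (u : ℝ) < p} = Set.univ :=
        Set.eq_univ_of_forall fun u => u.2.2.trans_lt h1
      rw [e, measure_univ, clampUnit, min_eq_right h1.le, max_eq_right zero_le_one]
      simp
    · rw [clampUnit_of_mem ⟨h0, h1⟩]
      exact unitInterval.volume_Iio (x := ⟨p, h0, h1⟩)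

namespace CoinTree

/-- By induction on the tree: the number at the root is independent of the rest of the tape, which
is again a tape. Every event is measurable since only finitely many comparisons are made. -/
theorem measure_run {E : Type} (t : CoinTree E) (A : Set E) :
    MeasurableSet {ω | (t.run ω).1 ∈ A} ∧
      tapeMeasure {ω | (t.run ω).1 ∈ A} = t.law.toOuterMeasure A := by
  induction t with
  | leaf x =>
    simp only [run, law]
    by_cases h : x ∈ A
    · simp [h]
    · simp [h]
  | node p l r hl hr =>
    have hU : MeasurableSet {u : unitInterval | (u : ℝ) < p} :=
      measurableSet_lt measurable_subtype_coe measurable_const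
    have h1 : Measurable fun ω : ℕ → unitInterval => fun k => ω (k + 1) :=
      measurable_pi_lambda _ fun k => measurable_pi_apply (k + 1)
    have e : {ω | ((node p l r).run ω).1 ∈ A} =
        {ω | ω 0 ∈ {u : unitInterval | (u : ℝ) < p} ∧
          (fun k => ω (k + 1)) ∈ {ω | (l.run ω).1 ∈ A}} ∪
        {ω | ω 0 ∈ {u : unitInterval | (u : ℝ) < p}ᶜ ∧
          (fun k => ω (k + 1)) ∈ {ω | (r.run ω).1 ∈ A}} := by
      ext ω
      by_cases h : (ω 0 : ℝ) < p
      · simp [run, h]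
      · simp [run, h, not_lt.mp h]
    have m1 : ∀ {U : Set unitInterval} {V : Set (ℕ → unitInterval)}, MeasurableSet U →
        MeasurableSet V →
        MeasurableSet {ω : ℕ → unitInterval | ω 0 ∈ U ∧ (fun k => ω (k + 1)) ∈ V} :=
      fun hU hV => ((measurable_pi_apply 0) hU).inter (h1 hV)
    rw [e]
    refine ⟨(m1 hU hl.1).union (m1 hU.compl hr.1), ?_⟩
    rw [measure_union _ (m1 hU.compl hr.1), tapeMeasure_head_tail hU hl.1,
      tapeMeasure_head_tail hU.compl hr.1, hl.2, hr.2, prob_compl_eq_one_sub hU,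
      volume_unitInterval_lt, law, toOuterMeasure_eq_expect, toOuterMeasure_eq_expect,
      toOuterMeasure_eq_expect, expect_bind, expect_coinPMF,
      ENNReal.ofReal_sub _ (clampUnit_mem p).1, ENNReal.ofReal_one]
    · rfl
    · refine Set.disjoint_left.mpr ?_
      rintro ω ⟨h, -⟩ ⟨h', -⟩
      exact h' h

end CoinTree

/-! ## Programs with a prescribed law -/

/-- Replacement of the unused random numbers. -/
def MState.withTape (s : MState) (ω : ℕ → unitInterval) : MState := { s with tape := ω }

/-- The state transformer `F` uses the tape to toss coins; from the state `s`, a value with law `μ`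
is generated, and the final state is related to it by `Q`. -/
def Generates {E : Type} (F : MState → MState) (s : MState) (μ : PMF E)
    (Q : E → MState → Prop) : Prop :=
  ∃ t : CoinTree (E × MState), t.law.map Prod.fst = μ ∧ t.All (fun z => Q z.1 z.2) ∧
    ∀ ω, F (s.withTape ω) = (t.run ω).1.2.withTape (t.run ω).2

namespace Generates

variable {E F : Type} {f g : MState → MState} {s : MState}

theorem pure (a : E) {Q : E → MState → Prop}
    (hf : ∀ ω, f (s.withTape ω) = (f s).withTape ω) (h : Q a (f s)) :
    Generates f s (PMF.pure a) Q :=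
  ⟨.leaf (a, f s), PMF.pure_map _ _, h, hf⟩

theorem bind {μ : PMF E} {Q : E → MState → Prop} {κ : E → PMF F} {R : F → MState → Prop}
    (hf : Generates f s μ Q) (hg : ∀ a s', Q a s' → Generates g s' (κ a) R) :
    Generates (fun s => g (f s)) s (μ.bind κ) R := by
  obtain ⟨t, ht1, ht2, ht3⟩ := hf
  -- Grafting needs a continuation at every `z`, while `hg` supplies one only under `Q`. Elsewhere a
  -- dummy leaf serves; its value exists because a probability mass function has nonempty support.
  have h : ∀ z : E × MState, ∃ u : CoinTree (F × MState), Q z.1 z.2 →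
      u.law.map Prod.fst = κ z.1 ∧ u.All (fun z => R z.1 z.2) ∧
      ∀ ω, g (z.2.withTape ω) = (u.run ω).1.2.withTape (u.run ω).2 := by
    intro z
    by_cases hz : Q z.1 z.2
    · obtain ⟨u, hu⟩ := hg z.1 z.2 hz
      exact ⟨u, fun _ => hu⟩
    · obtain ⟨b, -⟩ := (κ z.1).support_nonempty
      exact ⟨.leaf (b, z.2), fun h => absurd h hz⟩
  choose u hu using h
  refine ⟨t.bind u, ?_, ht2.bind fun z hz => (hu z hz).2.1, fun ω => ?_⟩
  · rw [CoinTree.law_bind, PMF.map_bind, ← ht1, PMF.bind_map]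
    exact CoinTree.bind_law_congr ht2 fun z hz => (hu z hz).1
  · change g (f _) = _
    rw [ht3, (hu _ (CoinTree.run_all ht2 ω)).2.2, CoinTree.run_bind]

theorem map {μ : PMF E} {Q : E → MState → Prop} {R : F → MState → Prop} (k : E → F)
    (hf : Generates f s μ Q) (h : ∀ a s', Q a s' → R (k a) s') :
    Generates f s (μ.map k) R := by
  obtain ⟨t, ht1, ht2, ht3⟩ := hf
  refine ⟨t.bind fun z : E × MState => .leaf (k z.1, z.2), ?_, ht2.bind fun z hz => h _ _ hz, fun ω => ?_⟩
  · rw [CoinTree.law_bind, PMF.map_bind, ← ht1, PMF.map_comp, PMF.map]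
    refine congrArg _ (funext fun z => ?_)
    simp only [CoinTree.law, PMF.pure_map]
    rfl
  · rw [ht3, CoinTree.run_bind]
    rfl

theorem mono {μ : PMF E} {Q R : E → MState → Prop} (hf : Generates f s μ Q)
    (h : ∀ a s', Q a s' → R a s') : Generates f s μ R := by
  obtain ⟨t, ht1, ht2, ht3⟩ := hf
  exact ⟨t, ht1, ht2.mono fun z : E × MState => h z.1 z.2, ht3⟩

/-- This is the passage from a generated law to a law on tapes. As `out` ignores the tape, it is a
function of the leaf reached. -/
theorem measure {μ : PMF E} {Q : E → MState → Prop} (hf : Generates f s μ Q) {G : Type}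
    (out : MState → G) (hout : ∀ s ω, out (s.withTape ω) = out s) (val : E → G)
    (h : ∀ a s', Q a s' → out s' = val a) (A : Set G) :
    MeasurableSet {ω | out (f (s.withTape ω)) ∈ A} ∧
      tapeMeasure {ω | out (f (s.withTape ω)) ∈ A} = (μ.map val).toOuterMeasure A := by
  obtain ⟨t, ht1, ht2, ht3⟩ := hf
  have e : {ω | out (f (s.withTape ω)) ∈ A} =
      {ω | (t.run ω).1 ∈ {z : E × MState | val z.1 ∈ A}} := by
    ext ω
    simp only [Set.mem_ofPred_eq]
    rw [ht3, hout, h _ _ (CoinTree.run_all ht2 ω)]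
  rw [e]
  refine ⟨(t.measure_run _).1, (t.measure_run _).2.trans ?_⟩
  rw [← ht1, PMF.map_comp, PMF.toOuterMeasure_map_apply]
  rfl

/-- The type `E t` depends on the step because the recorded histories of policies grow by one entry
per iteration. -/
theorem iterate {E : ℕ → Type} {ρ : (t : ℕ) → PMF (E t)} {κ : (t : ℕ) → E t → PMF (E (t + 1))}
    {I : (t : ℕ) → E t → MState → Prop} {a₀ : E 0} (h0 : ρ 0 = PMF.pure a₀) (hI : I 0 a₀ s)
    (hρ : ∀ t, ρ (t + 1) = (ρ t).bind (κ t)) (N : ℕ)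
    (hf : ∀ t < N, ∀ a s', I t a s' → Generates f s' (κ t a) (I (t + 1))) :
    Generates (f^[N]) s (ρ N) (I N) := by
  induction N with
  | zero =>
    rw [h0]
    exact pure a₀ (fun ω => rfl) hI
  | succ N ih =>
    rw [hρ]
    have h1 : f^[N + 1] = fun s => f (f^[N] s) := funext fun s => Function.iterate_succ_apply' f N s
    rw [h1]
    exact bind (ih fun t ht => hf t (ht.trans (Nat.lt_succ_self N))) (hf N (Nat.lt_succ_self N))

end Generates

/-! ## Registers and arrays that a program uses -/

/-- The registers in an expression. -/
def NExpr.regs : NExpr → List ℕ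
  | lit _ => []
  | reg x => [x]
  | add e f => e.regs ++ f.regs
  | sub e f => e.regs ++ f.regs
  | mul e f => e.regs ++ f.regs
  | div e f => e.regs ++ f.regs

theorem NExpr.eval_congr {s s' : MState} (e : NExpr) (h : ∀ x ∈ e.regs, s.nreg x = s'.nreg x) :
    e.eval s = e.eval s' := by
  induction e with
  | lit k => rfl
  | reg x => exact h x (List.mem_singleton_self x)
  | add e f he hf | sub e f he hf | mul e f he hf | div e f he hf =>
    simp only [regs, List.mem_append] at h
    simp only [eval, he fun x hx => h x (Or.inl hx), hf fun x hx => h x (Or.inr hx)]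

theorem NExpr.eval_of_nreg_eq {s s' : MState} (e : NExpr) (h : s.nreg = s'.nreg) :
    e.eval s = e.eval s' :=
  e.eval_congr fun x _ => congrFun h x

theorem RExpr.eval_of_eq {s s' : MState} (e : RExpr) (h : s.nreg = s'.nreg)
    (h' : s.arr = s'.arr) : e.eval s = e.eval s' := by
  induction e with
  | cast e => simp only [eval, e.eval_of_nreg_eq h]
  | get b e => simp only [eval, e.eval_of_nreg_eq h, h']
  | add e f he hf | sub e f he hf | mul e f he hf | div e f he hf => simp only [eval, he, hf]
  | exp e he | log e he | sqrt e he => simp only [eval, he]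

namespace Prog

/-- The registers that a program may write. -/
def wregs : Prog → List ℕ
  | skip => []
  | setN x _ => [x]
  | setR _ _ _ => []
  | draw _ _ => []
  | seq c d => c.wregs ++ d.wregs
  | ifN _ _ c d => c.wregs ++ d.wregs
  | ifR _ _ c d => c.wregs ++ d.wregs
  | loop _ c => c.wregs

/-- The arrays that a program may write. -/
def warrs : Prog → List ℕ
  | skip => []
  | setN _ _ => []
  | setR b _ _ => [b]
  | draw b _ => [b]
  | seq c d => c.warrs ++ d.warrs
  | ifN _ _ c d => c.warrs ++ d.warrs
  | ifR _ _ c d => c.warrs ++ d.warrs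
  | loop _ c => c.warrs

/-- The registers in the loop bounds of a program. -/
def lregs : Prog → List ℕ
  | skip => []
  | setN _ _ => []
  | setR _ _ _ => []
  | draw _ _ => []
  | seq c d => c.lregs ++ d.lregs
  | ifN _ _ c d => c.lregs ++ d.lregs
  | ifR _ _ c d => c.lregs ++ d.lregs
  | loop e c => e.regs ++ c.lregs

/-- The program draws no random numbers. -/
def NoDraw : Prog → Prop
  | skip => True
  | setN _ _ => True
  | setR _ _ _ => True
  | draw _ _ => False
  | seq c d => c.NoDraw ∧ d.NoDraw
  | ifN _ _ c d => c.NoDraw ∧ d.NoDraw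
  | ifR _ _ c d => c.NoDraw ∧ d.NoDraw
  | loop _ c => c.NoDraw

theorem iterate_induction {E : Type*} {f : E → E} {P : E → Prop} (hf : ∀ x, P x → P (f x)) {x : E}
    (hx : P x) (N : ℕ) : P (f^[N] x) := by
  induction N with
  | zero => exact hx
  | succ N ih =>
    rw [Function.iterate_succ_apply']
    exact hf _ ih

/-- A frame rule: what is not written syntactically is unchanged. Its side conditions concern
concrete lists and are decidable. -/
theorem exec_nreg {c : Prog} {x : ℕ} (h : x ∉ c.wregs) (s : MState) :
    (c.exec s).nreg x = s.nreg x := by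
  induction c generalizing s with
  | skip => rfl
  | setN y e =>
    refine Function.update_of_ne ?_ _ _
    simpa [wregs] using h
  | setR b e f => rfl
  | draw b e => rfl
  | seq c d hc hd =>
    simp only [wregs, List.mem_append, not_or] at h
    rw [exec, hd h.2, hc h.1]
  | ifN e f c d hc hd | ifR e f c d hc hd =>
    simp only [wregs, List.mem_append, not_or] at h
    simp only [exec]
    split_ifs
    exacts [hc h.1 _, hd h.2 _]
  | loop e c hc =>
    rw [exec]
    exact iterate_induction (P := fun s' : MState => s'.nreg x = s.nreg x)
      (fun (s' : MState) hs' => (hc h (s'.tick 1)).trans hs')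
      (x := s.tick (e.cost + 1)) rfl _

theorem exec_arr {c : Prog} {b : ℕ} (h : b ∉ c.warrs) (s : MState) :
    (c.exec s).arr b = s.arr b := by
  induction c generalizing s with
  | skip => rfl
  | setN y e => rfl
  | setR b' e f =>
    refine Function.update_of_ne ?_ _ _
    simpa [warrs] using h
  | draw b' e =>
    refine Function.update_of_ne ?_ _ _
    simpa [warrs] using h
  | seq c d hc hd =>
    simp only [warrs, List.mem_append, not_or] at h
    rw [exec, hd h.2, hc h.1]
  | ifN e f c d hc hd | ifR e f c d hc hd =>
    simp only [warrs, List.mem_append, not_or] at h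
    simp only [exec]
    split_ifs
    exacts [hc h.1 _, hd h.2 _]
  | loop e c hc =>
    rw [exec]
    exact iterate_induction (P := fun s' : MState => s'.arr b = s.arr b)
      (fun (s' : MState) hs' => (hc h (s'.tick 1)).trans hs')
      (x := s.tick (e.cost + 1)) rfl _

theorem _root_.NExpr.eval_withTape (e : NExpr) (s : MState) (ω : ℕ → unitInterval) :
    e.eval (s.withTape ω) = e.eval s := e.eval_of_nreg_eq rfl

theorem _root_.RExpr.eval_withTape (e : RExpr) (s : MState) (ω : ℕ → unitInterval) :
    e.eval (s.withTape ω) = e.eval s := e.eval_of_eq rfl rfl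

theorem exec_withTape {c : Prog} (h : c.NoDraw) (s : MState) (ω : ℕ → unitInterval) :
    c.exec (s.withTape ω) = (c.exec s).withTape ω := by
  induction c generalizing s with
  | skip => rfl
  | setN y e => simp only [exec, e.eval_withTape]; rfl
  | setR b' e f => simp only [exec, e.eval_withTape, f.eval_withTape]; rfl
  | draw b' e => exact h.elim
  | seq c d hc hd => rw [exec, exec, hc h.1, hd h.2]
  | ifN e f c d hc hd | ifR e f c d hc hd =>
    simp only [exec, e.eval_withTape, f.eval_withTape]
    split_ifs
    exacts [hc h.1 (s.tick _), hd h.2 (s.tick _)]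
  | loop e c hc =>
    rw [exec, exec, e.eval_withTape]
    generalize e.eval s = N
    induction N with
    | zero => rfl
    | succ N ih =>
      rw [Function.iterate_succ_apply', Function.iterate_succ_apply', ih]
      exact hc h (MState.tick _ 1)

/-! ## Run time -/

/-- An upper bound on the run time, evaluated at a state with the correct loop bounds. -/
def maxTime (s : MState) : Prog → ℕ
  | skip => 1
  | setN _ e => e.cost + 1
  | setR _ e f => e.cost + f.cost + 1
  | draw _ e => e.cost + 1
  | seq c d => c.maxTime s + d.maxTime s
  | ifN e f c d => e.cost + f.cost + 1 + c.maxTime s + d.maxTime s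
  | ifR e f c d => e.cost + f.cost + 1 + c.maxTime s + d.maxTime s
  | loop e c => e.cost + 1 + e.eval s * (c.maxTime s + 1)

/-- Registers in loop bounds lie in `X` and are never written, so every loop bound has its value at
`s₀` whenever the loop is reached. The time is thus bounded statically, however the random branches
turn out. -/
theorem exec_time_le (c : Prog) (s₀ : MState) (X : List ℕ) (hw : ∀ x ∈ X, x ∉ c.wregs)
    (hl : ∀ x ∈ c.lregs, x ∈ X) (s : MState) (hs : ∀ x ∈ X, s.nreg x = s₀.nreg x) :
    (c.exec s).time ≤ s.time + c.maxTime s₀ := by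
  induction c generalizing s with
  | skip | setN y e | setR b' e f | draw b' e => exact le_rfl
  | seq c d hc hd =>
    simp only [wregs, lregs, List.mem_append, not_or] at hw hl
    have h1 := hc (fun x hx => (hw x hx).1) (fun x hx => hl x (Or.inl hx)) s hs
    have h2 := hd (fun x hx => (hw x hx).2) (fun x hx => hl x (Or.inr hx)) (c.exec s)
      fun x hx => (exec_nreg (hw x hx).1 s).trans (hs x hx)
    rw [exec, maxTime]
    omega
  | ifN e f c d hc hd | ifR e f c d hc hd =>
    simp only [wregs, lregs, List.mem_append, not_or] at hw hl
    have h1 := hc (fun x hx => (hw x hx).1) (fun x hx => hl x (Or.inl hx))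
      (s.tick (e.cost + f.cost + 1)) hs
    have h2 := hd (fun x hx => (hw x hx).2) (fun x hx => hl x (Or.inr hx))
      (s.tick (e.cost + f.cost + 1)) hs
    simp only [exec, maxTime]
    simp only [MState.tick] at h1 h2
    split_ifs
    · exact h1.trans (by omega)
    · exact h2.trans (by omega)
  | loop e c hc =>
    simp only [wregs, lregs, List.mem_append] at hw hl
    have he : e.eval s = e.eval s₀ := e.eval_congr fun x hx => hs x (hl x (Or.inl hx))
    rw [exec, maxTime, he]
    generalize e.eval s₀ = N
    have key : ∀ N, (∀ x ∈ X, ((fun s' => c.exec (s'.tick 1))^[N] (s.tick (e.cost + 1))).nreg x =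
        s₀.nreg x) ∧ ((fun s' => c.exec (s'.tick 1))^[N] (s.tick (e.cost + 1))).time ≤
        s.time + (e.cost + 1 + N * (c.maxTime s₀ + 1)) := by
      intro N
      induction N with
      | zero => exact ⟨hs, by simp [MState.tick]⟩
      | succ N ih =>
        rw [Function.iterate_succ_apply']
        refine ⟨fun x hx => (exec_nreg (hw x hx) _).trans (ih.1 x hx), ?_⟩
        have h1 := hc hw (fun x hx => hl x (Or.inr hx)) (MState.tick
          ((fun s' => c.exec (s'.tick 1))^[N] (s.tick (e.cost + 1))) 1) ih.1
        refine h1.trans ?_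
        have h2 := ih.2
        simp only [MState.tick] at h2 ⊢
        rw [Nat.succ_mul]
        omega
    exact (key N).2

/-! ## Loops -/

theorem exec_setN_nreg (x : ℕ) (e : NExpr) (s : MState) :
    ((setN x e).exec s).nreg = Function.update s.nreg x (e.eval s) := rfl

theorem exec_setN_arr (x : ℕ) (e : NExpr) (s : MState) : ((setN x e).exec s).arr = s.arr := rfl

theorem exec_setR_nreg (b : ℕ) (e : NExpr) (f : RExpr) (s : MState) :
    ((setR b e f).exec s).nreg = s.nreg := rfl

theorem exec_setR_arr (b : ℕ) (e : NExpr) (f : RExpr) (s : MState) :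
    ((setR b e f).exec s).arr =
      Function.update s.arr b (Function.update (s.arr b) (e.eval s) (f.eval s)) := rfl

theorem exec_seq (c d : Prog) (s : MState) : (seq c d).exec s = d.exec (c.exec s) := rfl

theorem exec_loop (e : NExpr) (c : Prog) (s : MState) : (loop e c).exec s =
    (fun s' => c.exec (s'.tick 1))^[e.eval s] (s.tick (e.cost + 1)) := rfl

theorem exec_ifR_of_lt {e f : RExpr} {s : MState} (h : e.eval s < f.eval s) (c d : Prog) :
    (ifR e f c d).exec s = c.exec (s.tick (e.cost + f.cost + 1)) := if_pos h

theorem exec_ifR_of_not_lt {e f : RExpr} {s : MState} (h : ¬e.eval s < f.eval s) (c d : Prog) :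
    (ifR e f c d).exec s = d.exec (s.tick (e.cost + f.cost + 1)) := if_neg h

theorem exec_ifN_of_lt {e f : NExpr} {s : MState} (h : e.eval s < f.eval s) (c d : Prog) :
    (ifN e f c d).exec s = c.exec (s.tick (e.cost + f.cost + 1)) := if_pos h

theorem exec_ifN_of_not_lt {e f : NExpr} {s : MState} (h : ¬e.eval s < f.eval s) (c d : Prog) :
    (ifN e f c d).exec s = d.exec (s.tick (e.cost + f.cost + 1)) := if_neg h

/-- Run `c` with the values `0, 1, …, e - 1` of the register `x`. -/
def forN (x : ℕ) (e : NExpr) (c : Prog) : Prog :=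
  seq (setN x (.lit 0)) (loop e (seq c (setN x (.add (.reg x) (.lit 1)))))

/-- The invariant sees registers and arrays only, which makes it insensitive to the operation count
and to the tape. It must hold with the counter already advanced after the body. -/
theorem forN_inv {x : ℕ} {e : NExpr} {c : Prog} {s : MState} {N : ℕ}
    (I : ℕ → (ℕ → ℕ) → (ℕ → ℕ → ℝ) → Prop) (hxc : x ∉ c.wregs) (hxe : x ∉ e.regs)
    (hN : e.eval s = N) (h0 : I 0 (Function.update s.nreg x 0) s.arr)
    (hstep : ∀ t < N, ∀ s' : MState, s'.nreg x = t → I t s'.nreg s'.arr →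
      I (t + 1) (Function.update (c.exec s').nreg x (t + 1)) (c.exec s').arr) :
    I N ((forN x e c).exec s).nreg ((forN x e c).exec s).arr ∧
      ((forN x e c).exec s).nreg x = N := by
  rw [forN, exec_seq, exec_loop]
  have he : e.eval ((setN x (.lit 0)).exec s) = N := by
    rw [← hN]
    refine e.eval_congr fun y hy => Function.update_of_ne ?_ _ _
    rintro rfl
    exact hxe hy
  rw [he]
  have key : ∀ K ≤ N, ∀ s' : MState, s'.nreg x = 0 → I 0 s'.nreg s'.arr →
      (fun z : MState => I K z.nreg z.arr ∧ z.nreg x = K)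
        ((fun s' => (seq c (setN x (.add (.reg x) (.lit 1)))).exec (s'.tick 1))^[K] s') := by
    intro K
    induction K with
    | zero => exact fun _ s' h0 h1 => ⟨h1, h0⟩
    | succ K ih =>
      intro hK s' h0 h1
      rw [Function.iterate_succ_apply']
      obtain ⟨a1, a2⟩ := ih (Nat.le_of_succ_le hK) s' h0 h1
      generalize (fun s' => (seq c (setN x (.add (.reg x) (.lit 1)))).exec (s'.tick 1))^[K] s' = z
        at a1 a2
      have h2 := hstep K hK (z.tick 1) a2 a1
      have h3 : (c.exec (z.tick 1)).nreg x = K := (exec_nreg hxc _).trans a2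
      have h4 : ((seq c (setN x (.add (.reg x) (.lit 1)))).exec (z.tick 1)).nreg =
          Function.update (c.exec (z.tick 1)).nreg x (K + 1) := by
        rw [exec_seq, exec_setN_nreg]
        simp only [NExpr.eval, h3]
      rw [h4]
      exact ⟨h2, Function.update_self ..⟩
  exact key N le_rfl _ (Function.update_self ..) h0

theorem loop_inv {e : NExpr} {c : Prog} {s : MState} {N : ℕ}
    (I : ℕ → (ℕ → ℕ) → (ℕ → ℕ → ℝ) → Prop) (hN : e.eval s = N) (h0 : I 0 s.nreg s.arr)
    (hstep : ∀ t < N, ∀ s' : MState, I t s'.nreg s'.arr →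
      I (t + 1) (c.exec s').nreg (c.exec s').arr) :
    I N ((loop e c).exec s).nreg ((loop e c).exec s).arr := by
  rw [exec_loop, hN]
  have key : ∀ K ≤ N, (fun z : MState => I K z.nreg z.arr)
      ((fun s' => c.exec (s'.tick 1))^[K] (s.tick (e.cost + 1))) := by
    intro K
    induction K with
    | zero => exact fun _ => h0
    | succ K ih =>
      intro hK
      rw [Function.iterate_succ_apply']
      exact hstep K hK (MState.tick _ 1) (ih (Nat.le_of_succ_le hK))
  exact key N le_rfl

/-- Store the sum of the values of `f` for `x = 0, …, e - 1`. -/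
def sumLoop (x : ℕ) (e : NExpr) (b : ℕ) (i : NExpr) (f : RExpr) : Prog :=
  seq (setR b i (.cast (.lit 0))) (forN x e (setR b i (.add (.get b i) f)))

theorem exec_sumLoop {x : ℕ} {e : NExpr} {b : ℕ} {i : NExpr} {f : RExpr} {s : MState} {N : ℕ}
    (F : ℕ → ℝ) (hxe : x ∉ e.regs) (hxi : x ∉ i.regs) (hN : e.eval s = N)
    (hf : ∀ t < N, ∀ s' : MState, s'.nreg = Function.update s.nreg x t →
      (∀ b' ≠ b, s'.arr b' = s.arr b') → f.eval s' = F t) :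
    ((sumLoop x e b i f).exec s).nreg = Function.update s.nreg x N ∧
      ((sumLoop x e b i f).exec s).arr = Function.update s.arr b
        (Function.update (s.arr b) (i.eval s) (∑ t ∈ Finset.range N, F t)) := by
  have hi : ∀ (s' : MState) t, s'.nreg = Function.update s.nreg x t → i.eval s' = i.eval s := by
    intro s' t h
    refine i.eval_congr fun y hy => ?_
    rw [h]
    refine Function.update_of_ne ?_ _ _
    rintro rfl
    exact hxi hy
  have h := forN_inv (x := x) (e := e) (c := setR b i (.add (.get b i) f)) (N := N)
    (s := (setR b i (.cast (.lit 0))).exec s)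
    (fun t nr ar => nr = Function.update s.nreg x t ∧ ar = Function.update s.arr b
        (Function.update (s.arr b) (i.eval s) (∑ t ∈ Finset.range t, F t)))
    (by simp [wregs]) hxe (by rw [← hN]; exact e.eval_of_nreg_eq rfl) ?_ ?_
  · exact h.1
  · refine ⟨rfl, ?_⟩
    simp [exec_setR_arr, RExpr.eval, NExpr.eval]
  · rintro t ht s' - ⟨h1, h2⟩
    have hf' := hf t ht s' h1 fun b' hb' => by rw [h2]; exact Function.update_of_ne hb' _ _
    refine ⟨by rw [exec_setR_nreg, h1, Function.update_idem], ?_⟩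
    rw [exec_setR_arr]
    simp only [RExpr.eval, hf', hi s' t h1, h2, Finset.sum_range_succ, Function.update_self,
      Function.update_idem]

/-- Tabulate the values of `f` for `x = 0, …, e - 1` at the indices `i`. -/
def tabLoop (x : ℕ) (e : NExpr) (b : ℕ) (i : NExpr) (f : RExpr) : Prog :=
  forN x e (setR b i f)

theorem exec_tabLoop {x : ℕ} {e : NExpr} {b : ℕ} {i : NExpr} {f : RExpr} {s : MState} {N : ℕ}
    (o : ℕ) (F : ℕ → ℝ) (hxe : x ∉ e.regs) (hN : e.eval s = N)
    (hi : ∀ t < N, ∀ s' : MState, s'.nreg = Function.update s.nreg x t → i.eval s' = o + t)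
    (hf : ∀ t < N, ∀ s' : MState, s'.nreg = Function.update s.nreg x t →
      (∀ b' ≠ b, s'.arr b' = s.arr b') → f.eval s' = F t) :
    ((tabLoop x e b i f).exec s).nreg = Function.update s.nreg x N ∧
      ((tabLoop x e b i f).exec s).arr = Function.update s.arr b
        (fun k => if o ≤ k ∧ k < o + N then F (k - o) else s.arr b k) := by
  have h := forN_inv (x := x) (e := e) (c := setR b i f) (N := N) (s := s)
    (fun t nr ar => nr = Function.update s.nreg x t ∧ ar = Function.update s.arr b
        (fun k => if o ≤ k ∧ k < o + t then F (k - o) else s.arr b k))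
    (by simp [wregs]) hxe hN ?_ ?_
  · exact h.1
  · refine ⟨rfl, ?_⟩
    have : (fun k => if o ≤ k ∧ k < o + 0 then F (k - o) else s.arr b k) = s.arr b := by
      funext k
      rw [if_neg]
      omega
    rw [this, Function.update_eq_self]
  · rintro t ht s' - ⟨h1, h2⟩
    have hf' := hf t ht s' h1 fun b' hb' => by rw [h2]; exact Function.update_of_ne hb' _ _
    refine ⟨by rw [exec_setR_nreg, h1, Function.update_idem], ?_⟩
    rw [exec_setR_arr, hf', hi t ht s' h1, h2, Function.update_idem, Function.update_self]
    congr 1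
    funext k
    rw [Function.update_apply]
    by_cases h3 : k = o + t
    · subst h3
      simp
    · rw [if_neg h3]
      refine if_congr ?_ rfl rfl
      omega

/-- Toss a coin with bias `p`; array `4` is scratch space. -/
def coin (p : RExpr) (c d : Prog) : Prog :=
  seq (draw 4 (.lit 0)) (ifR (.get 4 (.lit 0)) p (seq (setR 4 (.lit 0) (.cast (.lit 0))) c)
    (seq (setR 4 (.lit 0) (.cast (.lit 0))) d))

end Prog

namespace Generates

variable {E : Type} {s : MState}

theorem det {c : Prog} (hc : c.NoDraw) (a : E) {Q : E → MState → Prop} (h : Q a (c.exec s)) :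
    Generates c.exec s (PMF.pure a) Q :=
  pure a (fun ω => Prog.exec_withTape hc s ω) h

theorem seq {F : Type} {c d : Prog} {μ : PMF E} {Q : E → MState → Prop} {κ : E → PMF F}
    {R : F → MState → Prop} (hc : Generates c.exec s μ Q)
    (hd : ∀ a s', Q a s' → Generates d.exec s' (κ a) R) :
    Generates (Prog.seq c d).exec s (μ.bind κ) R := hc.bind hd

theorem seq_map {F : Type} {c d : Prog} (hdd : d.NoDraw) {μ : PMF E} {Q : E → MState → Prop}
    (k : E → F) {R : F → MState → Prop} (hc : Generates c.exec s μ Q)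
    (hd : ∀ a s', Q a s' → R (k a) (d.exec s')) :
    Generates (Prog.seq c d).exec s (μ.map k) R :=
  hc.bind fun a s' h => det hdd _ (hd a s' h)

theorem det_seq {c d : Prog} (hcc : c.NoDraw) {μ : PMF E}
    {Q : E → MState → Prop} (hd : Generates d.exec (c.exec s) μ Q) :
    Generates (Prog.seq c d).exec s μ Q := by
  obtain ⟨t, h1, h2, h3⟩ := hd
  refine ⟨t, h1, h2, fun ω => ?_⟩
  rw [Prog.exec_seq, Prog.exec_withTape hcc, h3]

theorem ifN_of_lt {e f : NExpr} {c d : Prog} {μ : PMF E} {Q : E → MState → Prop}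
    (h : e.eval s < f.eval s) (hc : Generates c.exec (s.tick (e.cost + f.cost + 1)) μ Q) :
    Generates (Prog.ifN e f c d).exec s μ Q := by
  obtain ⟨t, h1, h2, h3⟩ := hc
  refine ⟨t, h1, h2, fun ω => ?_⟩
  rw [Prog.exec_ifN_of_lt (by rwa [e.eval_withTape, f.eval_withTape])]
  exact h3 ω

theorem ifN_of_not_lt {e f : NExpr} {c d : Prog} {μ : PMF E} {Q : E → MState → Prop}
    (h : ¬e.eval s < f.eval s) (hd : Generates d.exec (s.tick (e.cost + f.cost + 1)) μ Q) :
    Generates (Prog.ifN e f c d).exec s μ Q := by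
  obtain ⟨t, h1, h2, h3⟩ := hd
  refine ⟨t, h1, h2, fun ω => ?_⟩
  rw [Prog.exec_ifN_of_not_lt (by rwa [e.eval_withTape, f.eval_withTape])]
  exact h3 ω

theorem loop {E : ℕ → Type} {e : NExpr} {c : Prog} {ρ : (t : ℕ) → PMF (E t)}
    {κ : (t : ℕ) → E t → PMF (E (t + 1))} {I : (t : ℕ) → E t → MState → Prop} {a₀ : E 0}
    {N : ℕ} (hN : e.eval s = N) (h0 : ρ 0 = PMF.pure a₀) (hI : I 0 a₀ (s.tick (e.cost + 1)))
    (hρ : ∀ t, ρ (t + 1) = (ρ t).bind (κ t))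
    (hf : ∀ t < N, ∀ a s', I t a s' → Generates c.exec (s'.tick 1) (κ t a) (I (t + 1))) :
    Generates (Prog.loop e c).exec s (ρ N) (I N) := by
  have h := iterate (f := fun s' => c.exec (s'.tick 1)) h0 hI hρ N hf
  obtain ⟨t, h1, h2, h3⟩ := h
  refine ⟨t, h1, h2, fun ω => ?_⟩
  rw [Prog.exec, e.eval_withTape, hN]
  exact h3 ω

theorem coin {p : RExpr} {c d : Prog} {p₀ : ℝ} {μ ν : PMF E} {Q : E → MState → Prop}
    (h4 : s.arr 4 0 = 0) (hp : ∀ y, p.eval (s.writeR 4 0 y) = p₀)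
    (hc : ∀ s', s'.nreg = s.nreg → s'.arr = s.arr → Generates c.exec s' μ Q)
    (hd : ∀ s', s'.nreg = s.nreg → s'.arr = s.arr → Generates d.exec s' ν Q) :
    Generates (Prog.coin p c d).exec s ((coinPMF p₀).bind fun b => if b then μ else ν) Q := by
  -- The three increments are the costs of the draw, of the test and of clearing the scratch entry.
  let s' : MState := (s.tick 2).tick ((RExpr.get 4 (.lit 0)).cost + p.cost + 1) |>.tick 4
  obtain ⟨t, t1, t2, t3⟩ := hc s' rfl rfl
  obtain ⟨u, u1, u2, u3⟩ := hd s' rfl rfl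
  refine ⟨.node p₀ t u, ?_, ⟨t2, u2⟩, fun ω => ?_⟩
  · rw [CoinTree.law, PMF.map_bind]
    refine congrArg _ (funext fun b => ?_)
    cases b
    exacts [u1, t1]
  -- Clearing the scratch entry restores the arrays exactly. Otherwise the state would remember the
  -- number drawn, and finitely many leaves could not describe all outcomes.
  · have hz : ∀ y, Function.update (Function.update s.arr 4 (Function.update (s.arr 4) 0 y)) 4
        (Function.update (Function.update (s.arr 4) 0 y) 0 0) = s.arr := by
      intro y
      rw [Function.update_idem, Function.update_idem, ← h4, Function.update_eq_self,
        Function.update_eq_self]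
    have hcond : (RExpr.get 4 (.lit 0)).eval ((Prog.draw 4 (.lit 0)).exec (s.withTape ω)) =
        (ω 0 : ℝ) := by
      simp [RExpr.eval, NExpr.eval, Prog.exec, MState.tick, MState.writeR, MState.withTape]
    have hp' : p.eval ((Prog.draw 4 (.lit 0)).exec (s.withTape ω)) = p₀ := by
      rw [← hp (ω 0)]
      exact p.eval_of_eq rfl rfl
    have hst : ∀ k, (Prog.setR 4 (.lit 0) (.cast (.lit 0))).exec
        (((Prog.draw 4 (.lit 0)).exec (s.withTape ω)).tick k) =
        (((s.tick 2).tick k).tick 4).withTape fun k => ω (k + 1) := by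
      intro k
      simp only [Prog.exec, MState.tick, MState.writeR, MState.withTape, NExpr.eval, RExpr.eval,
        NExpr.cost, RExpr.cost, Function.update_self, Nat.cast_zero, hz]
    rw [Prog.coin, Prog.exec_seq]
    by_cases h : (ω 0 : ℝ) < p₀
    · rw [Prog.exec_ifR_of_lt (by rwa [hcond, hp']), Prog.exec_seq, hst, CoinTree.run, if_pos h]
      exact t3 _
    · rw [Prog.exec_ifR_of_not_lt (by rwa [hcond, hp']), Prog.exec_seq, hst, CoinTree.run,
        if_neg h]
      exact u3 _

end Generates

/-! ## Sum trees

The nodes of a sum tree with `N` leaves are `1, …, 2 * N - 1`; the children of a node `k < N` are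
`2 * k` and `2 * k + 1`, and `N, …, 2 * N - 1` are the leaves. -/

/-- The array `A` holds, at offset `o`, a sum tree with leaf weights `w 0, …, w (N - 1)`. -/
structure IsTree (A : ℕ → ℝ) (o N : ℕ) (w : ℕ → ℝ) : Prop where
  leaf : ∀ k < N, A (o + N + k) = w k
  node : ∀ k, 1 ≤ k → k < N → A (o + k) = A (o + 2 * k) + A (o + 2 * k + 1)

namespace IsTree

variable {A A' : ℕ → ℝ} {o N : ℕ} {w : ℕ → ℝ}

theorem congr (h : IsTree A o N w) (hA : ∀ k, o ≤ k → k < o + 2 * N → A' k = A k) :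
    IsTree A' o N w := by
  refine ⟨fun k hk => ?_, fun k h1 hk => ?_⟩
  · rw [hA _ (by omega) (by omega), h.leaf k hk]
  · rw [hA _ (by omega) (by omega), hA _ (by omega) (by omega), hA _ (by omega) (by omega),
      h.node k h1 hk]

/-- The nodes `j, …, 2j - 1` form a cut of the tree: replacing `j` by its children `2j` and `2j + 1`
turns it into the next cut without changing the total. The cut `j = 1` is the root and `j = N` the
leaves, for any `N`, not only powers of two. -/
theorem root_eq_sum (h : IsTree A o N w) (hN : 0 < N) :
    A (o + 1) = ∑ k ∈ Finset.range N, w k := by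
  have key : ∀ j, 1 ≤ j → j ≤ N → ∑ k ∈ Finset.Ico j (2 * j), A (o + k) = A (o + 1) := by
    intro j hj
    induction j, hj using Nat.le_induction with
    | base => intro _; simp
    | succ j hj ih =>
      intro hjN
      rw [← ih (by omega), Finset.sum_eq_sum_Ico_succ_bot (by omega : j < 2 * j),
        show 2 * (j + 1) = 2 * j + 1 + 1 by ring, Finset.sum_Ico_succ_top (by omega),
        Finset.sum_Ico_succ_top (by omega), h.node j hj (by omega), add_assoc o]
      ring
  rw [← key N hN le_rfl, Finset.sum_Ico_eq_sum_range, show 2 * N - N = N by omega]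
  exact Finset.sum_congr rfl fun k hk => by
    rw [← add_assoc, h.leaf k (Finset.mem_range.mp hk)]

theorem nonneg (h : IsTree A o N w) (hw : ∀ k < N, 0 ≤ w k) (k : ℕ) (h1 : 1 ≤ k)
    (h2 : k < 2 * N) : 0 ≤ A (o + k) := by
  by_cases hk : k < N
  · rw [h.node k h1 hk, add_assoc]
    exact add_nonneg (nonneg h hw (2 * k) (by omega) (by omega))
      (nonneg h hw (2 * k + 1) (by omega) (by omega))
  · obtain ⟨j, rfl⟩ := Nat.exists_eq_add_of_le (not_lt.mp hk)
    rw [← add_assoc, h.leaf j (by omega)]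
    exact hw j (by omega)
termination_by 2 * N - k

end IsTree

/-- Both sides have total mass one. Hence the law of a descent can be identified from lower bounds,
which need only a single path to each leaf. -/
theorem PMF.ext_of_le {E : Type*} [Fintype E] {p q : PMF E} (h : ∀ a, p a ≤ q a) : p = q := by
  ext a
  by_contra hne
  have hlt : p a < q a := lt_of_le_of_ne (h a) hne
  have h1 : ∑' a, p a < ∑' a, q a :=
    ENNReal.tsum_lt_tsum (by rw [p.tsum_coe]; exact ENNReal.one_ne_top) h hlt
  rw [p.tsum_coe, q.tsum_coe] at h1
  exact lt_irrefl _ h1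

/-- One step of a random descent in a sum tree. -/
def treeStep (A : ℕ → ℝ) (o N k : ℕ) : PMF ℕ :=
  if k < N then (coinPMF (A (o + 2 * k) / A (o + k))).bind fun b =>
    if b then PMF.pure (2 * k) else PMF.pure (2 * k + 1)
  else PMF.pure k

/-- The position of a random descent after `t` steps. -/
def treeWalk (A : ℕ → ℝ) (o N : ℕ) : ℕ → PMF ℕ
  | 0 => PMF.pure 1
  | t + 1 => (treeWalk A o N t).bind (treeStep A o N)

theorem le_bind_apply {E F : Type*} (p : PMF E) (k : E → PMF F) (a : E) (b : F) :
    p a * k a b ≤ (p.bind k) b := by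
  rw [PMF.bind_apply]
  exact ENNReal.le_tsum a

theorem ratio_le_treeStep {A : ℕ → ℝ} {o N : ℕ} {w : ℕ → ℝ} (h : IsTree A o N w)
    (hw : ∀ k < N, 0 ≤ w k) {k j : ℕ} (h1 : 1 ≤ k) (hk : k < N) (hA : 0 < A (o + k))
    (hj : j = 2 * k ∨ j = 2 * k + 1) :
    ENNReal.ofReal (A (o + j) / A (o + k)) ≤ treeStep A o N k j := by
  have hl := h.nonneg hw (2 * k) (by omega) (by omega)
  have hr := h.nonneg hw (2 * k + 1) (by omega) (by omega)
  have hn := h.node k h1 hk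
  rw [add_assoc] at hn
  have hc : clampUnit (A (o + 2 * k) / A (o + k)) = A (o + 2 * k) / A (o + k) :=
    clampUnit_of_mem ⟨div_nonneg hl hA.le, (div_le_one hA).mpr (by linarith)⟩
  rw [treeStep, if_pos hk]
  rcases hj with rfl | rfl
  · refine le_trans (le_of_eq ?_) (le_bind_apply _ _ true _)
    simp [coinPMF, hc]
  · refine le_trans (le_of_eq ?_) (le_bind_apply _ _ false _)
    have : A (o + (2 * k + 1)) / A (o + k) = 1 - A (o + 2 * k) / A (o + k) := by
      rw [eq_sub_iff_add_eq, ← add_div, div_eq_one_iff_eq hA.ne']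
      linarith
    simp [coinPMF, hc, this]

/-- The ratios of child to parent weight telescope along the path through `k / 2`. The last
hypothesis says that `k` lies at depth `t` or is a leaf, where the walk stays. Below a weightless
parent the claim is trivial, so division by zero does not matter. -/
theorem ratio_le_treeWalk {A : ℕ → ℝ} {o N : ℕ} {w : ℕ → ℝ} (h : IsTree A o N w)
    (hw : ∀ k < N, 0 ≤ w k) (h0 : 0 < A (o + 1)) (t : ℕ) (k : ℕ) (h1 : 1 ≤ k) (h2 : k < 2 * N)
    (h3 : k < 2 ^ (t + 1)) (h4 : 2 ^ t ≤ k ∨ N ≤ k) :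
    ENNReal.ofReal (A (o + k) / A (o + 1)) ≤ treeWalk A o N t k := by
  induction t generalizing k with
  | zero =>
    have : k = 1 := by omega
    subst this
    simp [treeWalk, div_self h0.ne']
  | succ t ih =>
    rw [treeWalk]
    by_cases hk : 2 ^ (t + 1) ≤ k
    · have e := Nat.pow_succ 2 t
      have e' := Nat.pow_succ 2 (t + 1)
      have ih' := ih (k / 2) (by omega) (by omega) (by omega) (Or.inl (by omega))
      refine le_trans ?_ (le_bind_apply _ _ (k / 2) k)
      by_cases hA : 0 < A (o + k / 2)
      · have hs := ratio_le_treeStep h hw (k := k / 2) (j := k) (by omega) (by omega) hA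
          (by omega)
        refine le_trans (le_of_eq ?_) (mul_le_mul' ih' hs)
        rw [← ENNReal.ofReal_mul (div_nonneg hA.le h0.le)]
        congr 1
        field_simp
      · have hn := h.node (k / 2) (by omega) (by omega)
        have a1 := h.nonneg hw (2 * (k / 2)) (by omega) (by omega)
        have a2 := h.nonneg hw (2 * (k / 2) + 1) (by omega) (by omega)
        rw [add_assoc] at hn
        have : A (o + k) ≤ 0 := by
          rcases Nat.mod_two_eq_zero_or_one k with hm | hm
          · rw [show k = 2 * (k / 2) by omega]
            linarith
          · rw [show k = 2 * (k / 2) + 1 by omega]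
            linarith
        rw [ENNReal.ofReal_of_nonpos (div_nonpos_of_nonpos_of_nonneg this h0.le)]
        exact zero_le
    · have hN : N ≤ k := by omega
      refine le_trans ?_ (le_bind_apply _ _ k k)
      rw [treeStep, if_neg hN.not_gt]
      simpa using ih k h1 h2 (by omega) (Or.inr hN)

namespace Prog

/-- Recompute the weight of the node in register `12` from its children. -/
def sumChildren (b : ℕ) : Prog :=
  setR b (.add (.reg 10) (.reg 12)) (.add (.get b (.add (.reg 10) (.mul (.lit 2) (.reg 12))))
    (.get b (.add (.add (.reg 10) (.mul (.lit 2) (.reg 12))) (.lit 1))))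

/-- Fill in the inner nodes of the tree in the array `b` at the offset in register `10`; the
number of leaves is in register `x`. -/
def buildTree (x b : ℕ) : Prog :=
  seq (setN 12 (.reg x)) (loop (.sub (.reg x) (.lit 1))
    (seq (setN 12 (.sub (.reg 12) (.lit 1))) (sumChildren b)))

/-- Update the ancestors of the node in register `12`. -/
def ascend (b : ℕ) : Prog :=
  loop (.reg 4) (seq (setN 12 (.div (.reg 12) (.lit 2)))
    (ifN (.lit 0) (.reg 12) (sumChildren b) skip))

/-- Sample a leaf, and store its number in register `12`. -/
def descend (x b : ℕ) : Prog :=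
  seq (setN 12 (.lit 1)) (seq
    (loop (.reg 4) (ifN (.reg 12) (.reg x)
      (coin (.div (.get b (.add (.reg 10) (.mul (.lit 2) (.reg 12))))
          (.get b (.add (.reg 10) (.reg 12))))
        (setN 12 (.mul (.lit 2) (.reg 12))) (setN 12 (.add (.mul (.lit 2) (.reg 12)) (.lit 1))))
      skip))
    (setN 12 (.sub (.reg 12) (.reg x))))

theorem exec_sumChildren_arr (b : ℕ) (s : MState) :
    ((sumChildren b).exec s).arr b = Function.update (s.arr b) (s.nreg 10 + s.nreg 12)
      (s.arr b (s.nreg 10 + 2 * s.nreg 12) + s.arr b (s.nreg 10 + 2 * s.nreg 12 + 1)) := by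
  simp [sumChildren, exec_setR_arr, NExpr.eval, RExpr.eval]

theorem isTree_buildTree {x b o N : ℕ} {w : ℕ → ℝ} {s : MState} (hx : x ≠ 12) (hN : 0 < N)
    (ho : s.nreg 10 = o) (hxN : s.nreg x = N) (hw : ∀ k < N, s.arr b (o + N + k) = w k) :
    IsTree (((buildTree x b).exec s).arr b) o N w ∧
      ∀ k, (k ≤ o ∨ o + N ≤ k) → ((buildTree x b).exec s).arr b k = s.arr b k := by
  -- Inner nodes are filled in decreasing order, so children are ready before their parents.
  have h := loop_inv (s := (setN 12 (.reg x)).exec s) (e := .sub (.reg x) (.lit 1))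
    (c := seq (setN 12 (.sub (.reg 12) (.lit 1))) (sumChildren b)) (N := N - 1)
    (fun t nr ar => nr 10 = o ∧ nr 12 = N - t ∧
      (∀ k, N - t ≤ k → k < N → ar b (o + k) = ar b (o + 2 * k) + ar b (o + 2 * k + 1)) ∧
      ∀ k, (k ≤ o ∨ o + N ≤ k) → ar b k = s.arr b k) ?_ ?_ ?_
  · rw [buildTree, exec_seq]
    obtain ⟨-, -, h3, h4⟩ := h
    refine ⟨⟨fun k hk => ?_, fun k h1 hk => h3 k (by omega) hk⟩, h4⟩
    rw [h4 _ (by omega), hw k hk]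
  · simp [NExpr.eval, exec_setN_nreg, hx, hxN]
  · refine ⟨by simp [exec_setN_nreg, ho], by simp [exec_setN_nreg, NExpr.eval, hxN],
      fun k h1 h2 => by omega, fun k _ => rfl⟩
  · rintro t ht s' ⟨h1, h2, h3, h4⟩
    rw [exec_seq]
    set s'' := (setN 12 (.sub (.reg 12) (.lit 1))).exec s' with hs''
    have e12 : s''.nreg 12 = N - (t + 1) := by
      simp [hs'', exec_setN_nreg, NExpr.eval, h2]
      omega
    have e10 : s''.nreg 10 = o := by simp [hs'', exec_setN_nreg, h1]
    have ea : s''.arr = s'.arr := rfl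
    refine ⟨e10, e12, ?_, ?_⟩
    · intro k k1 k2
      rw [exec_sumChildren_arr, e10, e12, ea]
      simp only [Function.update_apply]
      rw [if_neg (show ¬o + 2 * k = o + (N - (t + 1)) by omega),
        if_neg (show ¬o + 2 * k + 1 = o + (N - (t + 1)) by omega)]
      split_ifs with h
      · rw [show k = N - (t + 1) by omega]
      · exact h3 k (by omega) k2
    · intro k hk
      rw [exec_sumChildren_arr, e10, e12, ea, Function.update_of_ne (by omega)]
      exact h4 k hk

theorem isTree_ascend {b o N i L : ℕ} {w A : ℕ → ℝ} {z : ℝ} {s : MState} (hA : IsTree A o N w)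
    (hi : i < N) (hL : N ≤ 2 ^ L) (h4 : s.nreg 4 = L) (ho : s.nreg 10 = o)
    (h12 : s.nreg 12 = N + i) (hb : s.arr b = Function.update A (o + N + i) z) :
    IsTree (((ascend b).exec s).arr b) o N (Function.update w i z) ∧
      ∀ k, (k ≤ o ∨ o + 2 * N ≤ k) → ((ascend b).exec s).arr b k = A k := by
  have hdiv : ∀ t r, (N + i) / 2 ^ (t + r) = (N + i) / 2 ^ t / 2 ^ r := by
    intro t r
    rw [pow_add, Nat.div_div_eq_div_mul]
  -- After `t` steps only the ancestors `(N + i) / 2 ^ (t + 1 + r)` not yet visited may violate the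
  -- node equation. Since `N ≤ 2 ^ L`, none is left after `L` steps; once the index is `0`, the
  -- remaining steps do nothing.
  have h := loop_inv (s := s) (e := .reg 4)
    (c := seq (setN 12 (.div (.reg 12) (.lit 2)))
      (ifN (.lit 0) (.reg 12) (sumChildren b) skip)) (N := L)
    (fun t nr ar => nr 10 = o ∧ nr 12 = (N + i) / 2 ^ t ∧
      (∀ k, 1 ≤ k → k < N → (∀ r, k ≠ (N + i) / 2 ^ (t + 1 + r)) →
        ar b (o + k) = ar b (o + 2 * k) + ar b (o + 2 * k + 1)) ∧
      ∀ k, (k ≤ o ∨ o + N ≤ k) → ar b k = s.arr b k) h4 ?_ ?_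
  · obtain ⟨-, -, h3, h4⟩ := h
    refine ⟨⟨fun k hk => ?_, fun k h1 hk => h3 k h1 hk fun r hr => ?_⟩, fun k hk => ?_⟩
    · refine (h4 _ (by omega)).trans ?_
      rw [hb, Function.update_apply, Function.update_apply]
      by_cases hki : k = i
      · simp [hki]
      · rw [if_neg (by omega), if_neg hki, hA.leaf k hk]
    · have h2 : (N + i) / 2 ^ (L + 1) = 0 := by
        refine Nat.div_eq_of_lt ?_
        rw [pow_succ]
        omega
      rw [hdiv, h2, Nat.zero_div] at hr
      omega
    · refine (h4 _ (by omega)).trans ?_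
      rw [hb, Function.update_of_ne (by omega)]
  · refine ⟨ho, by simpa using h12, fun k k1 k2 hk => ?_, fun k _ => rfl⟩
    have := hk 0
    simp only [zero_add, add_zero, pow_one] at this
    rw [hb, Function.update_of_ne (by omega), Function.update_of_ne (by omega),
      Function.update_of_ne (by omega)]
    exact hA.node k k1 k2
  · rintro t ht s' ⟨h1, h2, h3, h4⟩
    rw [exec_seq]
    set s'' := (setN 12 (.div (.reg 12) (.lit 2))).exec s' with hs''
    set d := (N + i) / 2 ^ (t + 1) with hd
    have e12 : s''.nreg 12 = d := by
      simp only [hs'', exec_setN_nreg, NExpr.eval, Function.update_self, h2]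
      exact (hdiv t 1).symm
    have e10 : s''.nreg 10 = o := by simp [hs'', exec_setN_nreg, h1]
    have ea : s''.arr = s'.arr := rfl
    have hdN : d < N := by
      have : d = (N + i) / 2 / 2 ^ t := by
        rw [hd, add_comm t 1]
        simpa using hdiv 1 t
      rw [this]
      exact lt_of_le_of_lt (Nat.div_le_self _ _) (by omega)
    have hd1 : ∀ r, (N + i) / 2 ^ (t + 1 + r) = d / 2 ^ r := fun r => hdiv (t + 1) r
    have hd2 : ∀ r, (N + i) / 2 ^ (t + 1 + 1 + r) = d / 2 / 2 ^ r := fun r => by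
      rw [hdiv, hdiv (t + 1) 1, pow_one]
    by_cases hpos : 0 < d
    · rw [exec_ifN_of_lt (by simpa [NExpr.eval, e12] using hpos)]
      set s3 := s''.tick _
      have f12 : s3.nreg 12 = d := e12
      have f10 : s3.nreg 10 = o := e10
      have fa : s3.arr = s'.arr := ea
      refine ⟨e10, e12, ?_, ?_⟩
      · intro k k1 k2 hk
        have hk0 := hk 0
        rw [hd2, pow_zero, Nat.div_one] at hk0
        rw [exec_sumChildren_arr, f10, f12, fa]
        simp only [Function.update_apply]
        rw [if_neg (show ¬o + 2 * k = o + d by omega),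
          if_neg (show ¬o + 2 * k + 1 = o + d by omega)]
        split_ifs with h
        · rw [show k = d by omega]
        · refine h3 k k1 k2 fun r => ?_
          cases r with
          | zero =>
            rw [hd1, pow_zero, Nat.div_one]
            omega
          | succ r =>
            have := hk r
            rwa [show t + 1 + (r + 1) = t + 1 + 1 + r by ring]
      · intro k hk
        rw [exec_sumChildren_arr, f10, f12, fa, Function.update_of_ne (by omega)]
        exact h4 k hk
    · have hd0 : d = 0 := by omega
      rw [exec_ifN_of_not_lt (by simpa [NExpr.eval, e12] using hpos)]
      refine ⟨e10, e12, fun k k1 k2 _ => h3 k k1 k2 fun r => ?_, h4⟩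
      rw [hd1, hd0, Nat.zero_div]
      omega

end Prog

/-- The leaf weights need only be proportional to `y`, since the common factor `c` cancels in the
coin biases. This is what allows unnormalized weights. -/
theorem generates_descend {x b o N L : ℕ} {s : MState} {w : ℕ → ℝ} (y : stdSimplex ℝ (Fin N))
    {c : ℝ} (hc : 0 < c) (hx : x ≠ 12) (hb : b ≠ 4) (hN : 0 < N) (ho : s.nreg 10 = o)
    (hxN : s.nreg x = N) (hL : s.nreg 4 = L) (hNL : N ≤ 2 ^ L) (hs : s.arr 4 0 = 0)
    (hA : IsTree (s.arr b) o N w) (hw : ∀ i : Fin N, w i = c * y i) :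
    Generates (Prog.descend x b).exec s (vecPMF y)
      (fun i s' => s'.nreg = Function.update s.nreg 12 (i : ℕ) ∧ s'.arr = s.arr) := by
  have hw0 : ∀ k < N, 0 ≤ w k := fun k hk => by
    rw [hw ⟨k, hk⟩]
    exact mul_nonneg hc.le (simplex_nonneg y _)
  have hroot : s.arr b (o + 1) = c := by
    rw [hA.root_eq_sum hN, Finset.sum_range]
    simp_rw [hw]
    rw [← Finset.mul_sum, simplex_sum, mul_one]
  -- Leaf `N + i` has number `i`; the remainder only makes the map total.
  let g : ℕ → Fin N := fun k => ⟨(k - N) % N, Nat.mod_lt _ hN⟩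
  have hlaw : (treeWalk (s.arr b) o N L).map g = vecPMF y := by
    refine (PMF.ext_of_le fun i => ?_).symm
    have h1 := ratio_le_treeWalk hA hw0 (by rw [hroot]; exact hc) L (N + i) (by omega) (by omega)
      (by rw [pow_succ]; omega) (Or.inr (by omega))
    rw [hroot, ← add_assoc, hA.leaf i i.2, hw, mul_div_cancel_left₀ _ hc.ne'] at h1
    refine h1.trans ?_
    rw [PMF.map]
    refine le_trans (le_of_eq ?_) (le_bind_apply _ _ (N + (i : ℕ)) i)
    have : g (N + (i : ℕ)) = i := Fin.ext (by simp [g, Nat.mod_eq_of_lt i.2])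
    simp [this]
  rw [← hlaw, Prog.descend]
  refine Generates.det_seq (by simp [Prog.NoDraw]) ?_
  set s₁ := (Prog.setN 12 (.lit 1)).exec s with hs₁
  have e1 : s₁.nreg = Function.update s.nreg 12 1 := rfl
  have ea : s₁.arr = s.arr := rfl
  refine Generates.seq_map (Q := fun k s' => s'.nreg = Function.update s.nreg 12 k ∧
    s'.arr = s.arr ∧ N ≤ k ∧ k < 2 * N) (by simp [Prog.NoDraw]) g ?_ ?_
  · refine Generates.mono (Generates.loop (N := L) (E := fun _ => ℕ) (a₀ := 1)
      (ρ := treeWalk (s.arr b) o N) (κ := fun _ => treeStep (s.arr b) o N)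
      (I := fun t k s' => s'.nreg = Function.update s.nreg 12 k ∧ s'.arr = s.arr ∧
        1 ≤ k ∧ k < 2 * N ∧ (2 ^ t ≤ k ∨ N ≤ k)) ?_ rfl ?_ (fun t => rfl) ?_) ?_
    · simp [NExpr.eval, e1, hL]
    · exact ⟨e1, ea, le_rfl, by omega, Or.inl (by simp)⟩
    · rintro t ht k s' ⟨h1, h2, h3, h4, h5⟩
      have r12 : (s'.tick 1).nreg 12 = k := by
        change s'.nreg 12 = k
        rw [h1, Function.update_self]
      have rx : (s'.tick 1).nreg x = N := by
        change s'.nreg x = N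
        rw [h1, Function.update_of_ne hx, hxN]
      rw [treeStep]
      by_cases hk : k < N
      · rw [if_pos hk]
        refine Generates.ifN_of_lt (by simpa [NExpr.eval, r12, rx] using hk) ?_
        refine Generates.coin (E := ℕ)
          (p := .div (.get b (.add (.reg 10) (.mul (.lit 2) (.reg 12))))
              (.get b (.add (.reg 10) (.reg 12))))
          (c := Prog.setN 12 (.mul (.lit 2) (.reg 12)))
          (d := Prog.setN 12 (.add (.mul (.lit 2) (.reg 12)) (.lit 1)))
          (p₀ := s.arr b (o + 2 * k) / s.arr b (o + k)) (μ := PMF.pure (2 * k))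
          (ν := PMF.pure (2 * k + 1))
          (Q := fun k s' => s'.nreg = Function.update s.nreg 12 k ∧ s'.arr = s.arr ∧
            1 ≤ k ∧ k < 2 * N ∧ (2 ^ (t + 1) ≤ k ∨ N ≤ k)) ?_ ?_ ?_ ?_
        · change s'.arr 4 0 = 0
          rw [h2, hs]
        · intro z
          have q : ∀ s₂ : MState, s₂.nreg = Function.update s.nreg 12 k →
              s₂.arr b = s.arr b →
              (RExpr.div (.get b (.add (.reg 10) (.mul (.lit 2) (.reg 12))))
                (.get b (.add (.reg 10) (.reg 12)))).eval s₂ =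
              s.arr b (o + 2 * k) / s.arr b (o + k) := by
            intro s₂ q1 q2
            simp [RExpr.eval, NExpr.eval, q1, q2, ho]
          refine q _ h1 ?_
          rw [← h2]
          exact Function.update_of_ne hb _ _
        · intro s₂ q1 q2
          refine Generates.det (by simp [Prog.NoDraw]) _ ⟨?_, q2.trans h2, by omega, by omega, ?_⟩
          · rw [Prog.exec_setN_nreg, q1]
            change Function.update s'.nreg 12 (2 * s₂.nreg 12) = _
            rw [q1]
            change Function.update s'.nreg 12 (2 * s'.nreg 12) = _
            rw [h1, Function.update_idem, Function.update_self]
          · rw [pow_succ]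
            omega
        · intro s₂ q1 q2
          refine Generates.det (by simp [Prog.NoDraw]) _ ⟨?_, q2.trans h2, by omega, by omega, ?_⟩
          · rw [Prog.exec_setN_nreg, q1]
            change Function.update s'.nreg 12 (2 * s₂.nreg 12 + 1) = _
            rw [q1]
            change Function.update s'.nreg 12 (2 * s'.nreg 12 + 1) = _
            rw [h1, Function.update_idem, Function.update_self]
          · rw [pow_succ]
            omega
      · rw [if_neg hk]
        exact Generates.ifN_of_not_lt (by simpa [NExpr.eval, r12, rx] using hk)
          (Generates.det (by simp [Prog.NoDraw]) _ ⟨h1, h2, h3, h4, Or.inr (by omega)⟩)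
    · rintro k s' ⟨h1, h2, h3, h4, h5⟩
      exact ⟨h1, h2, by omega, h4⟩
  · rintro k s' ⟨h1, h2, h3, h4⟩
    refine ⟨?_, h2⟩
    have : ((g k : Fin N) : ℕ) = k - N := Nat.mod_eq_of_lt (by omega)
    rw [Prog.exec_setN_nreg, this]
    simp [NExpr.eval, h1, hx, hxN]

/-! ## The memory of the primal-dual method, and sampling -/

theorem flatten_apply {n m : ℕ} (f : Fin n → Fin m → Fin n → ℝ) (i : Fin n) (a : Fin m)
    (j : Fin n) : flatten f (j + n * (a + m * i)) = f i a j := by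
  have e1 : (j : ℕ) + n * (a + m * i) = (finProdFinEquiv (finProdFinEquiv (i, a), j) : ℕ) := by
    simp [finProdFinEquiv]
  have h : (j : ℕ) + n * (a + m * i) < n * m * n := e1 ▸ Fin.is_lt _
  have e2 : (⟨j + n * (a + m * i), h⟩ : Fin (n * m * n)) =
      finProdFinEquiv (finProdFinEquiv (i, a), j) := Fin.ext e1
  rw [flatten, dif_pos h]
  simp only [e2, Equiv.symm_apply_apply]

/-- The extension by zero of a finite sequence. -/
def zeroExtend {N : ℕ} (f : Fin N → ℝ) (k : ℕ) : ℝ := if h : k < N then f ⟨k, h⟩ else 0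

theorem zeroExtend_apply {N : ℕ} (f : Fin N → ℝ) (i : Fin N) : zeroExtend f i = f i := dif_pos i.2

theorem zeroExtend_of_lt {N : ℕ} (f : Fin N → ℝ) {k : ℕ} (h : k < N) : zeroExtend f k = f ⟨k, h⟩ :=
  dif_pos h

theorem IsTree.congr_weights {A : ℕ → ℝ} {o N : ℕ} {w w' : ℕ → ℝ} (h : IsTree A o N w)
    (hw : ∀ k < N, w k = w' k) : IsTree A o N w' :=
  ⟨fun k hk => (h.leaf k hk).trans (hw k hk), h.node⟩

/-- The index of the state-action pair `(i, a)`. -/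
def pairIdx {n m : ℕ} (i : Fin n) (a : Fin m) : ℕ := a + m * i

theorem pairIdx_lt {n m : ℕ} (i : Fin n) (a : Fin m) : pairIdx i a < n * m := by
  have h1 := i.2
  have h2 := a.2
  have h3 : m * (i + 1) ≤ m * n := Nat.mul_le_mul_left m h1
  rw [pairIdx, mul_comm n m]
  linarith [mul_add m (i : ℕ) 1]

theorem pairIdx_inj {n m : ℕ} {i i' : Fin n} {a a' : Fin m} (h : pairIdx i a = pairIdx i' a') :
    i = i' ∧ a = a' := by
  have e : ∀ (i : Fin n) (a : Fin m), pairIdx i a = (finProdFinEquiv (i, a) : ℕ) := by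
    intro i a
    simp [finProdFinEquiv, pairIdx]
  rw [e, e] at h
  have := finProdFinEquiv.injective (Fin.ext h)
  exact ⟨congrArg Prod.fst this, congrArg Prod.snd this⟩

namespace DMDP

variable {n m : ℕ} (M : DMDP n m)

/-- The memory contents that are set up before the first run of the primal-dual method and not
changed later. -/
structure Prepared (T L : ℕ) (nr : ℕ → ℕ) (ar : ℕ → ℕ → ℝ) : Prop where
  nr0 : nr 0 = n
  nr1 : nr 1 = m
  nr2 : nr 2 = T
  nr4 : nr 4 = L
  n_le : n ≤ 2 ^ L
  m_le : m ≤ 2 ^ L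
  ar0 : ar 0 = flatten fun i a j => M.p i a j
  ar1 : ar 1 = flatten M.r
  ar2 : ar 2 0 = M.γ
  ar4 : ar 4 0 = 0
  ar5 : ∀ c < n * m, IsTree (ar 5) (2 * n * c) n
    fun k => flatten (fun i a j => M.p i a j) (k + n * c)
  ar16 : IsTree (ar 16) 0 n fun _ => 1
  ar17β : ar 17 0 = M.β T
  ar17α : ar 17 1 = M.α T
  ar19 : ∀ i a, ar 19 (pairIdx i a) = M.meanReward i a

variable {M}

theorem Prepared.congr {T L : ℕ} {nr nr' : ℕ → ℕ} {ar ar' : ℕ → ℕ → ℝ}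
    (h : M.Prepared T L nr ar) (hn : ∀ x < 5, nr' x = nr x)
    (ha : ∀ b ∈ [0, 1, 2, 4, 5, 16, 17, 19], ar' b = ar b) : M.Prepared T L nr' ar' := by
  obtain ⟨h0, h1, h2, h3, h4, h5, h6, h7, h8, h9, h10, h11, h12, h13, h14⟩ := h
  simp only [List.mem_cons, List.not_mem_nil, or_false, forall_eq_or_imp, forall_eq] at ha
  obtain ⟨a0, a1, a2, a4, a5, a16, a17, a19⟩ := ha
  refine ⟨?_, ?_, ?_, ?_, h4, h5, ?_, ?_, ?_, ?_, ?_, ?_, ?_, ?_, ?_⟩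
  · rw [hn 0 (by norm_num), h0]
  · rw [hn 1 (by norm_num), h1]
  · rw [hn 2 (by norm_num), h2]
  · rw [hn 4 (by norm_num), h3]
  · rw [a0, h6]
  · rw [a1, h7]
  · rw [a2, h8]
  · rw [a4, h9]
  · rwa [a5]
  · rwa [a16]
  · rw [a17, h12]
  · rw [a17, h13]
  · rwa [a19]

end DMDP

/-- The memory represents the iterate `x` and the previous policies `h`; the unnormalized weights
have row sums `S`. -/
structure Represents {n m t : ℕ} (x : Iterate n m) (h : Fin t → Policy n m) (S : Fin n → ℝ) (Z : ℝ)
    (nr : ℕ → ℕ) (ar : ℕ → ℕ → ℝ) : Prop where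
  S_pos : ∀ i, 0 < S i
  Z_pos : 0 < Z
  nr6 : nr 6 = t
  ar6 : ∀ i : Fin n, IsTree (ar 6) (2 * m * i) m (zeroExtend fun a => S i * x.π i a)
  ar7 : IsTree (ar 7) 0 n (zeroExtend S)
  S_eq : ∀ i, S i = Z * x.ξ i
  ar8 : ∀ i : Fin n, ar 8 i = x.v i
  avg : ∀ i a, ∑ s, h s i a = ar 9 (pairIdx i a) + S i * x.π i a * (ar 10 i + t / S i)

namespace Prog

/-- The expression for the index of the current state-action pair. -/
def pairExpr : NExpr := .add (.reg 8) (.mul (.reg 1) (.reg 7))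

/-- Sample a state, an action and the next state, and store them in registers `7`, `8`, `9`. -/
def sampleTriple : Prog :=
  seq (seq (setN 10 (.lit 0)) (seq (coin (.get 2 (.lit 0)) (descend 0 7) (descend 0 16))
    (setN 7 (.reg 12))))
  (seq (seq (setN 10 (.mul (.mul (.lit 2) (.reg 1)) (.reg 7))) (seq (descend 1 6)
    (setN 8 (.reg 12))))
  (seq (setN 10 (.mul (.mul (.lit 2) (.reg 0)) pairExpr)) (seq (descend 0 5)
    (setN 9 (.reg 12)))))

end Prog

/-- The mixture defining the sampling weights is realized by a coin with bias `γ` and a descent in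
one of two trees, so it never has to be stored. -/
theorem coinPMF_bind_vecPMF {N : ℕ} (x y z : stdSimplex ℝ (Fin N)) {p : ℝ}
    (hp : p ∈ Set.Icc (0 : ℝ) 1) (hz : ∀ i, z i = p * x i + (1 - p) * y i) :
    ((coinPMF p).bind fun b => if b then vecPMF x else vecPMF y) = vecPMF z := by
  ext i
  rw [PMF.bind_apply, tsum_fintype, Fintype.sum_bool]
  have h : ∀ w : stdSimplex ℝ (Fin N), vecPMF w i = ENNReal.ofReal (w i) := fun w => rfl
  have h1 : 0 ≤ 1 - p := sub_nonneg.mpr hp.2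
  simp only [if_true, Bool.false_eq_true, if_false, h]
  rw [hz, ENNReal.ofReal_add (mul_nonneg hp.1 (simplex_nonneg x i))
    (mul_nonneg h1 (simplex_nonneg y i)), ENNReal.ofReal_mul hp.1, ENNReal.ofReal_mul h1]
  simp [coinPMF, clampUnit_of_mem hp]

namespace DMDP

variable {n m : ℕ} (M : DMDP n m) [NeZero n]

/-- The law of the sample `(i, a, j)`. -/
def samplePMF (x : Iterate n m) : PMF (Fin n × Fin m × Fin n) :=
  (vecPMF (M.mixVec x.ξ)).bind fun i => (vecPMF (x.π i)).bind fun a =>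
    (vecPMF (M.p i a)).map fun j => (i, a, j)

theorem iteration_eq (T : ℕ) (x : Iterate n m) :
    M.iteration T x = (M.samplePMF x).map fun z => M.update T x z.1 z.2.1 z.2.2 := by
  rw [samplePMF, PMF.map_bind]
  simp_rw [PMF.map_bind, PMF.map_comp]
  rfl

theorem generates_sampleTriple [NeZero m] {T L t : ℕ} {x : Iterate n m} {h : Fin t → Policy n m}
    {S : Fin n → ℝ} {Z : ℝ} {s : MState} (hP : M.Prepared T L s.nreg s.arr)
    (hR : Represents x h S Z s.nreg s.arr) :
    Generates Prog.sampleTriple.exec s (M.samplePMF x) (fun z s' =>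
      (∀ y < 7, s'.nreg y = s.nreg y) ∧ s'.nreg 7 = z.1 ∧ s'.nreg 8 = z.2.1 ∧
      s'.nreg 9 = z.2.2 ∧ s'.arr = s.arr) := by
  have hn0 := Nat.pos_of_ne_zero (NeZero.ne n)
  have hm0 := Nat.pos_of_ne_zero (NeZero.ne m)
  have hγ : M.γ ∈ Set.Icc (0 : ℝ) 1 := ⟨M.γ_nonneg, M.γ_mem.2.le⟩
  refine Generates.seq (Q := fun i s' => (∀ y < 7, s'.nreg y = s.nreg y) ∧
    s'.nreg 7 = (i : Fin n) ∧ s'.arr = s.arr) ?_ ?_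
  · rw [← coinPMF_bind_vecPMF x.ξ M.q (M.mixVec x.ξ) hγ (M.mixVec_apply x.ξ)]
    refine Generates.det_seq (by simp [Prog.NoDraw]) ?_
    set s₁ := (Prog.setN 10 (.lit 0)).exec s with hs₁
    have e1 : s₁.nreg = Function.update s.nreg 10 0 := rfl
    have ea : s₁.arr = s.arr := rfl
    rw [← PMF.map_id (PMF.bind _ _)]
    refine Generates.seq_map (by simp [Prog.NoDraw]) _ (Q := fun i s' =>
      s'.nreg = Function.update s₁.nreg 12 ((i : Fin n) : ℕ) ∧ s'.arr = s.arr) ?_ ?_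
    · refine Generates.coin (by rw [ea, hP.ar4]) (fun y => ?_) ?_ ?_
      · simp only [RExpr.eval, NExpr.eval, MState.writeR, ea]
        rw [Function.update_of_ne (by decide), hP.ar2]
      · intro s₂ h1 h2
        rw [← h1, ← ea, ← h2]
        exact generates_descend x.ξ hR.Z_pos (by decide) (by decide) hn0 (o := 0)
          (by simp [h1, e1]) (by simp [h1, e1, hP.nr0]) (L := L)
          (by simp [h1, e1, hP.nr4]) hP.n_le (by rw [h2, ea, hP.ar4])
          (by rw [h2, ea]; exact hR.ar7) (fun i => by rw [zeroExtend_apply, hR.S_eq])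
      · intro s₂ h1 h2
        rw [← h1, ← ea, ← h2]
        refine generates_descend M.q (c := n) (Nat.cast_pos.mpr hn0) (by decide) (by decide) hn0
          (o := 0)
          (by simp [h1, e1]) (by simp [h1, e1, hP.nr0]) (L := L)
          (by simp [h1, e1, hP.nr4]) hP.n_le (by rw [h2, ea, hP.ar4])
          (by rw [h2, ea]; exact hP.ar16) (fun i => ?_)
        have : (n : ℝ) ≠ 0 := Nat.cast_ne_zero.mpr (NeZero.ne n)
        rw [q_apply]
        field_simp
    · rintro i s' ⟨h1, h2⟩
      refine ⟨fun y hy => ?_, ?_, h2⟩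
      · rw [Prog.exec_setN_nreg, Function.update_of_ne (by omega), h1,
          Function.update_of_ne (by omega), e1, Function.update_of_ne (by omega)]
      · simp [Prog.exec_setN_nreg, NExpr.eval, h1]
  rintro i s₁ ⟨h1, h2, h3⟩
  refine Generates.seq (Q := fun a s' => (∀ y < 7, s'.nreg y = s.nreg y) ∧
    s'.nreg 7 = i ∧ s'.nreg 8 = (a : Fin m) ∧ s'.arr = s.arr) ?_ ?_
  · refine Generates.det_seq (by simp [Prog.NoDraw]) ?_
    set s₂ := (Prog.setN 10 (.mul (.mul (.lit 2) (.reg 1)) (.reg 7))).exec s₁ with hs₂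
    have e1 : s₂.nreg = Function.update s₁.nreg 10 (2 * m * i) := by
      simp [hs₂, Prog.exec_setN_nreg, NExpr.eval, h1 1 (by norm_num), h2, hP.nr1]
    have ea : s₂.arr = s.arr := h3
    rw [← PMF.map_id (vecPMF (x.π i))]
    refine Generates.seq_map (by simp [Prog.NoDraw]) _ (Q := fun a s' =>
      s'.nreg = Function.update s₂.nreg 12 ((a : Fin m) : ℕ) ∧ s'.arr = s₂.arr)
      (generates_descend (x.π i) (hR.S_pos i) (by decide) (by decide) hm0 (o := 2 * m * i)
          (by simp [e1]) (by simp [e1, h1 1 (by norm_num), hP.nr1]) (L := L)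
          (by simp [e1, h1 4 (by norm_num), hP.nr4]) hP.m_le (by rw [ea, hP.ar4])
          (by rw [ea]; exact hR.ar6 i) (fun a => by rw [zeroExtend_apply])) ?_
    rintro a s' ⟨k1, k2⟩
    refine ⟨fun y hy => ?_, ?_, ?_, k2.trans ea⟩
    · rw [Prog.exec_setN_nreg, Function.update_of_ne (by omega), k1,
        Function.update_of_ne (by omega), e1, Function.update_of_ne (by omega), h1 y hy]
    · simp [Prog.exec_setN_nreg, k1, e1, h2]
    · simp [Prog.exec_setN_nreg, NExpr.eval, k1]
  rintro a s₂ ⟨h4, h5, h6, h7⟩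
  refine Generates.det_seq (by simp [Prog.NoDraw]) ?_
  set s₃ := (Prog.setN 10 (.mul (.mul (.lit 2) (.reg 0)) Prog.pairExpr)).exec s₂ with hs₃
  have e1 : s₃.nreg = Function.update s₂.nreg 10 (2 * n * pairIdx i a) := by
    simp [hs₃, Prog.exec_setN_nreg, NExpr.eval, Prog.pairExpr, h4 0 (by norm_num),
      h4 1 (by norm_num), h5, h6, hP.nr0, hP.nr1, pairIdx]
  have ea : s₃.arr = s.arr := h7
  refine Generates.seq_map (by simp [Prog.NoDraw]) _ (Q := fun j s' =>
    s'.nreg = Function.update s₃.nreg 12 ((j : Fin n) : ℕ) ∧ s'.arr = s₃.arr)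
    (generates_descend (M.p i a) one_pos (by decide) (by decide) hn0 (o := 2 * n * pairIdx i a)
        (by simp [e1]) (by simp [e1, h4 0 (by norm_num), hP.nr0]) (L := L)
        (by simp [e1, h4 4 (by norm_num), hP.nr4]) hP.n_le (by rw [ea, hP.ar4])
        (by rw [ea]; exact hP.ar5 _ (pairIdx_lt i a)) (fun j => by
          rw [pairIdx, flatten_apply, one_mul])) ?_
  rintro j s' ⟨k1, k2⟩
  refine ⟨fun y hy => ?_, ?_, ?_, ?_, k2.trans ea⟩
  · rw [Prog.exec_setN_nreg, Function.update_of_ne (by omega), k1,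
      Function.update_of_ne (by omega), e1, Function.update_of_ne (by omega), h4 y hy]
  · simp [Prog.exec_setN_nreg, k1, e1, h5]
  · simp [Prog.exec_setN_nreg, k1, e1, h6]
  · simp [Prog.exec_setN_nreg, NExpr.eval, k1]

end DMDP

/-! ## Updating the memory -/

namespace Prog

/-- The discount factor. -/
def discountExpr : RExpr := .get 2 (.lit 0)

/-- The number `1 - γ`. -/
def discountGapExpr : RExpr := .sub (.cast (.lit 1)) discountExpr

/-- Store the value of `f`, clipped to `[0, 1 / (1 - γ)]`. -/
def storeClip (b : ℕ) (e : NExpr) (f : RExpr) : Prog :=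
  seq (setR 15 (.lit 3) f)
  (seq (ifR (.div (.cast (.lit 1)) discountGapExpr) (.get 15 (.lit 3))
    (setR 15 (.lit 3) (.div (.cast (.lit 1)) discountGapExpr)) skip)
  (seq (ifR (.get 15 (.lit 3)) (.cast (.lit 0)) (setR 15 (.lit 3) (.cast (.lit 0))) skip)
    (setR b e (.get 15 (.lit 3)))))

/-- The address of the current leaf in the action trees. -/
def actionLeafExpr : NExpr := .add (.add (.mul (.mul (.lit 2) (.reg 1)) (.reg 7)) (.reg 1)) (.reg 8)

/-- The address of the current leaf in the state tree. -/
def stateLeafExpr : NExpr := .add (.reg 0) (.reg 7)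

/-- Compute the sampling weight and the dual factor, and update the values. -/
def updateValues : Prog :=
  seq (setR 15 (.lit 1) (.add
    (.mul discountExpr (.div (.get 7 stateLeafExpr) (.get 7 (.lit 1))))
    (.mul discountGapExpr (.div (.cast (.lit 1)) (.cast (.reg 0))))))
  (seq (setR 15 (.lit 2) (.exp (.mul (.get 17 (.lit 0)) (.div
    (.sub (.add (.sub (.mul discountExpr (.get 8 (.reg 9))) (.get 8 (.reg 7)))
      (.get 1 (.add (.reg 9) (.mul (.reg 0) pairExpr))))
      (.div (.cast (.lit 1)) discountGapExpr))
    (.mul (.get 15 (.lit 1)) (.div (.get 6 actionLeafExpr) (.get 7 stateLeafExpr)))))))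
  (seq (storeClip 8 (.reg 7) (.sub (.get 8 (.reg 7)) (.mul (.get 17 (.lit 1)) (.sub
      (.div (.mul discountGapExpr (.div (.cast (.lit 1)) (.cast (.reg 0)))) (.get 15 (.lit 1)))
      (.cast (.lit 1))))))
    (storeClip 8 (.reg 9)
      (.sub (.get 8 (.reg 9)) (.mul (.get 17 (.lit 1)) discountExpr)))))

/-- The iteration counter plus one, divided by the current row sum. -/
def weightedTimeExpr : RExpr := .div (.cast (.add (.reg 6) (.lit 1))) (.get 7 stateLeafExpr)

/-- Update the running sums and the current leaf of the action tree. -/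
def updateLeaf : Prog :=
  seq (setR 15 (.lit 4) (.add (.get 10 (.reg 7)) weightedTimeExpr))
  (seq (setR 9 pairExpr (.add (.get 9 pairExpr)
    (.mul (.sub (.get 6 actionLeafExpr) (.mul (.get 6 actionLeafExpr) (.get 15 (.lit 2))))
      (.get 15 (.lit 4)))))
  (seq (setR 6 actionLeafExpr (.mul (.get 6 actionLeafExpr) (.get 15 (.lit 2))))
  (seq (setN 10 (.mul (.mul (.lit 2) (.reg 1)) (.reg 7)))
    (setN 12 (.add (.reg 1) (.reg 8))))))

/-- Copy the new row sum to the state tree. -/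
def updateRow : Prog :=
  seq (setR 7 stateLeafExpr (.get 6 (.add (.reg 10) (.lit 1))))
  (seq (setR 10 (.reg 7) (.sub (.get 15 (.lit 4)) weightedTimeExpr))
  (seq (setN 10 (.lit 0)) (setN 12 stateLeafExpr)))

/-- Update the memory after a sample has been drawn. -/
def updateAll : Prog :=
  seq updateValues (seq updateLeaf (seq (ascend 6) (seq updateRow (seq (ascend 7)
    (setN 6 (.add (.reg 6) (.lit 1)))))))

end Prog

namespace DMDP

variable {n m : ℕ} (M : DMDP n m)

theorem exec_storeClip {b : ℕ} {e : NExpr} {f : RExpr} {s : MState} (hb : b ≠ 15)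
    (hγ : s.arr 2 0 = M.γ) :
    ((Prog.storeClip b e f).exec s).nreg = s.nreg ∧
    ((Prog.storeClip b e f).exec s).arr b =
      Function.update (s.arr b) (e.eval s) (M.clip (f.eval s)) ∧
    (∀ b', b' ≠ b → b' ≠ 15 → ((Prog.storeClip b e f).exec s).arr b' = s.arr b') ∧
    ∀ k ≠ 3, ((Prog.storeClip b e f).exec s).arr 15 k = s.arr 15 k := by
  have hpos : 0 < 1 / (1 - M.γ) := one_div_pos.mpr M.one_sub_γ_pos
  set s₁ := (Prog.setR 15 (.lit 3) f).exec s with hs₁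
  -- Each of the two truncations is a conditional overwriting of one scratch entry; `P` is the
  -- condition under which it takes place.
  have step : ∀ (s' : MState) (P : Prop) [Decidable P] (z y : ℝ), s'.nreg = s.nreg →
      (∀ b' ≠ 15, s'.arr b' = s.arr b') → (∀ k ≠ 3, s'.arr 15 k = s.arr 15 k) →
      s'.arr 15 3 = z → ∀ g : RExpr, g.eval s' = y →
      ∀ s'' : MState, ((P ∧ s''.nreg = s'.nreg ∧ s''.arr = ((Prog.setR 15 (.lit 3) g).exec s').arr) ∨
        (¬P ∧ s''.nreg = s'.nreg ∧ s''.arr = s'.arr)) →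
      s''.nreg = s.nreg ∧ (∀ b' ≠ 15, s''.arr b' = s.arr b') ∧
        (∀ k ≠ 3, s''.arr 15 k = s.arr 15 k) ∧ s''.arr 15 3 = if P then y else z := by
    rintro s' P _ z y h1 h2 h3 h4 g h5 s'' (⟨h6, h7, h8⟩ | ⟨h6, h7, h8⟩)
    · rw [h7, h8, Prog.exec_setR_arr, h5]
      refine ⟨h1, fun b' hb' => ?_, fun k hk => ?_, ?_⟩
      · rw [Function.update_of_ne hb', h2 b' hb']
      · rw [Function.update_self, Function.update_of_ne (by simpa [NExpr.eval] using hk), h3 k hk]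
      · simp [NExpr.eval, h6]
    · rw [h7, h8, if_neg h6]
      exact ⟨h1, h2, h3, h4⟩
  have a1 : s₁.nreg = s.nreg := rfl
  have a2 : ∀ b' ≠ 15, s₁.arr b' = s.arr b' := fun b' hb' => Function.update_of_ne hb' _ _
  have a3 : ∀ k ≠ 3, s₁.arr 15 k = s.arr 15 k := fun k hk => by
    rw [hs₁, Prog.exec_setR_arr, Function.update_self]
    exact Function.update_of_ne hk _ _
  have a4 : s₁.arr 15 3 = f.eval s := by simp [hs₁, Prog.exec_setR_arr, NExpr.eval]
  have aU : ∀ s' : MState, (∀ b' ≠ 15, s'.arr b' = s.arr b') →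
      (RExpr.div (.cast (.lit 1)) Prog.discountGapExpr).eval s' = 1 / (1 - M.γ) := by
    intro s' h
    simp [RExpr.eval, NExpr.eval, Prog.discountGapExpr, Prog.discountExpr, h, hγ]
  classical
  set s₂ := (Prog.ifR (.div (.cast (.lit 1)) Prog.discountGapExpr) (.get 15 (.lit 3))
    (.setR 15 (.lit 3) (.div (.cast (.lit 1)) Prog.discountGapExpr)) .skip).exec s₁ with hs₂
  obtain ⟨b1, b2, b3, b4⟩ := step s₁ (1 / (1 - M.γ) < f.eval s) _ _ a1 a2 a3 a4 _ (aU s₁ a2) s₂ (by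
    have e : (RExpr.get 15 (.lit 3)).eval s₁ = f.eval s := a4
    by_cases h : 1 / (1 - M.γ) < f.eval s
    · refine Or.inl ⟨h, ?_⟩
      rw [hs₂, Prog.exec_ifR_of_lt (by rwa [aU s₁ a2, e])]
      exact ⟨rfl, rfl⟩
    · refine Or.inr ⟨h, ?_⟩
      rw [hs₂, Prog.exec_ifR_of_not_lt (by rwa [aU s₁ a2, e])]
      exact ⟨rfl, rfl⟩)
  set z := if 1 / (1 - M.γ) < f.eval s then 1 / (1 - M.γ) else f.eval s with hz
  set s₃ := (Prog.ifR (.get 15 (.lit 3)) (.cast (.lit 0))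
    (.setR 15 (.lit 3) (.cast (.lit 0))) .skip).exec s₂ with hs₃
  obtain ⟨c1, c2, c3, c4⟩ := step s₂ (z < 0) _ 0 b1 b2 b3 b4 (.cast (.lit 0))
    (by simp [RExpr.eval, NExpr.eval]) s₃ (by
    have e : (RExpr.get 15 (.lit 3)).eval s₂ = z := b4
    have e0 : (RExpr.cast (.lit 0)).eval s₂ = 0 := by simp [RExpr.eval, NExpr.eval]
    by_cases h : z < 0
    · refine Or.inl ⟨h, ?_⟩
      rw [hs₃, Prog.exec_ifR_of_lt (by rwa [e, e0])]
      exact ⟨rfl, rfl⟩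
    · refine Or.inr ⟨h, ?_⟩
      rw [hs₃, Prog.exec_ifR_of_not_lt (by rwa [e, e0])]
      exact ⟨rfl, rfl⟩)
  have hclip : (if z < 0 then 0 else z) = M.clip (f.eval s) := by
    have e1 : z = min (f.eval s) (1 / (1 - M.γ)) := by
      rw [hz]
      split_ifs with h
      · exact (min_eq_right h.le).symm
      · exact (min_eq_left (not_lt.mp h)).symm
    rw [clip, ← e1]
    split_ifs with h
    · exact (max_eq_right h.le).symm
    · exact (max_eq_left (not_lt.mp h)).symm
  rw [hclip] at c4
  have hfin : (Prog.storeClip b e f).exec s = (Prog.setR b e (.get 15 (.lit 3))).exec s₃ := rfl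
  rw [hfin, Prog.exec_setR_nreg, Prog.exec_setR_arr, Function.update_self, c2 b hb,
    e.eval_of_nreg_eq c1]
  refine ⟨c1, ?_, fun b' h1 h2 => ?_, fun k hk => ?_⟩
  · exact congrArg _ c4
  · rw [Function.update_of_ne h1, c2 b' h2]
  · rw [Function.update_of_ne (Ne.symm hb), c3 k hk]

variable {M}

theorem _root_.Represents.root_eq {t : ℕ} {x : Iterate n m} {h : Fin t → Policy n m} {S : Fin n → ℝ} {Z : ℝ}
    {nr : ℕ → ℕ} {ar : ℕ → ℕ → ℝ} (hR : Represents x h S Z nr ar) (hn : 0 < n) : ar 7 1 = Z := by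
  have h1 := hR.ar7.root_eq_sum hn
  rw [zero_add, Finset.sum_range] at h1
  simp_rw [zeroExtend_apply, hR.S_eq] at h1
  rw [h1, ← Finset.mul_sum, simplex_sum, mul_one]

/-- The normalized quantities are recovered as quotients: `π i a` is leaf over row sum, and `ξ i` is
row sum over the root `Z`. The exponent is computed before the values change. -/
theorem exec_updateValues [NeZero n] {T L t : ℕ} {x : Iterate n m} {h : Fin t → Policy n m}
    {S : Fin n → ℝ} {Z : ℝ} {s : MState} (hP : M.Prepared T L s.nreg s.arr)
    (hR : Represents x h S Z s.nreg s.arr) {i : Fin n} {a : Fin m} {j : Fin n}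
    (h7 : s.nreg 7 = i) (h8 : s.nreg 8 = a) (h9 : s.nreg 9 = j) :
    (Prog.updateValues.exec s).nreg = s.nreg ∧
    (∀ b, b ≠ 8 → b ≠ 15 → (Prog.updateValues.exec s).arr b = s.arr b) ∧
    (∀ k : Fin n, (Prog.updateValues.exec s).arr 8 k = M.primalUpdate T x i j k) ∧
    (Prog.updateValues.exec s).arr 15 2 = Real.exp (M.dualStep T x i a j) := by
  have hn0 := Nat.pos_of_ne_zero (NeZero.ne n)
  have e7 : s.arr 7 (n + i) = S i := by
    have := hR.ar7.leaf i i.2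
    rwa [zero_add, zeroExtend_apply] at this
  have e71 := hR.root_eq hn0
  have eξ : S i / Z = x.ξ i := by rw [hR.S_eq, mul_div_cancel_left₀ _ hR.Z_pos.ne']
  have e6 : s.arr 6 (2 * m * i + m + a) = S i * x.π i a := by
    have := (hR.ar6 i).leaf a a.2
    rwa [zeroExtend_apply] at this
  have eπ : S i * x.π i a / S i = x.π i a := mul_div_cancel_left₀ _ (hR.S_pos i).ne'
  have er : s.arr 1 (j + n * (a + m * i)) = M.r i a j := by rw [hP.ar1, flatten_apply]
  set w := M.mixVec x.ξ i with hw
  have ew : M.γ * x.ξ i + (1 - M.γ) * (1 / n) = w := by rw [hw, mixVec_apply, q_apply]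
  set s₁ := (Prog.setR 15 (.lit 1) (.add
    (.mul Prog.discountExpr (.div (.get 7 Prog.stateLeafExpr) (.get 7 (.lit 1))))
    (.mul Prog.discountGapExpr (.div (.cast (.lit 1)) (.cast (.reg 0)))))).exec s with hs₁
  have a1 : s₁.arr = Function.update s.arr 15 (Function.update (s.arr 15) 1 w) := by
    rw [hs₁, Prog.exec_setR_arr]
    congr 2
    simp only [RExpr.eval, NExpr.eval, Prog.discountGapExpr, Prog.discountExpr,
      Prog.stateLeafExpr, hP.nr0, h7, hP.ar2, e7, e71, eξ, Nat.cast_one, ew]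
  set f : RExpr := .exp (.mul (.get 17 (.lit 0)) (.div
    (.sub (.add (.sub (.mul Prog.discountExpr (.get 8 (.reg 9))) (.get 8 (.reg 7)))
      (.get 1 (.add (.reg 9) (.mul (.reg 0) Prog.pairExpr))))
      (.div (.cast (.lit 1)) Prog.discountGapExpr))
    (.mul (.get 15 (.lit 1)) (.div (.get 6 Prog.actionLeafExpr) (.get 7 Prog.stateLeafExpr)))))
    with hf
  have hfe : f.eval s₁ = Real.exp (M.dualStep T x i a j) := by
    have e8 : s₁.nreg = s.nreg := rfl
    simp only [hf, RExpr.eval, NExpr.eval, Prog.discountGapExpr, Prog.discountExpr,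
      Prog.stateLeafExpr, Prog.actionLeafExpr, Prog.pairExpr, e8, a1, h7, h8, h9, hP.nr0, hP.nr1]
    simp [hP.ar2, hP.ar17β, hR.ar8, er, e6, e7, eπ, dualStep, hw]
  set s₂ := (Prog.setR 15 (.lit 2) f).exec s₁ with hs₂
  have b1 : s₂.nreg = s.nreg := rfl
  have b2 : s₂.arr = Function.update s.arr 15 (Function.update (Function.update (s.arr 15) 1 w) 2
      (Real.exp (M.dualStep T x i a j))) := by
    rw [hs₂, Prog.exec_setR_arr, hfe, a1]
    simp [NExpr.eval]
  set g : RExpr := .sub (.get 8 (.reg 7)) (.mul (.get 17 (.lit 1)) (.sub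
      (.div (.mul Prog.discountGapExpr (.div (.cast (.lit 1)) (.cast (.reg 0)))) (.get 15 (.lit 1)))
      (.cast (.lit 1)))) with hg
  have hge : g.eval s₂ = x.v i - M.α T * ((1 - M.γ) * M.q i / w - 1) := by
    simp [hg, RExpr.eval, NExpr.eval, Prog.discountGapExpr, Prog.discountExpr, b1, b2, h7, hP.nr0,
      hP.ar2, hP.ar17α, hR.ar8, q_apply]
  obtain ⟨c1, c2, c3, c4⟩ := M.exec_storeClip (b := 8) (e := .reg 7) (f := g) (s := s₂) (by decide)
    (by simp [b2, hP.ar2])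
  rw [hge] at c2
  set s₃ := (Prog.storeClip 8 (.reg 7) g).exec s₂ with hs₃
  obtain ⟨d1, d2, d3, d4⟩ := M.exec_storeClip (b := 8) (e := .reg 9)
    (f := .sub (.get 8 (.reg 9)) (.mul (.get 17 (.lit 1)) Prog.discountExpr)) (s := s₃) (by decide)
    (by rw [c3 2 (by decide) (by decide)]; simp [b2, hP.ar2])
  have hfin : Prog.updateValues.exec s = (Prog.storeClip 8 (.reg 9)
    (.sub (.get 8 (.reg 9)) (.mul (.get 17 (.lit 1)) Prog.discountExpr))).exec s₃ := rfl
  have e8 : ∀ k : Fin n, s₃.arr 8 k = Function.update x.v i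
      (M.clip (x.v i - M.α T * ((1 - M.γ) * M.q i / w - 1))) k := by
    intro k
    rw [c2, Function.update_apply, Function.update_apply]
    simp only [NExpr.eval, b1, h7, Fin.val_inj]
    split_ifs
    · rfl
    · simp [b2, hR.ar8]
  rw [hfin]
  refine ⟨d1.trans (c1.trans b1), fun b h1 h2 => ?_, fun k => ?_, ?_⟩
  · rw [d3 b h1 h2, c3 b h1 h2, b2, Function.update_of_ne h2]
  · have e9 : (NExpr.reg 9).eval s₃ = j := by rw [NExpr.eval, c1, b1, h9]
    rw [d2, e9, primalUpdate]
    by_cases hk : k = j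
    · rw [hk, Function.update_self, Function.update_self, ← hw, ← e8]
      simp [NExpr.eval, RExpr.eval, c1, b1, h9, Prog.discountExpr,
        c3 17 (by decide) (by decide), c3 2 (by decide) (by decide), b2, hP.ar17α, hP.ar2]
    · rw [Function.update_of_ne hk, Function.update_of_ne (Fin.val_ne_of_ne hk), e8, hw]
  · rw [d4 2 (by decide), c4 2 (by decide), b2]
    simp

end DMDP

/-! ### Invariance of the memory representation. -/

namespace DMDP

variable {n m : ℕ} (M : DMDP n m)

/-- Multiplying one leaf by `E` multiplies the row sum by `1 + π i a * (E - 1)`, which is the update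
factor of `ξ i`; this preserves the proportionality of `S` and `ξ`. In `avg`, the quantity `ar 10 i
+ t / S i` is the sum over past iterations of the reciprocal row sums. The choice of `H` adds `1 / S
i` to it in the current row, and every other row gains its own `1 / S k` with no change in memory.
When a weight changes, array `9` absorbs the old weight minus the new one, times that sum, so
accumulated probabilities are preserved. -/
theorem represents_update [NeZero n] {T t : ℕ} {x : Iterate n m} {h : Fin t → Policy n m}
    {S : Fin n → ℝ} {Z : ℝ} {nr nr' : ℕ → ℕ} {ar ar' : ℕ → ℕ → ℝ} (hR : Represents x h S Z nr ar)
    {i : Fin n} {a : Fin m} {j : Fin n} {E S' H A : ℝ}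
    (hE : E = Real.exp (M.dualStep T x i a j)) (hS' : S' = S i * (1 + x.π i a * (E - 1)))
    (h6 : nr' 6 = t + 1)
    (a6 : IsTree (ar' 6) (2 * m * i) m
      (Function.update (zeroExtend fun a => S i * x.π i a) a (S i * x.π i a * E)))
    (a6' : ∀ k, (k ≤ 2 * m * i ∨ 2 * m * i + 2 * m ≤ k) → ar' 6 k = ar 6 k)
    (a7 : IsTree (ar' 7) 0 n (Function.update (zeroExtend S) i S'))
    (a8 : ∀ k : Fin n, ar' 8 k = M.primalUpdate T x i j k)
    (a9 : ar' 9 = Function.update (ar 9) (pairIdx i a) A)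
    (a10 : ar' 10 = Function.update (ar 10) i H)
    (hA : A = ar 9 (pairIdx i a) + (S i * x.π i a - S i * x.π i a * E) * (ar 10 i + (t + 1) / S i))
    (hH : H = ar 10 i + (t + 1) / S i - (t + 1) / S') :
    Represents (M.update T x i a j) (Fin.snoc h x.π : Fin (t + 1) → Policy n m)
      (Function.update S i S') (Z * (1 + x.ξ i * (1 + x.π i a * (E - 1) - 1))) nr' ar' := by
  have hEpos : 0 < E := hE ▸ Real.exp_pos _
  have hc : 0 < 1 + x.π i a * (E - 1) := scale_sum_pos (x.π i) a hEpos
  have hS'pos : 0 < S' := hS' ▸ mul_pos (hR.S_pos i) hc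
  have hξ : 0 < 1 + x.ξ i * (1 + x.π i a * (E - 1) - 1) := scale_sum_pos x.ξ i hc
  have hπ : ∀ b, S' * (M.update T x i a j).π i b =
      if b = a then S i * x.π i a * E else S i * x.π i b := by
    intro b
    have e : (M.update T x i a j).π i b =
        (if b = a then x.π i a * E else x.π i b) / (1 + x.π i a * (E - 1)) := by
      rw [update, hE]
      dsimp only
      rw [Function.update_self, scaleAt_apply]
    rw [e, hS', mul_assoc, mul_div_cancel₀ _ hc.ne', mul_ite, mul_assoc]
  have hπ' : ∀ k ≠ i, (M.update T x i a j).π k = x.π k := fun k hk => by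
    rw [update]
    exact Function.update_of_ne hk _ _
  refine ⟨fun k => ?_, mul_pos hR.Z_pos hξ, h6, fun k => ?_, ?_, fun k => ?_, a8, fun k b => ?_⟩
  · by_cases hk : k = i
    · rw [hk, Function.update_self]
      exact hS'pos
    · rw [Function.update_of_ne hk]
      exact hR.S_pos k
  · by_cases hk : k = i
    · subst hk
      refine a6.congr_weights fun b hb => ?_
      rw [zeroExtend_of_lt _ hb, Function.update_self, hπ, Function.update_apply]
      simp only [Fin.ext_iff]
      split_ifs
      · rfl
      · rw [zeroExtend_of_lt _ hb]
    · rw [hπ' k hk, Function.update_of_ne hk]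
      refine (hR.ar6 k).congr fun l h1 h2 => a6' l ?_
      rcases Nat.lt_or_gt_of_ne (Fin.val_ne_of_ne hk) with h3 | h3
      · left
        have : m * (k + 1) ≤ m * i := Nat.mul_le_mul_left m h3
        nlinarith
      · have : m * (i + 1) ≤ m * k := Nat.mul_le_mul_left m h3
        right
        nlinarith
  · refine a7.congr_weights fun k hk => ?_
    rw [Function.update_apply, zeroExtend_of_lt _ hk, zeroExtend_of_lt _ hk, Function.update_apply]
    simp only [Fin.ext_iff]
  · have e : (M.update T x i a j).ξ k = (if k = i then x.ξ i * (1 + x.π i a * (E - 1)) else x.ξ k) /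
        (1 + x.ξ i * (1 + x.π i a * (E - 1) - 1)) := by
      rw [update, hE]
      dsimp only
      rw [scaleAt_apply]
    rw [e, mul_assoc, mul_div_cancel₀ _ hξ.ne']
    by_cases hk : k = i
    · rw [hk, Function.update_self, if_pos rfl, hS', hR.S_eq, mul_assoc]
    · rw [Function.update_of_ne hk, if_neg hk, hR.S_eq]
  · rw [Fin.sum_univ_castSucc]
    simp only [Fin.snoc_castSucc, Fin.snoc_last]
    rw [hR.avg k b, a9, a10]
    have hSi := (hR.S_pos i).ne'
    push_cast
    by_cases hk : k = i
    · subst hk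
      simp only [Function.update_self, hπ]
      by_cases hb : b = a
      · subst hb
        rw [Function.update_self, if_pos rfl, hA, hH]
        field_simp
        ring
      · rw [Function.update_of_ne fun h => hb (pairIdx_inj h).2, if_neg hb, hH]
        field_simp
        ring
    · have hSk := (hR.S_pos k).ne'
      rw [Function.update_of_ne fun h => hk (pairIdx_inj h).1, Function.update_of_ne hk,
        Function.update_of_ne (Fin.val_ne_of_ne hk), hπ' k hk]
      field_simp
      ring

end DMDP

/-- The registers below `6` and all arrays not in `l` have the same contents in both states. -/
def MState.Keeps (l : List ℕ) (s s' : MState) : Prop :=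
  (∀ y < 6, s'.nreg y = s.nreg y) ∧ ∀ b ∉ l, s'.arr b = s.arr b

theorem MState.Keeps.trans {l : List ℕ} {s s' s'' : MState} (h : MState.Keeps l s s')
    (h' : MState.Keeps l s' s'') : MState.Keeps l s s'' :=
  ⟨fun y hy => (h'.1 y hy).trans (h.1 y hy), fun b hb => (h'.2 b hb).trans (h.2 b hb)⟩

theorem MState.Keeps.mono {l l' : List ℕ} {s s' : MState} (h : MState.Keeps l s s')
    (hl : l ⊆ l') : MState.Keeps l' s s' :=
  ⟨h.1, fun b hb => h.2 b fun hb' => hb (hl hb')⟩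

theorem Prog.keeps_exec {c : Prog} {l : List ℕ} (hr : ∀ y ∈ c.wregs, 6 ≤ y)
    (ha : ∀ b ∈ c.warrs, b ∈ l) (s : MState) : MState.Keeps l s (c.exec s) :=
  ⟨fun y hy => Prog.exec_nreg (fun h => absurd (hr y h) (not_le.mpr hy)) s,
    fun b hb => Prog.exec_arr (fun h => hb (ha b h)) s⟩

namespace Prog

theorem exec_updateLeaf (s : MState) {g E W A : ℝ} {o c i : ℕ}
    (ho : actionLeafExpr.eval s = o) (hc : pairExpr.eval s = c) (hi : s.nreg 7 = i)
    (hE : s.arr 15 2 = E) (hW : s.arr 6 o = W) (hA : s.arr 9 c = A)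
    (hg : s.arr 10 i + weightedTimeExpr.eval s = g) :
    (updateLeaf.exec s).nreg = Function.update (Function.update s.nreg 10
      (2 * s.nreg 1 * s.nreg 7)) 12 (s.nreg 1 + s.nreg 8) ∧
    (updateLeaf.exec s).arr 6 = Function.update (s.arr 6) o (W * E) ∧
    (updateLeaf.exec s).arr 9 = Function.update (s.arr 9) c (A + (W - W * E) * g) ∧
    (updateLeaf.exec s).arr 15 4 = g := by
  set s₁ := (setR 15 (.lit 4) (.add (.get 10 (.reg 7)) weightedTimeExpr)).exec s with hs₁
  have a1 : s₁.nreg = s.nreg := rfl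
  have a2 : s₁.arr = Function.update s.arr 15 (Function.update (s.arr 15) 4 g) := by
    rw [hs₁, exec_setR_arr, ← hg, ← hi]
    rfl
  have ao : actionLeafExpr.eval s₁ = o := (actionLeafExpr.eval_of_nreg_eq a1).trans ho
  have ac : pairExpr.eval s₁ = c := (pairExpr.eval_of_nreg_eq a1).trans hc
  set s₂ := (setR 9 pairExpr (.add (.get 9 pairExpr)
    (.mul (.sub (.get 6 actionLeafExpr) (.mul (.get 6 actionLeafExpr) (.get 15 (.lit 2))))
      (.get 15 (.lit 4))))).exec s₁ with hs₂
  have b1 : s₂.nreg = s.nreg := rfl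
  have b2 : s₂.arr = Function.update s₁.arr 9
      (Function.update (s₁.arr 9) c (A + (W - W * E) * g)) := by
    rw [hs₂, exec_setR_arr]
    simp [RExpr.eval, NExpr.eval, ao, ac, a2, hA, hW, hE]
  have bo : actionLeafExpr.eval s₂ = o := (actionLeafExpr.eval_of_nreg_eq b1).trans ho
  set s₃ := (setR 6 actionLeafExpr (.mul (.get 6 actionLeafExpr) (.get 15 (.lit 2)))).exec s₂
    with hs₃
  have c1 : s₃.nreg = s.nreg := rfl
  have c2 : s₃.arr = Function.update s₂.arr 6 (Function.update (s₂.arr 6) o (W * E)) := by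
    rw [hs₃, exec_setR_arr]
    simp [RExpr.eval, NExpr.eval, bo, b2, a2, hW, hE]
  have hn : (updateLeaf.exec s).nreg = Function.update (Function.update s₃.nreg 10
      (2 * s.nreg 1 * s.nreg 7)) 12 (s.nreg 1 + s.nreg 8) := rfl
  have ha : (updateLeaf.exec s).arr = s₃.arr := rfl
  rw [hn, ha, c2, b2, a2, c1]
  simp

theorem exec_updateRow (s : MState) {g S' : ℝ} {o i n : ℕ} (hi : s.nreg 7 = i) (hn : s.nreg 0 = n)
    (ho : s.nreg 10 = o) (hS : s.arr 6 (o + 1) = S') (hg : s.arr 15 4 = g) :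
    (updateRow.exec s).nreg = Function.update (Function.update s.nreg 10 0) 12 (n + i) ∧
    (updateRow.exec s).arr 7 = Function.update (s.arr 7) (n + i) S' ∧
    (updateRow.exec s).arr 10 = Function.update (s.arr 10) i (g - ((s.nreg 6 : ℝ) + 1) / S') := by
  subst hi hn ho hS hg
  simp [updateRow, exec_seq, exec_setR_arr, exec_setR_nreg, exec_setN_nreg, exec_setN_arr,
    RExpr.eval, NExpr.eval, stateLeafExpr, weightedTimeExpr]

end Prog

namespace DMDP

variable {n m : ℕ} {M : DMDP n m} [NeZero n] [NeZero m]

theorem exec_updateAll {T L t : ℕ} {x : Iterate n m} {h : Fin t → Policy n m}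
    {S : Fin n → ℝ} {Z : ℝ} {s : MState} (hP : M.Prepared T L s.nreg s.arr)
    (hR : Represents x h S Z s.nreg s.arr) {i : Fin n} {a : Fin m} {j : Fin n}
    (h7 : s.nreg 7 = i) (h8 : s.nreg 8 = a) (h9 : s.nreg 9 = j) :
    ∃ S' Z', Represents (M.update T x i a j) (Fin.snoc h x.π : Fin (t + 1) → Policy n m) S' Z'
      (Prog.updateAll.exec s).nreg (Prog.updateAll.exec s).arr := by
  have hn0 := Nat.pos_of_ne_zero (NeZero.ne n)
  have hm0 := Nat.pos_of_ne_zero (NeZero.ne m)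
  set E := Real.exp (M.dualStep T x i a j) with hE
  obtain ⟨v1, v2, v3, v4⟩ := exec_updateValues hP hR h7 h8 h9
  set s₁ := Prog.updateValues.exec s with hs₁
  have eS : s.arr 7 (n + i) = S i := by
    have := hR.ar7.leaf i i.2
    rwa [zero_add, zeroExtend_apply] at this
  obtain ⟨l1, l2, l3, l4⟩ := Prog.exec_updateLeaf s₁ (g := s.arr 10 i + (t + 1) / S i)
    (E := E) (W := S i * x.π i a) (A := s.arr 9 (pairIdx i a)) (o := 2 * m * i + m + a)
    (c := pairIdx i a) (i := i)
    (by simp [Prog.actionLeafExpr, NExpr.eval, v1, hP.nr1, h7, h8])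
    (by simp [Prog.pairExpr, NExpr.eval, v1, hP.nr1, h7, h8, pairIdx])
    (by rw [v1, h7]) v4
    (by
      rw [v2 6 (by decide) (by decide)]
      have := (hR.ar6 i).leaf a a.2
      rwa [zeroExtend_apply] at this)
    (by rw [v2 9 (by decide) (by decide)])
    (by
      rw [v2 10 (by decide) (by decide)]
      simp [Prog.weightedTimeExpr, Prog.stateLeafExpr, RExpr.eval, NExpr.eval, v1, hP.nr0, h7,
        hR.nr6, v2 7 (by decide) (by decide), eS])
  set s₂ := Prog.updateLeaf.exec s₁ with hs₂
  obtain ⟨t1, t2⟩ := Prog.isTree_ascend (b := 6) (s := s₂) (L := L) (hR.ar6 i) a.2 hP.m_le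
    (by rw [l1]; simp [v1, hP.nr4]) (by rw [l1]; simp [v1, hP.nr1, h7])
    (by rw [l1]; simp [v1, hP.nr1, h8]) (l2.trans (by rw [v2 6 (by decide) (by decide)]))
  set s₃ := (Prog.ascend 6).exec s₂ with hs₃
  have m1 : ∀ y ≠ 12, s₃.nreg y = s₂.nreg y := fun y hy =>
    Prog.exec_nreg (by simp [Prog.ascend, Prog.sumChildren, Prog.wregs, hy]) s₂
  have m2 : ∀ b ≠ 6, s₃.arr b = s₂.arr b := fun b hb =>
    Prog.exec_arr (by simp [Prog.ascend, Prog.sumChildren, Prog.warrs, hb]) s₂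
  have m3 : ∀ y, y ≠ 10 → y ≠ 12 → s₃.nreg y = s.nreg y := fun y h1 h2 => by
    rw [m1 y h2, l1, Function.update_of_ne h2, Function.update_of_ne h1, v1]
  have l5 : ∀ b, b ≠ 6 → b ≠ 9 → b ≠ 15 → s₂.arr b = s₁.arr b := fun b h1 h2 h3 =>
    Prog.exec_arr (by simp [Prog.updateLeaf, Prog.warrs, h1, h2, h3]) s₁
  -- The new row sum is read off at the root of the repaired action tree, before being copied into
  -- the state tree.
  have hsum : s₃.arr 6 (2 * m * i + 1) = S i * (1 + x.π i a * (E - 1)) := by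
    have hs : ∑ b, Function.update (fun b => x.π i b) a (x.π i a * E) b =
        1 + x.π i a * (E - 1) := by
      have h := Finset.add_sum_erase _ (fun b => x.π i b) (Finset.mem_univ a)
      rw [simplex_sum] at h
      rw [Finset.sum_update_of_mem (Finset.mem_univ a), Finset.sdiff_singleton_eq_erase]
      linarith
    rw [t1.root_eq_sum hm0, Finset.sum_range, ← hs, Finset.mul_sum]
    refine Finset.sum_congr rfl fun b _ => ?_
    rw [Function.update_apply, Function.update_apply, zeroExtend_apply]
    simp only [Fin.val_inj]
    split_ifs
    · rw [mul_assoc]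
    · rfl
  obtain ⟨r1, r2, r3⟩ := Prog.exec_updateRow s₃ (i := i) (n := n) (o := 2 * m * i)
    (by rw [m3 7 (by decide) (by decide), h7]) (by rw [m3 0 (by decide) (by decide), hP.nr0])
    (by rw [m1 10 (by decide), l1]; simp [v1, hP.nr1, h7]) hsum
    (by rw [m2 15 (by decide), l4])
  rw [m3 6 (by decide) (by decide), hR.nr6] at r3
  rw [m2 7 (by decide), l5 7 (by decide) (by decide) (by decide), v2 7 (by decide) (by decide)]
    at r2
  rw [m2 10 (by decide), l5 10 (by decide) (by decide) (by decide),
    v2 10 (by decide) (by decide)] at r3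
  set s₄ := Prog.updateRow.exec s₃ with hs₄
  have r4 : ∀ b, b ≠ 7 → b ≠ 10 → s₄.arr b = s₃.arr b := fun b h1 h2 =>
    Prog.exec_arr (by simp [Prog.updateRow, Prog.warrs, h1, h2]) s₃
  obtain ⟨u1, -⟩ := Prog.isTree_ascend (b := 7) (s := s₄) (L := L) hR.ar7 i.2 hP.n_le
    (by rw [r1]; simp [m3 4 (by decide) (by decide), hP.nr4]) (by rw [r1]; simp)
    (by rw [r1]; simp) (by rw [r2, zero_add])
  set s₅ := (Prog.ascend 7).exec s₄ with hs₅
  have n1 : ∀ y ≠ 12, s₅.nreg y = s₄.nreg y := fun y hy =>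
    Prog.exec_nreg (by simp [Prog.ascend, Prog.sumChildren, Prog.wregs, hy]) s₄
  have n2 : ∀ b ≠ 7, s₅.arr b = s₄.arr b := fun b hb =>
    Prog.exec_arr (by simp [Prog.ascend, Prog.sumChildren, Prog.warrs, hb]) s₄
  have hfin : Prog.updateAll.exec s = (Prog.setN 6 (.add (.reg 6) (.lit 1))).exec s₅ := rfl
  rw [hfin, Prog.exec_setN_arr, Prog.exec_setN_nreg]
  refine ⟨_, _, M.represents_update hR hE rfl ?_ ?_ ?_ u1 ?_ ?_ ?_ rfl rfl⟩
  · rw [Function.update_self]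
    simp only [NExpr.eval]
    rw [n1 6 (by decide), r1, Function.update_of_ne (by decide), Function.update_of_ne (by decide),
      m3 6 (by decide) (by decide), hR.nr6]
  · rw [n2 6 (by decide), r4 6 (by decide) (by decide)]
    exact t1
  · intro k hk
    rw [n2 6 (by decide), r4 6 (by decide) (by decide), t2 k hk]
  · intro k
    rw [n2 8 (by decide), r4 8 (by decide) (by decide), m2 8 (by decide),
      l5 8 (by decide) (by decide) (by decide), v3]
  · rw [n2 9 (by decide), r4 9 (by decide) (by decide), m2 9 (by decide), l3,
      v2 9 (by decide) (by decide)]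
  · rw [n2 10 (by decide), r3]

theorem generates_iteration {T L t : ℕ} {x : Iterate n m} {h : Fin t → Policy n m} {s : MState}
    (hP : M.Prepared T L s.nreg s.arr) (hR : ∃ S Z, Represents x h S Z s.nreg s.arr) :
    Generates (Prog.seq Prog.sampleTriple Prog.updateAll).exec s
      ((M.iteration T x).map fun y => (y, (Fin.snoc h x.π : Fin (t + 1) → Policy n m)))
      (fun z s' => (∃ S Z, Represents z.1 z.2 S Z s'.nreg s'.arr) ∧
        MState.Keeps [6, 7, 8, 9, 10, 15] s s') := by
  obtain ⟨S, Z, hR⟩ := hR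
  rw [iteration_eq, PMF.map_comp]
  refine Generates.seq_map (by
    simp [Prog.NoDraw, Prog.updateAll, Prog.updateValues, Prog.storeClip, Prog.updateLeaf,
      Prog.updateRow, Prog.ascend, Prog.sumChildren]) _ (M.generates_sampleTriple hP hR) ?_
  rintro z s' ⟨h1, h2, h3, h4, h5⟩
  have hP' : M.Prepared T L s'.nreg s'.arr :=
    hP.congr (fun y hy => h1 y (by omega)) fun b _ => by rw [h5]
  have hR' : Represents x h S Z s'.nreg s'.arr := by
    rw [h5]
    exact ⟨hR.S_pos, hR.Z_pos, (h1 6 (by omega)).trans hR.nr6, hR.ar6, hR.ar7, hR.S_eq, hR.ar8,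
      hR.avg⟩
  have hk : MState.Keeps [6, 7, 8, 9, 10, 15] s s' := ⟨fun y hy => h1 y (by omega), fun b _ => by
    rw [h5]⟩
  exact ⟨exec_updateAll hP' hR' h2 h3 h4, hk.trans (Prog.keeps_exec (by decide) (by decide) s')⟩

end DMDP

/-! ## A run of the primal-dual method as a program -/

/-- The table of a function of state-action pairs. -/
def pairTable {n m : ℕ} (g : Fin n → Fin m → ℝ) : ℕ → ℝ :=
  zeroExtend fun c : Fin (n * m) => g (finProdFinEquiv.symm c).1 (finProdFinEquiv.symm c).2

theorem pairTable_apply {n m : ℕ} (g : Fin n → Fin m → ℝ) (i : Fin n) (a : Fin m) :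
    pairTable g (pairIdx i a) = g i a := by
  have e : (⟨pairIdx i a, pairIdx_lt i a⟩ : Fin (n * m)) = finProdFinEquiv (i, a) :=
    Fin.ext (by simp [finProdFinEquiv, pairIdx])
  rw [pairTable, zeroExtend_of_lt _ (pairIdx_lt i a), e, Equiv.symm_apply_apply]

theorem exists_pairIdx {n m c : ℕ} (h : c < n * m) :
    ∃ (i : Fin n) (a : Fin m), pairIdx i a = c := by
  refine ⟨(finProdFinEquiv.symm ⟨c, h⟩).1, (finProdFinEquiv.symm ⟨c, h⟩).2, ?_⟩
  have e := congrArg Fin.val (finProdFinEquiv.apply_symm_apply (⟨c, h⟩ : Fin (n * m)))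
  simpa [finProdFinEquiv, pairIdx] using e

theorem pairIdx_div {n m : ℕ} (i : Fin n) (a : Fin m) : pairIdx i a / m = i := by
  have hm : 0 < m := Nat.zero_lt_of_lt a.2
  rw [pairIdx, Nat.add_mul_div_left _ _ hm, Nat.div_eq_of_lt a.2, zero_add]

namespace Prog

/-- Build a sum tree in the array `b` for every value of register `13` below `e`. The number of
leaves is in register `y`, and the leaf weights are given by `f`, with the number of the leaf in
register `11`. -/
def buildForest (y : ℕ) (e : NExpr) (b : ℕ) (f : RExpr) : Prog :=
  forN 13 e (seq (setN 10 (.mul (.mul (.lit 2) (.reg y)) (.reg 13)))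
    (seq (tabLoop 11 (.reg y) b (.add (.add (.reg 10) (.reg y)) (.reg 11)) f) (buildTree y b)))

theorem isTree_buildForest {y b W N : ℕ} {e : NExpr} {f : RExpr} {s : MState} (F : ℕ → ℕ → ℝ)
    (hy : y < 10) (he : 13 ∉ e.regs) (hN : e.eval s = N) (hW : s.nreg y = W) (hWpos : 0 < W)
    (hf : ∀ c < N, ∀ k < W, ∀ s' : MState, s'.nreg 13 = c → s'.nreg 11 = k →
      (∀ z < 10, s'.nreg z = s.nreg z) → (∀ b' ≠ b, s'.arr b' = s.arr b') → f.eval s' = F c k) :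
    ∀ c < N, IsTree (((buildForest y e b f).exec s).arr b) (2 * W * c) W (F c) := by
  refine (forN_inv (s := s) (N := N)
    (fun t nr ar => (∀ z < 10, nr z = s.nreg z) ∧ (∀ b' ≠ b, ar b' = s.arr b') ∧
      ∀ c < t, IsTree (ar b) (2 * W * c) W (F c)) ?_ he hN ?_ ?_).1.2.2
  · simp [wregs, tabLoop, forN, buildTree, sumChildren]
  · refine ⟨fun z hz => Function.update_of_ne (by omega) _ _, fun b' _ => rfl, fun c hc => ?_⟩
    omega
  · rintro t ht s₁ h13 ⟨h1, h2, h3⟩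
    set s₂ := (setN 10 (.mul (.mul (.lit 2) (.reg y)) (.reg 13))).exec s₁ with hs₂
    have a1 : s₂.nreg = Function.update s₁.nreg 10 (2 * W * t) := by
      rw [hs₂, exec_setN_nreg]
      simp [NExpr.eval, h13, h1 y hy, hW]
    have a2 : s₂.arr = s₁.arr := rfl
    have a3 : s₂.nreg y = W := by rw [a1, Function.update_of_ne (by omega), h1 y hy, hW]
    obtain ⟨b1, b2⟩ := exec_tabLoop (x := 11) (e := .reg y) (b := b)
      (i := .add (.add (.reg 10) (.reg y)) (.reg 11)) (f := f) (s := s₂) (N := W)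
      (2 * W * t + W) (F t) (by simp [NExpr.regs]; omega) a3
      (fun k hk s' h => by
        simp only [NExpr.eval, h, Function.update_self]
        rw [Function.update_of_ne (by decide), Function.update_of_ne (by omega), a3, a1,
          Function.update_self])
      (fun k hk s' h h' => hf t ht k hk s' (by rw [h, a1]; simpa using h13) (by rw [h]; simp)
        (fun z hz => by
          rw [h, a1, Function.update_of_ne (by omega), Function.update_of_ne (by omega), h1 z hz])
        fun b' hb' => by rw [h' b' hb', a2, h2 b' hb'])
    set s₃ := (tabLoop 11 (.reg y) b (.add (.add (.reg 10) (.reg y)) (.reg 11)) f).exec s₂ with hs₃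
    obtain ⟨c1, c2⟩ := isTree_buildTree (x := y) (b := b) (o := 2 * W * t) (w := F t) (s := s₃)
      (by omega) hWpos (by rw [b1, a1]; simp)
      (by rw [b1, Function.update_of_ne (by omega), a3]) (fun k hk => by
        rw [b2, Function.update_self, if_pos ⟨by omega, by omega⟩]
        congr 1
        omega)
    have hfin : (seq (setN 10 (.mul (.mul (.lit 2) (.reg y)) (.reg 13)))
      (seq (tabLoop 11 (.reg y) b (.add (.add (.reg 10) (.reg y)) (.reg 11)) f)
        (buildTree y b))).exec s₁ = (buildTree y b).exec s₃ := rfl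
    rw [hfin]
    have d2 : ∀ b' ≠ b, ((buildTree y b).exec s₃).arr b' = s₃.arr b' := fun b' hb' =>
      exec_arr (by simp [buildTree, sumChildren, warrs, hb']) s₃
    refine ⟨fun z hz => ?_, fun b' hb' => ?_, fun c hc => ?_⟩
    · rw [Function.update_of_ne (by omega),
        exec_nreg (by simp [buildTree, sumChildren, wregs]; omega), b1,
        Function.update_of_ne (by omega), a1, Function.update_of_ne (by omega), h1 z hz]
    · rw [d2 b' hb', b2, Function.update_of_ne hb', a2, h2 b' hb']
    · rcases Nat.lt_succ_iff_lt_or_eq.mp hc with hc | rfl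
      · refine (h3 c hc).congr fun k k1 k2 => ?_
        -- Different trees occupy disjoint blocks of length `2 W`, so the trees already built are
        -- left intact.
        have h5 : W * (c + 1) ≤ W * t := Nat.mul_le_mul_left W hc
        have h6 : k < 2 * W * t := by nlinarith
        rw [c2 k (Or.inl h6.le), b2, Function.update_self, if_neg (by omega), a2]
      · exact c1

/-- Set up the memory for a run of the primal-dual method. -/
def initRun : Prog :=
  seq (tabLoop 11 (.reg 0) 8 (.reg 11) (.cast (.lit 0)))
  (seq (tabLoop 11 (.reg 0) 10 (.reg 11) (.cast (.lit 0)))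
  (seq (tabLoop 11 (.mul (.reg 0) (.reg 1)) 9 (.reg 11) (.cast (.lit 0)))
  (seq (buildForest 1 (.reg 0) 6 (.cast (.lit 1)))
  (seq (tabLoop 11 (.reg 0) 7 (.add (.reg 0) (.reg 11)) (.cast (.reg 1)))
  (seq (setN 10 (.lit 0)) (seq (buildTree 0 7) (setN 6 (.lit 0))))))))

/-- The probability of the state-action pair in register `11` under the average policy. -/
def averageExpr : RExpr :=
    (.mul (.div (.cast (.lit 1)) (.cast (.reg 2))) (.add (.get 9 (.reg 11))
      (.mul (.get 6 (.add (.add (.mul (.mul (.lit 2) (.reg 1)) (.div (.reg 11) (.reg 1))) (.reg 1))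
          (.sub (.reg 11) (.mul (.reg 1) (.div (.reg 11) (.reg 1))))))
        (.add (.get 10 (.div (.reg 11) (.reg 1)))
          (.div (.cast (.reg 2)) (.get 7 (.add (.reg 0) (.div (.reg 11) (.reg 1)))))))))

/-- Store the average policy in the array `18`. -/
def storeAverage : Prog := tabLoop 11 (.mul (.reg 0) (.reg 1)) 18 (.reg 11) averageExpr

/-- One run of the primal-dual method; the output policy is stored in the array `18`. -/
def runMethod : Prog :=
  seq initRun (seq (loop (.reg 2) (seq sampleTriple updateAll)) storeAverage)

end Prog

namespace DMDP

variable {n m : ℕ} {M : DMDP n m}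

theorem exec_storeAverage {T L : ℕ} [NeZero T] {x : Iterate n m} {h : Fin T → Policy n m}
    {S : Fin n → ℝ} {Z : ℝ} {s : MState} (hP : M.Prepared T L s.nreg s.arr)
    (hR : Represents x h S Z s.nreg s.arr) (i : Fin n) (a : Fin m) :
    (Prog.storeAverage.exec s).arr 18 (pairIdx i a) = avgPolicy h i a := by
  have hf : ∀ c < n * m, ∀ s' : MState, s'.nreg = Function.update s.nreg 11 c →
      (∀ b' ≠ 18, s'.arr b' = s.arr b') →
      Prog.averageExpr.eval s' = pairTable (fun i a => avgPolicy h i a) c := by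
    intro c hc s' h1 h2
    obtain ⟨k, b, rfl⟩ := exists_pairIdx hc
    have e7 : s.arr 7 (n + k) = S k := by
      have := hR.ar7.leaf k k.2
      rwa [zero_add, zeroExtend_apply] at this
    have e6 : s.arr 6 (2 * m * k + m + b) = S k * x.π k b := by
      have := (hR.ar6 k).leaf b b.2
      rwa [zeroExtend_apply] at this
    have e : pairIdx k b - m * k = b := Nat.add_sub_cancel _ _
    rw [pairTable_apply]
    change _ = 1 / (T : ℝ) * ∑ t, h t k b
    rw [hR.avg k b]
    simp [Prog.averageExpr, RExpr.eval, NExpr.eval, h1, h2, hP.nr0, hP.nr1, hP.nr2, pairIdx_div, e, e6, e7]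
  obtain ⟨-, h2⟩ := Prog.exec_tabLoop (x := 11) (e := .mul (.reg 0) (.reg 1)) (b := 18)
    (i := .reg 11) (s := s) (N := n * m) 0 (pairTable fun i a => avgPolicy h i a) (by decide)
    (by simp [NExpr.eval, hP.nr0, hP.nr1]) (fun t _ s' h => by simp [NExpr.eval, h]) hf
  rw [Prog.storeAverage, h2, Function.update_self,
    if_pos ⟨zero_le, by simpa using pairIdx_lt i a⟩, Nat.sub_zero, pairTable_apply]

variable [NeZero n] [NeZero m]

/-- All weights start at `1`: the row sums are `m`, the total is `n m`, and every normalized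
distribution is uniform. -/
theorem exec_initRun {T L : ℕ} {s : MState} (hP : M.Prepared T L s.nreg s.arr) :
    Represents M.initIterate (Fin.elim0 : Fin 0 → Policy n m) (fun _ => (m : ℝ)) (n * m)
      (Prog.initRun.exec s).nreg (Prog.initRun.exec s).arr := by
  have hn0 := Nat.pos_of_ne_zero (NeZero.ne n)
  have hm0 := Nat.pos_of_ne_zero (NeZero.ne m)
  have hnr : (n : ℝ) ≠ 0 := Nat.cast_ne_zero.mpr (NeZero.ne n)
  have hmr : (m : ℝ) ≠ 0 := Nat.cast_ne_zero.mpr (NeZero.ne m)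
  obtain ⟨a1, a2⟩ := Prog.exec_tabLoop (x := 11) (e := .reg 0) (b := 8) (i := .reg 11)
    (f := .cast (.lit 0)) (s := s) (N := n) 0 (fun _ => 0) (by decide) hP.nr0
    (fun t _ s' h => by simp [NExpr.eval, h])
    (fun t _ s' _ _ => by simp [RExpr.eval, NExpr.eval])
  set s₁ := (Prog.tabLoop 11 (.reg 0) 8 (.reg 11) (.cast (.lit 0))).exec s with hs₁
  obtain ⟨b1, b2⟩ := Prog.exec_tabLoop (x := 11) (e := .reg 0) (b := 10) (i := .reg 11)
    (f := .cast (.lit 0)) (s := s₁) (N := n) 0 (fun _ => 0) (by decide)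
    (by simp [NExpr.eval, a1, hP.nr0])
    (fun t _ s' h => by simp [NExpr.eval, h])
    (fun t _ s' _ _ => by simp [RExpr.eval, NExpr.eval])
  set s₂ := (Prog.tabLoop 11 (.reg 0) 10 (.reg 11) (.cast (.lit 0))).exec s₁ with hs₂
  obtain ⟨c1, c2⟩ := Prog.exec_tabLoop (x := 11) (e := .mul (.reg 0) (.reg 1)) (b := 9)
    (i := .reg 11) (f := .cast (.lit 0)) (s := s₂) (N := n * m) 0 (fun _ => 0) (by decide)
    (by simp [NExpr.eval, a1, b1, hP.nr0, hP.nr1])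
    (fun t _ s' h => by simp [NExpr.eval, h])
    (fun t _ s' _ _ => by simp [RExpr.eval, NExpr.eval])
  set s₃ := (Prog.tabLoop 11 (.mul (.reg 0) (.reg 1)) 9 (.reg 11) (.cast (.lit 0))).exec s₂ with hs₃
  have c3 : ∀ y < 6, s₃.nreg y = s.nreg y := fun y hy => by
    rw [c1, b1, a1]
    simp [show y ≠ 11 by omega]
  have d := Prog.isTree_buildForest (y := 1) (b := 6) (e := .reg 0) (f := .cast (.lit 1)) (s := s₃)
    (N := n) (W := m) (fun _ _ => 1) (by decide) (by decide)
    (by rw [NExpr.eval, c3 0 (by decide), hP.nr0]) (by rw [c3 1 (by decide), hP.nr1]) hm0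
    (fun _ _ _ _ s' _ _ _ _ => by simp [RExpr.eval, NExpr.eval])
  set s₄ := (Prog.buildForest 1 (.reg 0) 6 (.cast (.lit 1))).exec s₃ with hs₄
  have d1 : ∀ y < 6, s₄.nreg y = s.nreg y := fun y hy =>
    ((Prog.keeps_exec (l := [6]) (by decide) (by decide) s₃).1 y hy).trans (c3 y hy)
  have d2 : ∀ b ≠ 6, s₄.arr b = s₃.arr b := fun b hb =>
    (Prog.keeps_exec (l := [6]) (by decide) (by decide) s₃).2 b (by simpa using hb)
  obtain ⟨e1, e2⟩ := Prog.exec_tabLoop (x := 11) (e := .reg 0) (b := 7)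
    (i := .add (.reg 0) (.reg 11)) (f := .cast (.reg 1)) (s := s₄) (N := n) n (fun _ => m)
    (by decide) (by rw [NExpr.eval, d1 0 (by decide), hP.nr0])
    (fun t _ s' h => by simp [NExpr.eval, h, d1 0, hP.nr0])
    (fun t _ s' h _ => by simp [RExpr.eval, NExpr.eval, h, d1 1, hP.nr1])
  set s₅ := (Prog.tabLoop 11 (.reg 0) 7 (.add (.reg 0) (.reg 11)) (.cast (.reg 1))).exec s₄ with hs₅
  set s₆ := (Prog.setN 10 (.lit 0)).exec s₅ with hs₆
  have f1 : s₆.nreg = Function.update s₅.nreg 10 0 := rfl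
  have f2 : s₆.arr = s₅.arr := rfl
  obtain ⟨g1, -⟩ := Prog.isTree_buildTree (x := 0) (b := 7) (o := 0) (N := n) (w := fun _ => m)
    (s := s₆) (by decide) hn0 (by rw [f1]; simp)
    (by rw [f1, e1]; simp [d1 0, hP.nr0]) (fun k hk => by
      rw [f2, e2, Function.update_self, if_pos (by omega)])
  set s₇ := (Prog.buildTree 0 7).exec s₆ with hs₇
  have g2 : ∀ b ≠ 7, s₇.arr b = s₄.arr b := fun b hb => by
    refine ((Prog.keeps_exec (l := [7]) (by decide) (by decide) s₆).2 b (by simpa using hb)).trans ?_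
    rw [f2, e2, Function.update_of_ne hb]
  have hfin : Prog.initRun.exec s = (Prog.setN 6 (.lit 0)).exec s₇ := rfl
  rw [hfin, Prog.exec_setN_nreg, Prog.exec_setN_arr]
  refine ⟨fun i => Nat.cast_pos.mpr hm0, by positivity, rfl, fun i => ?_, ?_, fun i => ?_,
    fun i => ?_, fun i a => ?_⟩
  · rw [g2 6 (by decide)]
    refine (d i i.2).congr_weights fun k hk => ?_
    rw [zeroExtend_of_lt _ hk]
    exact (mul_one_div_cancel hmr).symm
  · exact g1.congr_weights fun k hk => (zeroExtend_of_lt (fun _ => (m : ℝ)) hk).symm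
  · change (m : ℝ) = n * m * (1 / n)
    field_simp
  · rw [g2 8 (by decide), d2 8 (by decide), c2, Function.update_of_ne (by decide), b2,
      Function.update_of_ne (by decide), a2, Function.update_self, if_pos (by simp)]
    rfl
  · rw [g2 9 (by decide), d2 9 (by decide), c2, Function.update_self,
      if_pos ⟨zero_le, by simpa using pairIdx_lt i a⟩, g2 10 (by decide), d2 10 (by decide), c2,
      Function.update_of_ne (by decide), b2, Function.update_self, if_pos (by simp)]
    simp

theorem generates_runMethod {T L : ℕ} [NeZero T] {s : MState} (hP : M.Prepared T L s.nreg s.arr) :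
    Generates Prog.runMethod.exec s (M.primalDual T) (fun π s' =>
      (∀ i a, s'.arr 18 (pairIdx i a) = π i a) ∧
        MState.Keeps [6, 7, 8, 9, 10, 15, 18] s s') := by
  have hk : MState.Keeps [6, 7, 8, 9, 10, 15] s (Prog.initRun.exec s) :=
    Prog.keeps_exec (by decide) (by decide) s
  have hPk : ∀ s', MState.Keeps [6, 7, 8, 9, 10, 15] s s' → M.Prepared T L s'.nreg s'.arr :=
    fun s' h => hP.congr (fun y hy => h.1 y (by omega)) fun b hb => h.2 b fun hb' => by
      revert hb hb'
      simp only [List.mem_cons, List.not_mem_nil, or_false]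
      omega
  rw [Prog.runMethod]
  refine Generates.det_seq (by
    simp [Prog.NoDraw, Prog.initRun, Prog.tabLoop, Prog.forN, Prog.buildForest, Prog.buildTree,
      Prog.sumChildren]) ?_
  have h0 := exec_initRun hP
  generalize Prog.initRun.exec s = s₁ at hk h0 ⊢
  have hloop := Generates.loop (E := fun t => Iterate n m × (Fin t → Policy n m)) (e := .reg 2)
    (c := .seq Prog.sampleTriple Prog.updateAll) (s := s₁) (ρ := M.runPMF T)
    (κ := fun t x => (M.iteration T x.1).map fun y =>
      (y, (Fin.snoc x.2 x.1.π : Fin (t + 1) → Policy n m)))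
    (I := fun t z s' => (∃ S Z, Represents z.1 z.2 S Z s'.nreg s'.arr) ∧
      MState.Keeps [6, 7, 8, 9, 10, 15] s s') (N := T) (hPk _ hk).nr2 rfl
    ⟨⟨_, _, h0⟩, hk⟩ (fun t => rfl) fun t _ z s' h =>
      (generates_iteration (s := s'.tick 1) (hPk _ h.2) h.1).mono
        fun y s'' h' => ⟨h'.1, h.2.trans h'.2⟩
  rw [primalDual]
  refine Generates.seq_map (by simp [Prog.NoDraw, Prog.storeAverage, Prog.tabLoop, Prog.forN]) _
    hloop ?_
  rintro z s' ⟨⟨S, Z, h1⟩, h2⟩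
  have h3 : MState.Keeps [6, 7, 8, 9, 10, 15, 18] s' (Prog.storeAverage.exec s') :=
    Prog.keeps_exec (by decide) (by decide) s'
  exact ⟨exec_storeAverage (hPk _ h2) h1, (h2.mono (by decide)).trans h3⟩

end DMDP

/-! ## Value iteration -/

namespace DMDP

variable {n m : ℕ} (M : DMDP n m)

/-- The value iteration for `π`, started at `0`. -/
def valueIter (π : Policy n m) : ℕ → Fin n → ℝ
  | 0 => 0
  | N + 1 => fun i => ∑ a, π i a * (M.meanReward i a + M.γ * M.meanNext (valueIter π N) i a)

/-- The error is contracted by `γ` in every step and keeps its sign because the iteration starts at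
`0`. The estimate therefore never exceeds the value, as the one-sided interval of an evaluator
requires. -/
theorem value_sub_valueIter_mem (π : Policy n m) (N : ℕ) (i : Fin n) :
    M.value π i - M.valueIter π N i ∈ Set.Icc 0 (M.γ ^ N / (1 - M.γ)) := by
  induction N generalizing i with
  | zero => simpa [valueIter] using M.value_mem π i
  | succ N ih =>
    have e : M.value π i - M.valueIter π (N + 1) i =
        ∑ a, π i a * (M.γ * ∑ j, M.p i a j * (M.value π j - M.valueIter π N j)) := by
      rw [M.value_bellman π i, valueIter, ← Finset.sum_sub_distrib]
      refine Finset.sum_congr rfl fun a _ => ?_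
      simp only [meanNext, mul_sub, Finset.sum_sub_distrib]
      ring
    rw [e]
    have hnn : ∀ a, 0 ≤ M.γ * ∑ j, M.p i a j * (M.value π j - M.valueIter π N j) := fun a =>
      mul_nonneg M.γ_nonneg (Finset.sum_nonneg fun j _ =>
        mul_nonneg (simplex_nonneg _ j) (ih j).1)
    refine ⟨Finset.sum_nonneg fun a _ => mul_nonneg (simplex_nonneg _ a) (hnn a), ?_⟩
    have hle : ∀ a, M.γ * ∑ j, M.p i a j * (M.value π j - M.valueIter π N j) ≤
        M.γ ^ (N + 1) / (1 - M.γ) := fun a => by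
      calc M.γ * ∑ j, M.p i a j * (M.value π j - M.valueIter π N j)
          ≤ M.γ * ∑ j, M.p i a j * (M.γ ^ N / (1 - M.γ)) :=
            mul_le_mul_of_nonneg_left (Finset.sum_le_sum fun j _ =>
              mul_le_mul_of_nonneg_left (ih j).2 (simplex_nonneg _ j)) M.γ_nonneg
        _ = M.γ ^ (N + 1) / (1 - M.γ) := by
            rw [← Finset.sum_mul, simplex_sum]
            ring
    calc ∑ a, π i a * (M.γ * ∑ j, M.p i a j * (M.value π j - M.valueIter π N j))
        ≤ ∑ a, π i a * (M.γ ^ (N + 1) / (1 - M.γ)) :=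
          Finset.sum_le_sum fun a _ => mul_le_mul_of_nonneg_left (hle a) (simplex_nonneg _ a)
      _ = M.γ ^ (N + 1) / (1 - M.γ) := by rw [← Finset.sum_mul, simplex_sum, one_mul]

theorem valueIter_nonneg (π : Policy n m) (N : ℕ) (i : Fin n) : 0 ≤ M.valueIter π N i := by
  induction N generalizing i with
  | zero => exact le_rfl
  | succ N ih =>
    refine Finset.sum_nonneg fun a _ => mul_nonneg (simplex_nonneg _ a) (add_nonneg ?_ ?_)
    · exact Finset.sum_nonneg fun j _ => mul_nonneg (simplex_nonneg _ j) (M.r_mem i a j).1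
    · exact mul_nonneg M.γ_nonneg (Finset.sum_nonneg fun j _ =>
        mul_nonneg (simplex_nonneg _ j) (ih j))

/-- The estimate of `qᵀ v^π` after `N` steps of value iteration. -/
def valueEstimate [NeZero n] (π : Policy n m) (N : ℕ) : ℝ := ∑ i, M.q i * M.valueIter π N i

theorem valueEstimate_nonneg [NeZero n] (π : Policy n m) (N : ℕ) : 0 ≤ M.valueEstimate π N :=
  Finset.sum_nonneg fun i _ => mul_nonneg (simplex_nonneg _ i) (M.valueIter_nonneg π N i)

theorem valueEstimate_mem [NeZero n] (π : Policy n m) (N : ℕ) :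
    M.valueEstimate π N ∈
      Set.Icc (M.weightedValue π - M.γ ^ N / (1 - M.γ)) (M.weightedValue π) := by
  have e : M.weightedValue π - M.valueEstimate π N =
      ∑ i, M.q i * (M.value π i - M.valueIter π N i) := by
    rw [weightedValue, valueEstimate, ← Finset.sum_sub_distrib]
    simp_rw [mul_sub]
  have h1 : 0 ≤ ∑ i, M.q i * (M.value π i - M.valueIter π N i) :=
    Finset.sum_nonneg fun i _ =>
      mul_nonneg (simplex_nonneg _ i) (M.value_sub_valueIter_mem π N i).1
  have h2 : ∑ i, M.q i * (M.value π i - M.valueIter π N i) ≤ M.γ ^ N / (1 - M.γ) := by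
    calc ∑ i, M.q i * (M.value π i - M.valueIter π N i)
        ≤ ∑ i, M.q i * (M.γ ^ N / (1 - M.γ)) := Finset.sum_le_sum fun i _ =>
          mul_le_mul_of_nonneg_left (M.value_sub_valueIter_mem π N i).2 (simplex_nonneg _ i)
      _ = M.γ ^ N / (1 - M.γ) := by rw [← Finset.sum_mul, simplex_sum, one_mul]
  constructor <;> linarith

/-- Value iteration is accurate after the number of steps that is spent on it. -/
theorem pow_div_le [NeZero n] [NeZero m] (hnm : 2 ≤ n * m) {ε : ℝ} (hε : ε ∈ Set.Ioo (0 : ℝ) 1)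
    {T : ℕ} (hT : 1000 * ((n : ℝ) ^ 3 * m * Real.log ((n : ℝ) * m) /
      ((1 - M.γ) ^ 6 * (ε / 2) ^ 2)) ≤ T) :
    M.γ ^ (T / (n * n * m) + 1) / (1 - M.γ) ≤ ε / 2 := by
  -- A sweep costs `O(n² m)`, so `N` sweeps cost `O(T + n² m)`. Since `T` is at least of order `n³ m
  -- / ((1 - γ)⁶ ε²)` when `n m ≥ 2`, this is still far more than accuracy demands.
  set N := T / (n * n * m) + 1 with hN
  set θ := 1 - M.γ with hθ
  have hθ0 : 0 < θ := M.one_sub_γ_pos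
  have hθ1 : θ ≤ 1 := by linarith [M.γ_nonneg]
  have hn : (1 : ℝ) ≤ n := Nat.one_le_cast.mpr (Nat.pos_of_ne_zero (NeZero.ne n))
  have hm : (1 : ℝ) ≤ m := Nat.one_le_cast.mpr (Nat.pos_of_ne_zero (NeZero.ne m))
  have hlog : 1 / 2 ≤ Real.log ((n : ℝ) * m) := by
    have := Real.log_two_gt_d9
    have h2 : Real.log 2 ≤ Real.log ((n : ℝ) * m) :=
      Real.log_le_log (by norm_num) (by exact_mod_cast hnm)
    linarith
  have hNT : (T : ℝ) ≤ N * (n * n * m) := by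
    have h := Nat.lt_div_mul_add (a := T) (b := n * n * m) (by
      have := Nat.pos_of_ne_zero (NeZero.ne n)
      have := Nat.pos_of_ne_zero (NeZero.ne m)
      positivity)
    have h' : T ≤ N * (n * n * m) := by
      rw [hN, add_mul, one_mul]
      exact h.le
    exact_mod_cast h'
  have hε0 := hε.1
  have hNlow : 2000 / (θ ^ 6 * ε ^ 2) ≤ N := by
    have hnnm : (0 : ℝ) < n * n * m := by positivity
    have h1 : 2000 / (θ ^ 6 * ε ^ 2) * (n * n * m) ≤ N * (n * n * m) := by
      refine le_trans ?_ (hT.trans hNT)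
      have e : 1000 * ((n : ℝ) ^ 3 * m * Real.log ((n : ℝ) * m) / (θ ^ 6 * (ε / 2) ^ 2)) =
          2000 / (θ ^ 6 * ε ^ 2) * (n * n * m) * (2 * n * Real.log ((n : ℝ) * m)) := by
        field_simp
        ring
      rw [e]
      refine le_mul_of_one_le_right (by positivity) ?_
      nlinarith
    exact le_of_mul_le_mul_right h1 hnnm
  have hN0 : (0 : ℝ) < N := lt_of_lt_of_le (by positivity) hNlow
  -- From `γ ≤ exp (-θ)` and `exp y ≥ y`. This crude decay suffices because `N` exceeds `2000 / (θ⁶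
  -- ε²)`.
  have hpow : M.γ ^ N ≤ 1 / (θ * N) := by
    have h1 : M.γ ≤ Real.exp (-θ) := by
      have := Real.add_one_le_exp (-θ)
      linarith
    calc M.γ ^ N ≤ Real.exp (-θ) ^ N := pow_le_pow_left₀ M.γ_nonneg h1 N
      _ = (Real.exp (θ * N))⁻¹ := by
          rw [← Real.exp_nat_mul, ← Real.exp_neg]
          ring_nf
      _ ≤ (θ * N)⁻¹ := by
          refine inv_anti₀ (by positivity) ?_
          linarith [Real.add_one_le_exp (θ * N)]
      _ = 1 / (θ * N) := (one_div _).symm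
  calc M.γ ^ N / θ ≤ 1 / (θ * N) / θ := by gcongr
    _ = 1 / (θ ^ 2 * N) := by
        field_simp
    _ ≤ 1 / (θ ^ 2 * (2000 / (θ ^ 6 * ε ^ 2))) := by gcongr
    _ = θ ^ 4 * ε ^ 2 / 2000 := by
        field_simp
    _ ≤ ε / 2 := by
        have h1 : θ ^ 4 ≤ 1 := pow_le_one₀ hθ0.le hθ1
        have h2 : ε ^ 2 ≤ ε := by nlinarith [hε.2]
        have : θ ^ 4 * ε ^ 2 ≤ 1 * ε := mul_le_mul h1 h2 (sq_nonneg ε) zero_le_one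
        linarith

end DMDP

/-! ### Deterministic evaluators, independent copies and the choice of the best run. -/

theorem PMF.ofReal_one_sub_le_toOuterMeasure_pure {A : Set ℝ} {y ρ : ℝ} (hρ : 0 ≤ ρ)
    (hy : y ∈ A) : ENNReal.ofReal (1 - ρ) ≤ (PMF.pure y).toOuterMeasure A := by
  rw [PMF.toOuterMeasure_pure_apply, if_pos hy, ← ENNReal.ofReal_one]
  exact ENNReal.ofReal_le_ofReal (by linarith)

theorem indepPMF_pure {E : Type} : ∀ {K : ℕ} (y : Fin K → E),
    indepPMF K (fun k => PMF.pure (y k)) = PMF.pure y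
  | 0, y => by rw [indepPMF, Subsingleton.elim y Fin.elim0]
  | K + 1, y => by
    rw [indepPMF, PMF.pure_bind, indepPMF_pure fun k => y k.succ, PMF.pure_map]
    congr 1
    exact Fin.cons_self_tail y

/-- The definition of `indepPMF` prepends a new draw while the loop of the program appends one; for
identical laws the two orders agree. -/
theorem indepPMF_succ_eq_snoc {E : Type} (μ : PMF E) : ∀ K : ℕ, indepPMF (K + 1) (fun _ => μ) =
    (indepPMF K fun _ => μ).bind fun h => μ.map fun x => (Fin.snoc h x : Fin (K + 1) → E)
  | 0 => by
    simp only [indepPMF, PMF.pure_map, PMF.pure_bind]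
    refine congrArg _ (funext fun x => congrArg _ ?_)
    ext k
    obtain rfl : k = 0 := Fin.ext (by omega)
    rfl
  | K + 1 => by
    conv_lhs => rw [indepPMF, indepPMF_succ_eq_snoc μ K]
    conv_rhs => rw [indepPMF, PMF.bind_bind]
    refine congrArg _ (funext fun x => ?_)
    rw [PMF.map_bind, PMF.bind_map]
    refine congrArg _ (funext fun h => ?_)
    rw [PMF.map_comp]
    refine congrArg (fun f => PMF.map f μ) (funext fun y => ?_)
    exact Fin.cons_snoc_eq_snoc_cons x h y

theorem DMDP.metaAlg_pure {n m : ℕ} (M : DMDP n m) [NeZero n] [NeZero m] (T K : ℕ) [NeZero T]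
    [NeZero K] (g : Policy n m → ℝ) : M.metaAlg T K (fun π => PMF.pure (g π)) =
      (indepPMF K fun _ => M.primalDual T).map fun π => π (argmaxIdx fun k => g (π k)) := by
  rw [metaAlg, PMF.map]
  refine congrArg _ (funext fun π => ?_)
  rw [indepPMF_pure fun k => g (π k), PMF.pure_map]
  rfl

theorem argmaxIdx_eq {K : ℕ} [NeZero K] {y : Fin K → ℝ} {k : Fin K} (h : ∀ l, y l ≤ y k)
    (h' : ∀ l < k, y l < y k) : argmaxIdx y = k := by
  refine le_antisymm ?_ ?_
  · exact Finset.min'_le _ _ (by simpa using h)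
  · refine not_lt.mp fun hlt => ?_
    have h1 := h' _ hlt
    exact absurd (le_argmaxIdx y k) (not_le.mpr h1)

/-! ## Policy evaluation as a program -/

namespace Prog

/-- Store the sums of the values of `f` over register `11`, up to register `y`, for all values of
register `13` below `e`. -/
def tabSum (b : ℕ) (e : NExpr) (y : ℕ) (f : RExpr) : Prog :=
  forN 13 e (sumLoop 11 (.reg y) b (.reg 13) f)

theorem exec_tabSum {b y W N : ℕ} {e : NExpr} {f : RExpr} {s : MState} (F : ℕ → ℕ → ℝ)
    (hy : y < 10) (he : 13 ∉ e.regs) (hN : e.eval s = N) (hW : s.nreg y = W)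
    (hf : ∀ c < N, ∀ k < W, ∀ s' : MState, s'.nreg 13 = c → s'.nreg 11 = k →
      (∀ z < 10, s'.nreg z = s.nreg z) → (∀ b' ≠ b, s'.arr b' = s.arr b') → f.eval s' = F c k) :
    ∀ c < N, ((tabSum b e y f).exec s).arr b c = ∑ k ∈ Finset.range W, F c k := by
  refine (forN_inv (s := s) (N := N)
    (fun t nr ar => (∀ z < 10, nr z = s.nreg z) ∧ (∀ b' ≠ b, ar b' = s.arr b') ∧
      ∀ c < t, ar b c = ∑ k ∈ Finset.range W, F c k) ?_ he hN ?_ ?_).1.2.2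
  · simp [wregs, sumLoop, forN]
  · refine ⟨fun z hz => Function.update_of_ne (by omega) _ _, fun b' _ => rfl, fun c hc => ?_⟩
    omega
  · rintro t ht s₁ h13 ⟨h1, h2, h3⟩
    obtain ⟨b1, b2⟩ := exec_sumLoop (x := 11) (e := .reg y) (b := b) (i := .reg 13) (f := f)
      (s := s₁) (N := W) (F t) (by simp [NExpr.regs]; omega) (by decide)
      (by rw [NExpr.eval, h1 y hy, hW])
      (fun k hk s' h h' => hf t ht k hk s' (by rw [h]; simpa using h13) (by rw [h]; simp)
        (fun z hz => by rw [h, Function.update_of_ne (by omega), h1 z hz])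
        fun b' hb' => by rw [h' b' hb', h2 b' hb'])
    rw [b1, b2]
    refine ⟨fun z hz => ?_, fun b' hb' => ?_, fun c hc => ?_⟩
    · rw [Function.update_of_ne (by omega), Function.update_of_ne (by omega), h1 z hz]
    · rw [Function.update_of_ne hb', h2 b' hb']
    · rw [Function.update_self]
      simp only [NExpr.eval, h13]
      rcases Nat.lt_succ_iff_lt_or_eq.mp hc with hc | rfl
      · rw [Function.update_of_ne hc.ne, h3 c hc]
      · rw [Function.update_self]

/-- The number of state-action pairs. -/
def pairCountExpr : NExpr := .mul (.reg 0) (.reg 1)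

/-- The index of the transition from the pair in register `13` to the state in register `11`. -/
def transitionExpr : NExpr := .add (.reg 11) (.mul (.reg 0) (.reg 13))

/-- Tabulate the expected rewards of the state-action pairs. -/
def tabMeanReward : Prog :=
  tabSum 19 pairCountExpr 0 (.mul (.get 0 transitionExpr) (.get 1 transitionExpr))

/-- One step of value iteration for the policy in the array `18`; the values are in the
array `13`. -/
def sweep : Prog :=
  seq (tabSum 21 pairCountExpr 0 (.mul (.get 0 transitionExpr) (.get 13 (.reg 11))))
    (tabSum 13 (.reg 0) 1 (.mul (.get 18 (.add (.reg 11) (.mul (.reg 1) (.reg 13))))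
      (.add (.get 19 (.add (.reg 11) (.mul (.reg 1) (.reg 13))))
        (.mul discountExpr (.get 21 (.add (.reg 11) (.mul (.reg 1) (.reg 13))))))))

/-- The number of steps of value iteration. -/
def sweepCountExpr : NExpr :=
  .add (.div (.reg 2) (.mul (.mul (.reg 0) (.reg 0)) (.reg 1))) (.lit 1)

/-- Estimate the value of the policy in the array `18`. -/
def evalPolicy : Prog :=
  seq (tabLoop 11 (.reg 0) 13 (.reg 11) (.cast (.lit 0))) (seq (loop sweepCountExpr sweep)
    (sumLoop 11 (.reg 0) 20 (.lit 1)
      (.mul (.div (.cast (.lit 1)) (.cast (.reg 0))) (.get 13 (.reg 11)))))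

end Prog

namespace DMDP

variable {n m : ℕ} {M : DMDP n m}

theorem exec_tabMeanReward {s : MState} (h0 : s.nreg 0 = n) (h1 : s.nreg 1 = m)
    (a0 : s.arr 0 = flatten fun i a j => M.p i a j) (a1 : s.arr 1 = flatten M.r)
    (i : Fin n) (a : Fin m) :
    (Prog.tabMeanReward.exec s).arr 19 (pairIdx i a) = M.meanReward i a := by
  have h := Prog.exec_tabSum (b := 19) (y := 0) (e := Prog.pairCountExpr)
    (f := .mul (.get 0 Prog.transitionExpr) (.get 1 Prog.transitionExpr)) (s := s) (N := n * m)
    (W := n) (fun c k => flatten (fun i a j => M.p i a j) (k + n * c) * flatten M.r (k + n * c))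
    (by decide) (by decide) (by simp [Prog.pairCountExpr, NExpr.eval, h0, h1]) h0
    (fun c _ k _ s' e1 e2 e3 e4 => by
      simp [Prog.transitionExpr, RExpr.eval, NExpr.eval, e1, e2, e3 0, e4, h0, a0, a1])
  rw [Prog.tabMeanReward, h _ (pairIdx_lt i a), Finset.sum_range, meanReward]
  refine Finset.sum_congr rfl fun j _ => ?_
  rw [pairIdx, flatten_apply, flatten_apply]

theorem exec_sweep {T L : ℕ} {s : MState} (hP : M.Prepared T L s.nreg s.arr) {π : Policy n m}
    (hπ : ∀ i a, s.arr 18 (pairIdx i a) = π i a) {u : Fin n → ℝ} (hu : ∀ i : Fin n, s.arr 13 i = u i)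
    (i : Fin n) : (Prog.sweep.exec s).arr 13 i =
      ∑ a, π i a * (M.meanReward i a + M.γ * M.meanNext u i a) := by
  have h := Prog.exec_tabSum (b := 21) (y := 0) (e := Prog.pairCountExpr)
    (f := .mul (.get 0 Prog.transitionExpr) (.get 13 (.reg 11))) (s := s) (N := n * m)
    (W := n) (fun c k => flatten (fun i a j => M.p i a j) (k + n * c) * s.arr 13 k)
    (by decide) (by decide) (by simp [Prog.pairCountExpr, NExpr.eval, hP.nr0, hP.nr1]) hP.nr0
    (fun c _ k _ s' e1 e2 e3 e4 => by
      simp [Prog.transitionExpr, RExpr.eval, NExpr.eval, e1, e2, e3 0, e4, hP.nr0, hP.ar0])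
  set s₁ := (Prog.tabSum 21 Prog.pairCountExpr 0
    (.mul (.get 0 Prog.transitionExpr) (.get 13 (.reg 11)))).exec s with hs₁
  have hk : MState.Keeps [21] s s₁ := Prog.keeps_exec (by decide) (by decide) s
  have hQ : ∀ i a, s₁.arr 21 (pairIdx i a) = M.meanNext u i a := by
    intro i a
    rw [h _ (pairIdx_lt i a), Finset.sum_range, meanNext]
    refine Finset.sum_congr rfl fun j _ => ?_
    rw [pairIdx, flatten_apply, hu]
  have h' := Prog.exec_tabSum (b := 13) (y := 1) (e := .reg 0)
    (f := .mul (.get 18 (.add (.reg 11) (.mul (.reg 1) (.reg 13))))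
      (.add (.get 19 (.add (.reg 11) (.mul (.reg 1) (.reg 13))))
        (.mul Prog.discountExpr (.get 21 (.add (.reg 11) (.mul (.reg 1) (.reg 13)))))))
    (s := s₁) (N := n) (W := m) (fun c k => s₁.arr 18 (k + m * c) * (s₁.arr 19 (k + m * c) +
      M.γ * s₁.arr 21 (k + m * c)))
    (by decide) (by decide) (by rw [NExpr.eval, hk.1 0 (by decide), hP.nr0])
    (by rw [hk.1 1 (by decide), hP.nr1])
    (fun c _ k _ s' e1 e2 e3 e4 => by
      have e5 := hk.2 2 (by decide)
      simp [RExpr.eval, NExpr.eval, Prog.discountExpr, e1, e2, e3 1, e4, hk.1 1, hP.nr1, e5, hP.ar2])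
  have hfin : Prog.sweep.exec s = (Prog.tabSum 13 (.reg 0) 1
    (.mul (.get 18 (.add (.reg 11) (.mul (.reg 1) (.reg 13))))
      (.add (.get 19 (.add (.reg 11) (.mul (.reg 1) (.reg 13))))
        (.mul Prog.discountExpr (.get 21 (.add (.reg 11) (.mul (.reg 1) (.reg 13)))))))).exec s₁ :=
    rfl
  rw [hfin, h' i i.2, Finset.sum_range]
  refine Finset.sum_congr rfl fun a _ => ?_
  have e18 := hπ i a
  have e19 := hP.ar19 i a
  have e21 := hQ i a
  rw [← hk.2 18 (by decide)] at e18
  rw [← hk.2 19 (by decide)] at e19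
  rw [pairIdx] at e18 e19 e21
  rw [e18, e19, e21]

theorem Prepared.of_keeps {T L : ℕ} {s s' : MState} {l : List ℕ}
    (hP : M.Prepared T L s.nreg s.arr) (h : MState.Keeps l s s')
    (hl : ∀ b ∈ [0, 1, 2, 4, 5, 16, 17, 19], b ∉ l) : M.Prepared T L s'.nreg s'.arr :=
  hP.congr (fun y hy => h.1 y (by omega)) fun b hb => h.2 b (hl b hb)

theorem exec_evalPolicy [NeZero n] {T L : ℕ} {s : MState} (hP : M.Prepared T L s.nreg s.arr)
    {π : Policy n m} (hπ : ∀ i a, s.arr 18 (pairIdx i a) = π i a) :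
    (Prog.evalPolicy.exec s).arr 20 = Function.update (s.arr 20) 1
      (M.valueEstimate π (T / (n * n * m) + 1)) := by
  obtain ⟨a1, a2⟩ := Prog.exec_tabLoop (x := 11) (e := .reg 0) (b := 13) (i := .reg 11)
    (f := .cast (.lit 0)) (s := s) (N := n) 0 (fun _ => 0) (by decide) hP.nr0
    (fun t _ s' h => by simp [NExpr.eval, h])
    (fun t _ s' _ _ => by simp [RExpr.eval, NExpr.eval])
  set s₁ := (Prog.tabLoop 11 (.reg 0) 13 (.reg 11) (.cast (.lit 0))).exec s with hs₁
  have hk : MState.Keeps [13, 21] s s₁ := Prog.keeps_exec (by decide) (by decide) s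
  have hloop := Prog.loop_inv (s := s₁) (e := Prog.sweepCountExpr) (c := Prog.sweep)
    (N := T / (n * n * m) + 1)
    (fun t nr ar => (∀ y < 6, nr y = s.nreg y) ∧ (∀ b ∉ [13, 21], ar b = s.arr b) ∧
      ∀ i : Fin n, ar 13 i = valueIter M π t i)
    (by simp [Prog.sweepCountExpr, NExpr.eval, hk.1, hP.nr0, hP.nr1, hP.nr2]) ?_ ?_
  · obtain ⟨b1, b2, b3⟩ := hloop
    have hfin : Prog.evalPolicy.exec s = (Prog.sumLoop 11 (.reg 0) 20 (.lit 1)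
      (.mul (.div (.cast (.lit 1)) (.cast (.reg 0))) (.get 13 (.reg 11)))).exec
        ((Prog.loop Prog.sweepCountExpr Prog.sweep).exec s₁) := rfl
    rw [hfin]
    generalize (Prog.loop Prog.sweepCountExpr Prog.sweep).exec s₁ = s₂ at b1 b2 b3
    obtain ⟨-, c2⟩ := Prog.exec_sumLoop (x := 11) (e := .reg 0) (b := 20) (i := .lit 1)
      (f := .mul (.div (.cast (.lit 1)) (.cast (.reg 0))) (.get 13 (.reg 11))) (s := s₂) (N := n)
      (fun k => 1 / (n : ℝ) * s₂.arr 13 k) (by decide) (by decide)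
      (by rw [NExpr.eval, b1 0 (by decide), hP.nr0])
      (fun t _ s' h h' => by simp [RExpr.eval, NExpr.eval, h, h', b1 0, hP.nr0])
    rw [c2, Function.update_self, b2 20 (by decide), NExpr.eval, Finset.sum_range, valueEstimate]
    congr 1
    refine Finset.sum_congr rfl fun i _ => ?_
    rw [b3, q_apply]
  · refine ⟨hk.1, hk.2, fun i => ?_⟩
    rw [a2, Function.update_self, if_pos (by simp)]
    rfl
  · rintro t - s' ⟨h1, h2, h3⟩
    have hk' : MState.Keeps [13, 21] s s' := ⟨h1, h2⟩
    have hk'' : MState.Keeps [13, 21] s (Prog.sweep.exec s') :=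
      hk'.trans (Prog.keeps_exec (by decide) (by decide) s')
    refine ⟨hk''.1, hk''.2, fun i => ?_⟩
    rw [exec_sweep (hP.of_keeps hk' (by decide)) (fun i a => by rw [h2 18 (by decide), hπ]) h3]
    rfl

end DMDP

/-! ## The meta algorithm as a program -/

namespace Prog

/-- Store in register `4` the smallest `L` with `n + m ≤ 2 ^ L`. -/
def findDepth : Prog :=
  seq (setN 4 (.lit 0)) (seq (setN 11 (.lit 1)) (loop (.add (.reg 0) (.reg 1))
    (ifN (.reg 11) (.add (.reg 0) (.reg 1))
      (seq (setN 11 (.mul (.lit 2) (.reg 11))) (setN 4 (.add (.reg 4) (.lit 1)))) skip)))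

/-- The dual step size. -/
def dualStepSizeExpr : RExpr :=
  .mul discountGapExpr (.sqrt (.div
    (.log (.add (.mul (.cast (.reg 0)) (.cast (.reg 1))) (.cast (.lit 1))))
    (.mul (.cast (.lit 2)) (.mul (.mul (.cast (.reg 0)) (.cast (.reg 1))) (.cast (.reg 2))))))

/-- The primal step size. -/
def primalStepSizeExpr : RExpr :=
  .mul (.div (.cast (.reg 0)) (.mul (.cast (.lit 2)) (.mul discountGapExpr discountGapExpr)))
    (.get 17 (.lit 0))

/-- Set up the memory before the first run of the primal-dual method. -/
def prepare : Prog :=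
  seq (buildForest 0 pairCountExpr 5 (.get 0 transitionExpr))
  (seq (tabLoop 11 (.reg 0) 16 (.add (.reg 0) (.reg 11)) (.cast (.lit 1)))
  (seq (setN 10 (.lit 0)) (seq (buildTree 0 16)
  (seq (setR 17 (.lit 0) dualStepSizeExpr) (seq (setR 17 (.lit 1) primalStepSizeExpr)
  (seq tabMeanReward (setR 20 (.lit 0) (.sub (.cast (.lit 0)) (.cast (.lit 1))))))))))

/-- Replace the best policy so far by the policy in the array `18` if that has a larger estimate. -/
def updateBest : Prog :=
  ifR (.get 20 (.lit 0)) (.get 20 (.lit 1)) (seq (setR 20 (.lit 0) (.get 20 (.lit 1)))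
    (tabLoop 11 pairCountExpr 3 (.reg 11) (.get 18 (.reg 11)))) skip

/-- The meta algorithm after the preparations. -/
def mainLoop : Prog := loop (.reg 3) (seq runMethod (seq evalPolicy updateBest))

/-- The meta algorithm. -/
def metaProg : Prog := seq findDepth (seq prepare mainLoop)

/-- Register `11` always holds two to the power of register `4`. As `n + m ≤ 2 ^ (n + m)`, that many
iterations suffice; the last doubling starts below `n + m`, which gives the upper bound. -/
theorem exec_findDepth {s : MState} {n m : ℕ} (h0 : s.nreg 0 = n) (h1 : s.nreg 1 = m)
    (hnm : 0 < n + m) : n + m ≤ 2 ^ (findDepth.exec s).nreg 4 ∧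
      2 ^ (findDepth.exec s).nreg 4 ≤ 2 * (n + m) := by
  set s₁ := (setN 11 (.lit 1)).exec ((setN 4 (.lit 0)).exec s) with hs₁
  have h := loop_inv (s := s₁) (e := .add (.reg 0) (.reg 1))
    (c := ifN (.reg 11) (.add (.reg 0) (.reg 1))
      (seq (setN 11 (.mul (.lit 2) (.reg 11))) (setN 4 (.add (.reg 4) (.lit 1)))) skip)
    (N := n + m) (fun t nr ar => nr 0 = n ∧ nr 1 = m ∧ nr 11 = 2 ^ nr 4 ∧
      2 ^ nr 4 ≤ 2 * (n + m) ∧ (n + m ≤ 2 ^ nr 4 ∨ nr 4 = t)) ?_ ?_ ?_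
  · have hfin : findDepth.exec s = (loop (.add (.reg 0) (.reg 1))
      (ifN (.reg 11) (.add (.reg 0) (.reg 1))
      (seq (setN 11 (.mul (.lit 2) (.reg 11))) (setN 4 (.add (.reg 4) (.lit 1)))) skip)).exec s₁ :=
      rfl
    rw [hfin]
    obtain ⟨-, -, -, h4, h5⟩ := h
    refine ⟨?_, h4⟩
    rcases h5 with h5 | h5
    · exact h5
    · rw [h5]
      exact Nat.lt_two_pow_self.le
  · simp [NExpr.eval, hs₁, exec_setN_nreg, h0, h1]
  · simp [NExpr.eval, hs₁, exec_setN_nreg, h0, h1]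
    omega
  · rintro t - s' ⟨a1, a2, a3, a4, a5⟩
    by_cases hlt : s'.nreg 11 < n + m
    · rw [exec_ifN_of_lt (by simpa [NExpr.eval, a1, a2] using hlt)]
      simp only [exec_seq, exec_setN_nreg, MState.tick, NExpr.eval]
      simp only [ne_eq, not_false_eq_true, Function.update_self,
        Function.update_of_ne, OfNat.zero_ne_ofNat, OfNat.one_ne_ofNat, Nat.reduceEqDiff]
      refine ⟨a1, a2, ?_, ?_, ?_⟩
      · rw [a3, pow_succ, mul_comm]
      · rw [pow_succ, ← a3]
        omega
      · right
        rw [a3] at hlt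
        omega
    · rw [exec_ifN_of_not_lt (by simpa [NExpr.eval, a1, a2] using hlt)]
      rw [a3, not_lt] at hlt
      exact ⟨a1, a2, a3, a4, Or.inl hlt⟩

end Prog

namespace DMDP

variable {n m : ℕ} {M : DMDP n m}

theorem exec_prepare [NeZero n] {T L : ℕ} {s : MState} (h0 : s.nreg 0 = n) (h1 : s.nreg 1 = m)
    (h2 : s.nreg 2 = T) (h4 : s.nreg 4 = L) (hn : n ≤ 2 ^ L) (hm : m ≤ 2 ^ L)
    (a0 : s.arr 0 = flatten fun i a j => M.p i a j) (a1 : s.arr 1 = flatten M.r)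
    (a2 : s.arr 2 0 = M.γ) (a4 : s.arr 4 0 = 0) :
    M.Prepared T L (Prog.prepare.exec s).nreg (Prog.prepare.exec s).arr ∧
      (Prog.prepare.exec s).arr 20 0 = -1 := by
  have hn0 := Nat.pos_of_ne_zero (NeZero.ne n)
  have b5 := Prog.isTree_buildForest (y := 0) (b := 5) (e := Prog.pairCountExpr)
    (f := .get 0 Prog.transitionExpr) (s := s) (N := n * m) (W := n)
    (fun c k => flatten (fun i a j => M.p i a j) (k + n * c)) (by decide) (by decide)
    (by simp [Prog.pairCountExpr, NExpr.eval, h0, h1]) h0 hn0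
    (fun c _ k _ s' e1 e2 e3 e4 => by
      simp [Prog.transitionExpr, RExpr.eval, NExpr.eval, e1, e2, e3 0, e4, h0, a0])
  have k1 : MState.Keeps [5] s _ := Prog.keeps_exec
    (c := Prog.buildForest 0 Prog.pairCountExpr 5 (.get 0 Prog.transitionExpr))
    (by decide) (by decide) s
  set s₁ := (Prog.buildForest 0 Prog.pairCountExpr 5 (.get 0 Prog.transitionExpr)).exec s with hs₁
  obtain ⟨c1, c2⟩ := Prog.exec_tabLoop (x := 11) (e := .reg 0) (b := 16)
    (i := .add (.reg 0) (.reg 11)) (f := .cast (.lit 1)) (s := s₁) (N := n) n (fun _ => 1)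
    (by decide) (by rw [NExpr.eval, k1.1 0 (by decide), h0])
    (fun t _ s' h => by simp [NExpr.eval, h, k1.1 0, h0])
    (fun t _ s' h _ => by simp [RExpr.eval, NExpr.eval])
  set s₂ := (Prog.tabLoop 11 (.reg 0) 16 (.add (.reg 0) (.reg 11)) (.cast (.lit 1))).exec s₁
    with hs₂
  have k2 : MState.Keeps [5, 16] s s₂ := (k1.mono (by decide)).trans
    (Prog.keeps_exec (by decide) (by decide) s₁)
  set s₃ := (Prog.setN 10 (.lit 0)).exec s₂ with hs₃
  have k3 : MState.Keeps [5, 16] s s₃ := k2.trans (Prog.keeps_exec (by decide) (by decide) s₂)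
  obtain ⟨d1, -⟩ := Prog.isTree_buildTree (x := 0) (b := 16) (o := 0) (N := n) (w := fun _ => 1)
    (s := s₃) (by decide) hn0 (by rw [hs₃, Prog.exec_setN_nreg]; simp [NExpr.eval])
    ((k3.1 0 (by decide)).trans h0) (fun k hk => by
      rw [hs₃, Prog.exec_setN_arr, c2, Function.update_self, if_pos (by omega)])
  have k4' : MState.Keeps [16] s₃ _ := Prog.keeps_exec (c := Prog.buildTree 0 16)
    (by decide) (by decide) s₃
  set s₄ := (Prog.buildTree 0 16).exec s₃ with hs₄
  have k4 : MState.Keeps [5, 16] s s₄ := k3.trans (k4'.mono (by decide))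
  have e5 : s₄.arr 5 = s₁.arr 5 := by
    rw [k4'.2 5 (by decide), hs₃, Prog.exec_setN_arr, c2, Function.update_of_ne (by decide)]
  have hβ : Prog.dualStepSizeExpr.eval s₄ = M.β T := by
    simp [Prog.dualStepSizeExpr, Prog.discountGapExpr, Prog.discountExpr, RExpr.eval, NExpr.eval,
      k4.1, k4.2 2, h0, h1, h2, a2, β]
  set s₅ := (Prog.setR 17 (.lit 0) Prog.dualStepSizeExpr).exec s₄ with hs₅
  have k5' : MState.Keeps [17] s₄ s₅ := Prog.keeps_exec (by decide) (by decide) s₄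
  have k5 : MState.Keeps [5, 16, 17] s s₅ := (k4.mono (by decide)).trans (k5'.mono (by decide))
  have f1 : s₅.arr 17 0 = M.β T := by
    rw [hs₅, Prog.exec_setR_arr, hβ]
    simp [NExpr.eval]
  have hα : Prog.primalStepSizeExpr.eval s₅ = M.α T := by
    simp [Prog.primalStepSizeExpr, Prog.discountGapExpr, Prog.discountExpr, RExpr.eval, NExpr.eval,
      k5.1, k5.2 2, h0, a2, f1, α, sq]
  set s₆ := (Prog.setR 17 (.lit 1) Prog.primalStepSizeExpr).exec s₅ with hs₆
  have k6' : MState.Keeps [17] s₄ s₆ := k5'.trans (Prog.keeps_exec (by decide) (by decide) s₅)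
  have k6 : MState.Keeps [5, 16, 17] s s₆ := (k4.mono (by decide)).trans (k6'.mono (by decide))
  have f2 : s₆.arr 17 = Function.update (s₅.arr 17) 1 (M.α T) := by
    rw [hs₆, Prog.exec_setR_arr, hα]
    simp [NExpr.eval]
  have g := exec_tabMeanReward (M := M) (s := s₆) ((k6.1 0 (by decide)).trans h0)
    ((k6.1 1 (by decide)).trans h1) ((k6.2 0 (by decide)).trans a0) ((k6.2 1 (by decide)).trans a1)
  have k7' : MState.Keeps [19] s₆ _ := Prog.keeps_exec (c := Prog.tabMeanReward)
    (by decide) (by decide) s₆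
  set s₇ := Prog.tabMeanReward.exec s₆ with hs₇
  have k7 : MState.Keeps [5, 16, 17, 19] s s₇ :=
    (k6.mono (by decide)).trans (k7'.mono (by decide))
  have hfin : Prog.prepare.exec s =
    (Prog.setR 20 (.lit 0) (.sub (.cast (.lit 0)) (.cast (.lit 1)))).exec s₇ := rfl
  rw [hfin, Prog.exec_setR_nreg, Prog.exec_setR_arr]
  refine ⟨⟨(k7.1 0 (by decide)).trans h0, (k7.1 1 (by decide)).trans h1,
    (k7.1 2 (by decide)).trans h2, (k7.1 4 (by decide)).trans h4, hn, hm, ?_, ?_, ?_, ?_, ?_, ?_,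
    ?_, ?_, ?_⟩, ?_⟩
  · rw [Function.update_of_ne (by decide), k7.2 0 (by decide), a0]
  · rw [Function.update_of_ne (by decide), k7.2 1 (by decide), a1]
  · rw [Function.update_of_ne (by decide), k7.2 2 (by decide), a2]
  · rw [Function.update_of_ne (by decide), k7.2 4 (by decide), a4]
  · rw [Function.update_of_ne (by decide), k7'.2 5 (by decide), k6'.2 5 (by decide), e5]
    exact b5
  · rw [Function.update_of_ne (by decide), k7'.2 16 (by decide), k6'.2 16 (by decide)]
    exact d1
  · rw [Function.update_of_ne (by decide), k7'.2 17 (by decide), f2,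
      Function.update_of_ne (by decide), f1]
  · rw [Function.update_of_ne (by decide), k7'.2 17 (by decide), f2, Function.update_self]
  · rw [Function.update_of_ne (by decide)]
    exact g
  · simp [NExpr.eval, RExpr.eval]

theorem exec_updateBest {s : MState} (h0 : s.nreg 0 = n) (h1 : s.nreg 1 = m) {π : Policy n m}
    (hπ : ∀ i a, s.arr 18 (pairIdx i a) = π i a) {y : ℝ} (hy : s.arr 20 1 = y) :
    (s.arr 20 0 < y → (Prog.updateBest.exec s).arr 20 0 = y ∧
      ∀ i a, (Prog.updateBest.exec s).arr 3 (pairIdx i a) = π i a) ∧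
    (¬s.arr 20 0 < y → (Prog.updateBest.exec s).arr 20 0 = s.arr 20 0 ∧
      (Prog.updateBest.exec s).arr 3 = s.arr 3) := by
  refine ⟨fun h => ?_, fun h => ?_⟩
  · rw [Prog.updateBest, Prog.exec_ifR_of_lt (by simpa [RExpr.eval, NExpr.eval, hy] using h),
      Prog.exec_seq]
    set s₁ := (Prog.setR 20 (.lit 0) (.get 20 (.lit 1))).exec (s.tick _) with hs₁
    have a1 : s₁.nreg = s.nreg := rfl
    have a2 : s₁.arr = Function.update s.arr 20 (Function.update (s.arr 20) 0 y) := by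
      rw [← hy]
      rfl
    obtain ⟨-, c2⟩ := Prog.exec_tabLoop (x := 11) (e := Prog.pairCountExpr) (b := 3)
      (i := .reg 11) (f := .get 18 (.reg 11)) (s := s₁) (N := n * m) 0 (s.arr 18)
      (by decide) (by simp [Prog.pairCountExpr, NExpr.eval, a1, h0, h1])
      (fun t _ s' h => by simp [NExpr.eval, h])
      (fun t _ s' h h' => by simp [RExpr.eval, NExpr.eval, h, h', a2])
    rw [c2]
    refine ⟨?_, fun i a => ?_⟩
    · rw [Function.update_of_ne (by decide), a2]
      simp
    · rw [Function.update_self, if_pos ⟨zero_le, by simpa using pairIdx_lt i a⟩, Nat.sub_zero, hπ]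
  · rw [Prog.updateBest, Prog.exec_ifR_of_not_lt (by simpa [RExpr.eval, NExpr.eval, hy] using h)]
    exact ⟨rfl, rfl⟩

/-- The arrays that are changed by the main loop. -/
def mainArrays : List ℕ := [3, 6, 7, 8, 9, 10, 13, 15, 18, 20, 21]

/-- After some runs with output policies `h`, the memory holds the first policy with the largest
estimate. -/
def HoldsBest {k : ℕ} (g : Policy n m → ℝ) (h : Fin k → Policy n m) (ar : ℕ → ℕ → ℝ) : Prop :=
  (k = 0 ∧ ar 20 0 = -1) ∨ ∃ l : Fin k, (∀ l', g (h l') ≤ g (h l)) ∧ (∀ l' < l, g (h l') < g (h l)) ∧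
    ar 20 0 = g (h l) ∧ ∀ i a, ar 3 (pairIdx i a) = h l i a

/-- The initial value `-1` lies below all estimates, as these are nonnegative, so the first policy
is always stored. The strict comparison keeps the first maximizer, in agreement with `argmaxIdx`. -/
theorem HoldsBest.snoc {k : ℕ} {g : Policy n m → ℝ} (hg : ∀ π, 0 ≤ g π) {h : Fin k → Policy n m}
    {ar ar' : ℕ → ℕ → ℝ} (hb : HoldsBest g h ar) {π : Policy n m}
    (h1 : ar 20 0 < g π → ar' 20 0 = g π ∧ ∀ i a, ar' 3 (pairIdx i a) = π i a)
    (h2 : ¬ar 20 0 < g π → ar' 20 0 = ar 20 0 ∧ ar' 3 = ar 3) :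
    HoldsBest g (Fin.snoc h π : Fin (k + 1) → Policy n m) ar' := by
  by_cases hlt : ar 20 0 < g π
  · obtain ⟨a1, a2⟩ := h1 hlt
    have hall : ∀ l, g (h l) < g π := by
      intro l
      rcases hb with ⟨rfl, -⟩ | ⟨l', b1, -, b3, -⟩
      · exact l.elim0
      · exact (b1 l).trans_lt (b3 ▸ hlt)
    refine Or.inr ⟨Fin.last k, fun l => ?_, fun l hl => ?_, ?_, fun i a => ?_⟩
    · refine Fin.lastCases ?_ (fun l => ?_) l
      · exact le_rfl
      · simpa using (hall l).le
    · obtain ⟨l, rfl⟩ := Fin.exists_castSucc_eq.mpr hl.ne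
      simpa using hall l
    · simpa using a1
    · simpa using a2 i a
  · obtain ⟨a1, a2⟩ := h2 hlt
    rcases hb with ⟨-, b⟩ | ⟨l', b1, b2, b3, b4⟩
    · rw [b] at hlt
      linarith [hg π]
    · refine Or.inr ⟨l'.castSucc, fun l => ?_, fun l hl => ?_, ?_, fun i a => ?_⟩
      · refine Fin.lastCases ?_ (fun l => ?_) l
        · simpa [b3] using hlt
        · simpa using b1 l
      · obtain ⟨l, rfl⟩ := Fin.exists_castSucc_eq.mpr
          (hl.trans_le (Fin.le_last _)).ne
        simpa using b2 l (by simpa using hl)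
      · simpa [a1] using b3
      · simpa [a2] using b4 i a

variable [NeZero n] [NeZero m]

theorem generates_mainStep {T L : ℕ} [NeZero T] {s : MState} (hP : M.Prepared T L s.nreg s.arr)
    {k : ℕ} {h : Fin k → Policy n m}
    (hb : HoldsBest (fun π => M.valueEstimate π (T / (n * n * m) + 1)) h s.arr) :
    Generates (Prog.seq Prog.runMethod (Prog.seq Prog.evalPolicy Prog.updateBest)).exec s
      ((M.primalDual T).map fun π => (Fin.snoc h π : Fin (k + 1) → Policy n m)) (fun h' s' =>
        HoldsBest (fun π => M.valueEstimate π (T / (n * n * m) + 1)) h' s'.arr ∧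
        MState.Keeps mainArrays s s') := by
  refine Generates.seq_map ?_ _ (generates_runMethod hP) ?_
  · simp [Prog.NoDraw, Prog.evalPolicy, Prog.updateBest, Prog.sweep, Prog.tabSum, Prog.sumLoop,
      Prog.tabLoop, Prog.forN]
  rintro π s₁ ⟨h1, h2⟩
  have hP₁ := hP.of_keeps h2 (by decide)
  have e := exec_evalPolicy hP₁ h1
  have k1 : MState.Keeps [13, 20, 21] s₁ (Prog.evalPolicy.exec s₁) :=
    Prog.keeps_exec (by decide) (by decide) s₁
  rw [Prog.exec_seq]
  generalize Prog.evalPolicy.exec s₁ = s₂ at e k1 ⊢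
  have k2 : MState.Keeps [3, 20] s₂ (Prog.updateBest.exec s₂) :=
    Prog.keeps_exec (by decide) (by decide) s₂
  have e0 : s₂.arr 20 0 = s.arr 20 0 := by
    rw [e, Function.update_of_ne (by decide), h2.2 20 (by decide)]
  have e3 : s₂.arr 3 = s.arr 3 := by
    rw [k1.2 3 (by decide), h2.2 3 (by decide)]
  obtain ⟨b1, b2⟩ := exec_updateBest (s := s₂) ((k1.1 0 (by decide)).trans hP₁.nr0)
    ((k1.1 1 (by decide)).trans hP₁.nr1) (π := π)
    (fun i a => by rw [k1.2 18 (by decide), h1]) (y := M.valueEstimate π (T / (n * n * m) + 1))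
    (by rw [e, Function.update_self])
  rw [e0, e3] at b2
  rw [e0] at b1
  exact ⟨hb.snoc (fun π => M.valueEstimate_nonneg π _) b1 b2,
    ((h2.mono (by decide)).trans (k1.mono (by decide))).trans (k2.mono (by decide))⟩

theorem generates_mainLoop {T K L : ℕ} [NeZero T] [NeZero K] {s : MState}
    (hP : M.Prepared T L s.nreg s.arr) (h3 : s.nreg 3 = K) (h20 : s.arr 20 0 = -1) :
    Generates Prog.mainLoop.exec s
      (M.metaAlg T K fun π => PMF.pure (M.valueEstimate π (T / (n * n * m) + 1)))
      (fun π s' => ∀ i a, s'.arr 3 (pairIdx i a) = π i a) := by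
  have hloop := Generates.loop (E := fun k => Fin k → Policy n m) (e := .reg 3)
    (c := Prog.seq Prog.runMethod (Prog.seq Prog.evalPolicy Prog.updateBest)) (s := s)
    (ρ := fun k => indepPMF k fun _ => M.primalDual T)
    (κ := fun k h => (M.primalDual T).map fun π => (Fin.snoc h π : Fin (k + 1) → Policy n m))
    (I := fun k h s' => HoldsBest (fun π => M.valueEstimate π (T / (n * n * m) + 1)) h s'.arr ∧
      MState.Keeps mainArrays s s') (N := K) h3 rfl
    ⟨Or.inl ⟨rfl, h20⟩, fun _ _ => rfl, fun _ _ => rfl⟩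
    (fun k => indepPMF_succ_eq_snoc _ k) fun k _ h s' hI =>
      (generates_mainStep (s := s'.tick 1) (hP.of_keeps hI.2 (by decide)) hI.1).mono
        fun y s'' h' => ⟨h'.1, hI.2.trans h'.2⟩
  rw [metaAlg_pure]
  refine hloop.map _ ?_
  rintro h s' ⟨h1, -⟩
  rcases h1 with ⟨h1, -⟩ | ⟨l, b1, b2, -, b4⟩
  · exact absurd h1 (NeZero.ne K)
  · rw [argmaxIdx_eq b1 b2]
    exact b4

end DMDP

/-! ## Law and run time of the program -/

namespace Prog

theorem maxTime_findDepth {s : MState} {n m : ℕ} (h0 : s.nreg 0 = n) (h1 : s.nreg 1 = m) :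
    findDepth.maxTime s = 8 + n * 15 + m * 15 := by
  simp only [maxTime, findDepth, NExpr.cost, NExpr.eval, h0, h1, Nat.reduceAdd]
  ring

theorem maxTime_prepare {s : MState} {n m : ℕ} (h0 : s.nreg 0 = n) (h1 : s.nreg 1 = m) :
    prepare.maxTime s = 83 + n * 11 + n * m * 34 + n * m * (n - 1) * 24 + n * n * m * 40 +
      (n - 1) * 24 := by
  simp only [maxTime, prepare, dualStepSizeExpr, primalStepSizeExpr, tabMeanReward, buildForest,
    buildTree, sumChildren, tabSum, sumLoop, pairCountExpr, transitionExpr, tabLoop, forN,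
    NExpr.cost, RExpr.cost, NExpr.eval, discountExpr, discountGapExpr, h0, h1, Nat.reduceAdd]
  ring

theorem maxTime_runMethod {s : MState} {n m T L : ℕ} (h0 : s.nreg 0 = n) (h1 : s.nreg 1 = m)
    (h2 : s.nreg 2 = T) (h4 : s.nreg 4 = L) :
    runMethod.maxTime s = 40 + n * 50 + n * m * 71 + n * (m - 1) * 24 + (n - 1) * 24 + T * 379 +
      T * L * 212 := by
  simp only [maxTime, runMethod, initRun, tabLoop, forN, buildForest, buildTree, sumChildren,
    sampleTriple, updateAll, updateValues, storeClip, updateLeaf, updateRow, ascend, descend, coin,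
    storeAverage, averageExpr, NExpr.cost, RExpr.cost, NExpr.eval, pairExpr, discountExpr,
    discountGapExpr, actionLeafExpr, stateLeafExpr, weightedTimeExpr, h0, h1, h2, h4,
    Nat.reduceAdd]
  ring

theorem maxTime_evalPolicy {s : MState} {n m T : ℕ} (h0 : s.nreg 0 = n) (h1 : s.nreg 1 = m)
    (h2 : s.nreg 2 = T) :
    (seq evalPolicy updateBest).maxTime s = 38 + n * 27 + n * m * 9 +
      (T / (n * n * m) + 1) * (11 + n * 13 + n * m * 46 + n * n * m * 19) := by
  simp only [maxTime, evalPolicy, updateBest, sweep, tabSum, sumLoop, sweepCountExpr,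
    pairCountExpr, transitionExpr, tabLoop, forN, NExpr.cost, RExpr.cost, NExpr.eval,
    discountExpr, h0, h1, h2, Nat.reduceAdd]
  ring

theorem maxTime_prepare_mainLoop_le {s : MState} {n m T K L : ℕ} (hn : 0 < n) (hm : 0 < m)
    (hL : 0 < L) (h0 : s.nreg 0 = n) (h1 : s.nreg 1 = m) (h2 : s.nreg 2 = T) (h3 : s.nreg 3 = K)
    (h4 : s.nreg 4 = L) : (seq prepare mainLoop).maxTime s ≤
      220 * (n * n * m) + K * (400 * (n * n * m) + 700 * (T * L)) := by
  set P := n * n * m with hP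
  have p1 : n * m ≤ P := Nat.mul_le_mul_right m (Nat.le_mul_of_pos_left n hn)
  have p2 : n ≤ P := (Nat.le_mul_of_pos_right n hm).trans p1
  have p3 : n * (m - 1) ≤ P := (Nat.mul_le_mul_left n (Nat.sub_le m 1)).trans p1
  have p4 : n * m * (n - 1) ≤ P := by
    rw [hP, mul_right_comm n n m]
    exact Nat.mul_le_mul_left (n * m) (Nat.sub_le n 1)
  have p5 : n - 1 ≤ P := (Nat.sub_le n 1).trans p2
  have p6 : 1 ≤ P := hn.trans_le p2
  have p7 : T ≤ T * L := Nat.le_mul_of_pos_right T hL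
  have p8 : T / P * P ≤ T := Nat.div_mul_le_self T P
  have hprep := maxTime_prepare h0 h1
  have hrun := maxTime_runMethod h0 h1 h2 h4
  have heval := maxTime_evalPolicy h0 h1 h2
  -- The division in the number of sweeps is undone here by `T / P * P ≤ T`, so the evaluation costs
  -- no more than the run itself, up to constants and the input size `P`.
  have hsweep : (T / P + 1) * (11 + n * 13 + n * m * 46 + P * 19) ≤ 89 * T + 89 * P :=
    calc (T / P + 1) * (11 + n * 13 + n * m * 46 + P * 19) ≤ (T / P + 1) * (89 * P) :=
          Nat.mul_le_mul_left _ (by omega)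
      _ = 89 * (T / P * P) + 89 * P := by ring
      _ ≤ 89 * T + 89 * P := by omega
  have e : (seq prepare mainLoop).maxTime s = prepare.maxTime s +
      (2 + K * (runMethod.maxTime s + (seq evalPolicy updateBest).maxTime s + 1)) := by
    simp only [mainLoop, maxTime, NExpr.cost, NExpr.eval, h3, Nat.reduceAdd]
  have hbody : runMethod.maxTime s + (seq evalPolicy updateBest).maxTime s + 1 ≤
      400 * P + 700 * (T * L) := by
    rw [hrun, heval, ← hP]
    omega
  have hloop := Nat.mul_le_mul_left K hbody
  rw [e, hprep, ← hP]
  omega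

end Prog

namespace DMDP

variable {n m : ℕ} (M : DMDP n m) [NeZero n] [NeZero m]

/-- The static bound is applied separately to `findDepth` and to the rest, because `findDepth`
writes register `4`, which bounds later loops. -/
theorem metaProg_time_le (ε δ : ℝ) (T K : ℕ) (ω : ℕ → unitInterval) :
    ∃ L, 2 ^ L ≤ 2 * (n + m) ∧ (Prog.metaProg.exec (M.inputState ε δ T K ω)).time ≤
      1000 * (n * n * m + K * (n * n * m + T * L)) := by
  have hn0 := Nat.pos_of_ne_zero (NeZero.ne n)
  have hm0 := Nat.pos_of_ne_zero (NeZero.ne m)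
  set s := M.inputState ε δ T K ω with hs
  obtain ⟨h1, h2⟩ := Prog.exec_findDepth (s := s) (n := n) (m := m) rfl rfl (by omega)
  have t1 := Prog.exec_time_le Prog.findDepth s [0, 1, 2, 3] (by decide) (by decide) s
    fun _ _ => rfl
  have hr : ∀ y < 4, (Prog.findDepth.exec s).nreg y = s.nreg y := fun y hy =>
    Prog.exec_nreg (by simp [Prog.findDepth, Prog.wregs]; omega) s
  set s₁ := Prog.findDepth.exec s with hs₁
  set L := s₁.nreg 4 with hL
  have hLpos : 0 < L := by
    by_contra h
    have : L = 0 := by omega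
    rw [this] at h1
    omega
  have t2 := Prog.exec_time_le (Prog.seq Prog.prepare Prog.mainLoop) s₁ [0, 1, 2, 3, 4]
    (by decide) (by decide) s₁ fun _ _ => rfl
  have t3 := Prog.maxTime_prepare_mainLoop_le (s := s₁) (n := n) (m := m) (T := T) (K := K)
    (L := L) hn0 hm0 hLpos (hr 0 (by decide)) (hr 1 (by decide)) (hr 2 (by decide))
    (hr 3 (by decide)) rfl
  have t4 := Prog.maxTime_findDepth (s := s) (n := n) (m := m) rfl rfl
  have t5 : s.time = 0 := rfl
  have p1 : n ≤ n * n * m := by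
    rw [mul_assoc]
    exact Nat.le_mul_of_pos_right n (Nat.mul_pos hn0 hm0)
  have p2 : m ≤ n * n * m := Nat.le_mul_of_pos_left m (Nat.mul_pos hn0 hn0)
  refine ⟨L, h2, ?_⟩
  have hfin : Prog.metaProg.exec s = (Prog.seq Prog.prepare Prog.mainLoop).exec s₁ := rfl
  have p3 : K * (400 * (n * n * m) + 700 * (T * L)) ≤ 1000 * (K * (n * n * m + T * L)) :=
    calc K * (400 * (n * n * m) + 700 * (T * L)) ≤ K * (1000 * (n * n * m + T * L)) :=
          Nat.mul_le_mul_left K (by omega)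
      _ = 1000 * (K * (n * n * m + T * L)) := by ring
  rw [hfin]
  omega

theorem outputsPolicy_metaProg (ε δ : ℝ) (T K : ℕ) [NeZero T] [NeZero K] :
    Prog.metaProg.OutputsPolicy (M.inputState ε δ T K)
      (M.metaAlg T K fun π => PMF.pure (M.valueEstimate π (T / (n * n * m) + 1))) := by
  have hn0 := Nat.pos_of_ne_zero (NeZero.ne n)
  set s := M.inputState ε δ T K fun _ => 0 with hs
  have hgen : Generates Prog.metaProg.exec s
      (M.metaAlg T K fun π => PMF.pure (M.valueEstimate π (T / (n * n * m) + 1)))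
      (fun π s' => ∀ i a, s'.arr 3 (pairIdx i a) = π i a) := by
    refine Generates.det_seq (by simp [Prog.NoDraw, Prog.findDepth]) ?_
    obtain ⟨h1, -⟩ := Prog.exec_findDepth (s := s) (n := n) (m := m) rfl rfl (by omega)
    have hr : ∀ y < 4, (Prog.findDepth.exec s).nreg y = s.nreg y := fun y hy =>
      Prog.exec_nreg (by simp [Prog.findDepth, Prog.wregs]; omega) s
    have ha : ∀ b, (Prog.findDepth.exec s).arr b = s.arr b := fun b =>
      Prog.exec_arr (by simp [Prog.findDepth, Prog.warrs]) s
    generalize Prog.findDepth.exec s = s₁ at h1 hr ha ⊢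
    refine Generates.det_seq (by
      simp [Prog.NoDraw, Prog.prepare, Prog.buildForest, Prog.tabLoop, Prog.forN, Prog.buildTree,
        Prog.sumChildren, Prog.tabMeanReward, Prog.tabSum, Prog.sumLoop]) ?_
    obtain ⟨hP, h20⟩ := exec_prepare (M := M) (T := T) (s := s₁) (hr 0 (by decide))
      (hr 1 (by decide)) (hr 2 (by decide)) rfl (by omega) (by omega) (ha 0) (ha 1)
      (by rw [ha 2]; rfl) (by rw [ha 4]; rfl)
    have hk : MState.Keeps [5, 16, 17, 19, 20] s₁ (Prog.prepare.exec s₁) :=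
      Prog.keeps_exec (by decide) (by decide) s₁
    exact generates_mainLoop hP ((hk.1 3 (by decide)).trans (hr 3 (by decide))) h20
  have hmeas := hgen.measure (MState.output n m) (fun _ _ => rfl) (fun π i a => π i a)
    (fun π s' h => funext fun i => funext fun a => h i a)
  have hmb : Measurable fun ω => (Prog.metaProg.exec (M.inputState ε δ T K ω)).output n m :=
    fun A _ => (hmeas A).1
  refine ⟨hmb.aemeasurable, Measure.ext fun A hA => ?_⟩
  rw [Measure.map_apply hmb hA, PMF.toMeasure_apply_eq_toOuterMeasure_apply _ hA]
  exact (hmeas A).2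

end DMDP

/-! ### From operation counts to the stated run-time bound. -/

theorem depth_le {n m L : ℕ} (hn : 0 < n) (hm : 0 < m) (hL : 2 ^ L ≤ 2 * (n + m)) :
    (L : ℝ) ≤ 2 * (1 + Real.log ((n : ℝ) * m)) := by
  have hn1 : (1 : ℝ) ≤ n := Nat.one_le_cast.mpr hn
  have hm1 : (1 : ℝ) ≤ m := Nat.one_le_cast.mpr hm
  have hL' : (2 : ℝ) ^ L ≤ 2 * (n + m) := by exact_mod_cast hL
  have h1 : (2 : ℝ) ^ L ≤ 4 * ((n : ℝ) * m) := by nlinarith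
  have h2 := Real.log_le_log (by positivity) h1
  rw [Real.log_pow, Real.log_mul (by norm_num) (by positivity),
    show (4 : ℝ) = 2 ^ 2 by norm_num, Real.log_pow] at h2
  have h3 := Real.log_two_gt_d9
  have h4 : 0 ≤ Real.log ((n : ℝ) * m) := Real.log_nonneg (by nlinarith)
  push_cast at h2
  by_contra! h5
  nlinarith

namespace DMDP

variable {n m : ℕ} (M : DMDP n m) [NeZero n]

theorem isEvaluator_pure {g : Policy n m → ℝ} {η ρ : ℝ} (hρ : 0 ≤ ρ)
    (hg : ∀ π, g π ∈ Set.Icc (M.weightedValue π - η) (M.weightedValue π)) :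
    M.IsEvaluator (fun π => PMF.pure (g π)) η ρ :=
  fun π => PMF.ofReal_one_sub_le_toOuterMeasure_pure hρ (hg π)

variable [NeZero m]

/-- The dominant term is `K T L`. One logarithm comes from `T` and one from the tree depth `L`,
hence the exponent `2`. The last summand on the right is not needed to dominate anything and enters
only through its nonnegativity. -/
theorem operationCount_le {B ε δ : ℝ} (hε : ε ∈ Set.Ioo (0 : ℝ) 1) (hδ : δ ∈ Set.Ioo (0 : ℝ) 1)
    {T K L : ℕ} [NeZero K]
    (hT : T ≤ B * (1 + (n : ℝ) ^ 3 * m * Real.log ((n : ℝ) * m) /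
      ((1 - M.γ) ^ 6 * (ε / 2) ^ 2)))
    (hK : K ≤ B * Real.log (2 / δ)) (hL : 2 ^ L ≤ 2 * (n + m)) :
    (n : ℝ) ^ 2 * m + K * ((n : ℝ) ^ 2 * m + T * L) ≤
      (1 + B + 8 * B ^ 2) * (1 + Real.log ((n : ℝ) * m / (ε * (1 - M.γ)))) ^ 2 *
        ((n : ℝ) ^ 2 * m
          + (n : ℝ) ^ 3 * m / ((1 - M.γ) ^ 6 * ε ^ 2) * Real.log (2 / δ)
          + 1 / (ε ^ 2 * (1 - M.γ) ^ 2) * Real.log (2 / δ) ^ 2) := by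
  have hn0 := Nat.pos_of_ne_zero (NeZero.ne n)
  have hm0 := Nat.pos_of_ne_zero (NeZero.ne m)
  have hn1 : (1 : ℝ) ≤ n := Nat.one_le_cast.mpr hn0
  have hm1 : (1 : ℝ) ≤ m := Nat.one_le_cast.mpr hm0
  have hK1 : (1 : ℝ) ≤ K := Nat.one_le_cast.mpr (Nat.pos_of_ne_zero (NeZero.ne K))
  set θ := 1 - M.γ with hθ
  have hθ0 : 0 < θ := M.one_sub_γ_pos
  have hθ1 : θ ≤ 1 := by linarith [M.γ_nonneg]
  obtain ⟨hε0, hε1⟩ := hε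
  set l := Real.log (2 / δ) with hl
  have hl0 : 0 < l := Real.log_pos (by rw [lt_div_iff₀ hδ.1]; linarith [hδ.2])
  -- Otherwise the bound on `K` would contradict `K ≥ 1`.
  have hB : 0 < B := by
    by_contra! h
    nlinarith
  set g := (n : ℝ) ^ 3 * m / (θ ^ 6 * ε ^ 2) with hg
  set Λ := 1 + Real.log ((n : ℝ) * m / (ε * θ)) with hΛ
  have hnm : 1 ≤ (n : ℝ) * m := by nlinarith
  have hlog0 : 0 ≤ Real.log ((n : ℝ) * m) := Real.log_nonneg hnm
  have hlog : 1 + Real.log ((n : ℝ) * m) ≤ Λ := by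
    have : (n : ℝ) * m ≤ (n : ℝ) * m / (ε * θ) := by
      refine le_div_self (by positivity) (by positivity) ?_
      nlinarith
    have := Real.log_le_log (by positivity) this
    linarith
  have hΛ0 : 0 < Λ := by linarith
  have hΛ1 : 1 ≤ Λ ^ 2 := one_le_pow₀ (by linarith)
  have hden : θ ^ 6 * ε ^ 2 ≤ 1 :=
    mul_le_one₀ (pow_le_one₀ hθ0.le hθ1) (sq_nonneg ε) (pow_le_one₀ hε0.le hε1.le)
  have hgn : (n : ℝ) ^ 2 * m ≤ g := by
    have h1 : (n : ℝ) ^ 2 * m ≤ (n : ℝ) ^ 3 * m :=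
      mul_le_mul_of_nonneg_right (pow_le_pow_right₀ hn1 (by norm_num)) (by positivity)
    exact h1.trans (le_div_self (by positivity) (by positivity) hden)
  have hg1 : 1 ≤ g := by
    refine le_trans ?_ hgn
    exact one_le_mul_of_one_le_of_one_le (one_le_pow₀ hn1) hm1
  have hT' : (T : ℝ) ≤ B * (4 * g * Λ) := by
    refine hT.trans (mul_le_mul_of_nonneg_left ?_ hB.le)
    have e : (n : ℝ) ^ 3 * m * Real.log ((n : ℝ) * m) / (θ ^ 6 * (ε / 2) ^ 2) =
        4 * g * Real.log ((n : ℝ) * m) := by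
      rw [hg]
      field_simp
      ring
    rw [e]
    nlinarith
  have hL' : (L : ℝ) ≤ 2 * Λ := (depth_le hn0 hm0 hL).trans (by linarith)
  have hTL : (T : ℝ) * L ≤ B * (4 * g * Λ) * (2 * Λ) :=
    mul_le_mul hT' hL' (Nat.cast_nonneg L) (by positivity)
  have h1 : (K : ℝ) * ((n : ℝ) ^ 2 * m + T * L) ≤
      B * l * (g * Λ ^ 2 + 8 * B * (g * Λ ^ 2)) := by
    refine mul_le_mul hK ?_ (by positivity) (by positivity)
    have : g ≤ g * Λ ^ 2 := le_mul_of_one_le_right (by positivity) hΛ1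
    linarith
  have h2 : (n : ℝ) ^ 2 * m ≤ Λ ^ 2 * ((n : ℝ) ^ 2 * m) :=
    le_mul_of_one_le_left (by positivity) hΛ1
  have h3 : 0 ≤ Λ ^ 2 * (1 / (ε ^ 2 * θ ^ 2) * l ^ 2) := by positivity
  have h4 : 0 ≤ (B + 8 * B ^ 2) * (Λ ^ 2 * ((n : ℝ) ^ 2 * m)) := by positivity
  have h5 : 0 ≤ Λ ^ 2 * (g * l) := by positivity
  have h6 : 0 ≤ (B + 8 * B ^ 2) * (Λ ^ 2 * (1 / (ε ^ 2 * θ ^ 2) * l ^ 2)) := by positivity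
  calc (n : ℝ) ^ 2 * m + K * ((n : ℝ) ^ 2 * m + T * L)
      ≤ Λ ^ 2 * ((n : ℝ) ^ 2 * m) + (B + 8 * B ^ 2) * (Λ ^ 2 * (g * l)) := by linarith
    _ ≤ (1 + B + 8 * B ^ 2) * Λ ^ 2 * ((n : ℝ) ^ 2 * m + g * l + 1 / (ε ^ 2 * θ ^ 2) * l ^ 2) := by
        linarith

/-- For `n m ≥ 2` value iteration itself is a valid evaluator, with failure probability zero. For `n
m = 1` the hypothesis allows small `T` and the estimate may be poor, but there is only one policy.
The law of the output then does not depend on the evaluator, and the exact value can be taken as the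
witness. -/
theorem exists_evaluator_outputsPolicy {ε δ : ℝ} (hε : ε ∈ Set.Ioo (0 : ℝ) 1)
    (hδ : δ ∈ Set.Ioo (0 : ℝ) 1) (T K : ℕ) [NeZero T] [NeZero K]
    (hT : 1000 * ((n : ℝ) ^ 3 * m * Real.log ((n : ℝ) * m) /
      ((1 - M.γ) ^ 6 * (ε / 2) ^ 2)) ≤ T) :
    ∃ ev : Policy n m → PMF ℝ, M.IsEvaluator ev (ε / 2) (δ / (2 * K)) ∧
      Prog.metaProg.OutputsPolicy (M.inputState ε δ T K) (M.metaAlg T K ev) := by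
  have hρ : 0 ≤ δ / (2 * K) := div_nonneg hδ.1.le (by positivity)
  have hout := M.outputsPolicy_metaProg ε δ T K
  rcases Nat.lt_or_ge (n * m) 2 with h | h
  · have hm1 : m = 1 := by
      have := Nat.pos_of_ne_zero (NeZero.ne n)
      have := Nat.pos_of_ne_zero (NeZero.ne m)
      nlinarith
    subst hm1
    have hsub : ∀ π π' : Policy n 1, π = π' := fun π π' => funext fun i => Subsingleton.elim _ _
    refine ⟨fun π => PMF.pure (M.weightedValue π), M.isEvaluator_pure hρ fun π =>
      ⟨by linarith [hε.1], le_rfl⟩, ?_⟩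
    have e : M.metaAlg T K (fun π => PMF.pure (M.weightedValue π)) =
        M.metaAlg T K fun π => PMF.pure (M.valueEstimate π (T / (n * n * 1) + 1)) := by
      rw [metaAlg_pure, metaAlg_pure]
      exact congrArg (fun f => PMF.map f _) (funext fun π => hsub _ _)
    rwa [e]
  · refine ⟨_, M.isEvaluator_pure hρ fun π => ?_, hout⟩
    have h1 := M.valueEstimate_mem π (T / (n * n * m) + 1)
    have h2 := M.pow_div_le h hε hT
    exact ⟨by linarith [h1.1], h1.2⟩

end DMDP

end

theorem theorem1 :
    ∃ C : ℝ, 0 < C ∧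
    -- (i) the primal-dual method
    (∀ (n m : ℕ) [NeZero n] [NeZero m] (M : DMDP n m) (ε : ℝ), ε ∈ Set.Ioo (0 : ℝ) 1 →
      ∀ (T : ℕ) [NeZero T],
        C * ((n : ℝ) ^ 3 * m * Real.log ((n : ℝ) * m) / ((1 - M.γ) ^ 6 * ε ^ 2)) ≤ T →
        ENNReal.ofReal (2 / 3) ≤
          (M.primalDual T).toOuterMeasure {π | ∀ i, M.value π i ≥ M.optValue i - ε}) ∧
    -- (ii) the meta algorithm: quality of the output
    (∀ (n m : ℕ) [NeZero n] [NeZero m] (M : DMDP n m) (ε δ : ℝ), ε ∈ Set.Ioo (0 : ℝ) 1 →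
      δ ∈ Set.Ioo (0 : ℝ) 1 → ∀ (T K : ℕ) [NeZero T] [NeZero K] (ev : Policy n m → PMF ℝ),
        C * ((n : ℝ) ^ 3 * m * Real.log ((n : ℝ) * m) / ((1 - M.γ) ^ 6 * (ε / 2) ^ 2)) ≤ T →
        C * Real.log (1 / δ) ≤ K →
        M.IsEvaluator ev (ε / 2) (δ / (2 * K)) →
        ENNReal.ofReal (1 - δ) ≤
          (M.metaAlg T K ev).toOuterMeasure
            {π | M.weightedValue π ≥ M.weightedOptValue - ε}) ∧
    -- (ii) the meta algorithm: run time
    (∃ (c : Prog) (k : ℕ), ∀ B : ℝ, ∃ D : ℝ,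
      ∀ (n m : ℕ) [NeZero n] [NeZero m] (M : DMDP n m) (ε δ : ℝ), ε ∈ Set.Ioo (0 : ℝ) 1 →
      δ ∈ Set.Ioo (0 : ℝ) 1 → ∀ (T K : ℕ) [NeZero T] [NeZero K],
        C * ((n : ℝ) ^ 3 * m * Real.log ((n : ℝ) * m) / ((1 - M.γ) ^ 6 * (ε / 2) ^ 2)) ≤ T →
        T ≤ B * (1 + (n : ℝ) ^ 3 * m * Real.log ((n : ℝ) * m) /
          ((1 - M.γ) ^ 6 * (ε / 2) ^ 2)) →
        C * Real.log (1 / δ) ≤ K →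
        K ≤ B * Real.log (2 / δ) →
        ∃ ev : Policy n m → PMF ℝ,
          M.IsEvaluator ev (ε / 2) (δ / (2 * K)) ∧
          c.OutputsPolicy (M.inputState ε δ T K) (M.metaAlg T K ev) ∧
          ∀ ω, ((c.exec (M.inputState ε δ T K ω)).time : ℝ) ≤
            D * (1 + Real.log ((n : ℝ) * m / (ε * (1 - M.γ)))) ^ k *
              ((n : ℝ) ^ 2 * m
                + (n : ℝ) ^ 3 * m / ((1 - M.γ) ^ 6 * ε ^ 2) * Real.log (2 / δ)
                + 1 / (ε ^ 2 * (1 - M.γ) ^ 2) * Real.log (2 / δ) ^ 2)) := by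
  -- The value `1000` covers the `441` needed for a single run and leaves room for amplification and
  -- evaluation. The exponent `2` is that of `operationCount_le`; the factor `1000` in `D` is the
  -- one in `metaProg_time_le`.
  refine ⟨1000, by norm_num, ?_, ?_, Prog.metaProg, 2, fun B => ⟨1000 * (1 + B + 8 * B ^ 2), ?_⟩⟩
  · intro n m _ _ M ε hε T _ hT
    refine M.primalDual_near_optimal hε.1 T (le_trans ?_ hT)
    have hn1 : (1 : ℝ) ≤ n := Nat.one_le_cast.mpr (Nat.pos_of_ne_zero (NeZero.ne n))
    have hm1 : (1 : ℝ) ≤ m := Nat.one_le_cast.mpr (Nat.pos_of_ne_zero (NeZero.ne m))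
    have hlog : 0 ≤ Real.log ((n : ℝ) * m) := Real.log_nonneg (by nlinarith)
    have := M.one_sub_γ_pos
    exact mul_le_mul_of_nonneg_right (by norm_num) (by positivity)
  · intro n m _ _ M ε δ hε hδ T K _ _ ev hT hK hev
    exact M.metaAlg_near_optimal hε hδ T K ev hT hK hev
  · intro n m _ _ M ε δ hε hδ T K _ _ hT hTB _ hKB
    obtain ⟨ev, h1, h2⟩ := M.exists_evaluator_outputsPolicy hε hδ T K hT
    refine ⟨ev, h1, h2, fun ω => ?_⟩
    obtain ⟨L, hL, ht⟩ := M.metaProg_time_le ε δ T K ω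
    have h3 := M.operationCount_le hε hδ hTB hKB hL
    calc ((Prog.metaProg.exec (M.inputState ε δ T K ω)).time : ℝ)
        ≤ 1000 * ((n : ℝ) ^ 2 * m + K * ((n : ℝ) ^ 2 * m + T * L)) := by
          rw [sq]
          exact_mod_cast ht
      _ ≤ 1000 * _ := mul_le_mul_of_nonneg_left h3 (by norm_num)
      _ = _ := by ring
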